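/- **Setting.** All graphs are finite and simple. $MSO_1$ formulas are built from the atoms $x=y$, $xy\in E$ and $x\in X$ ($x,y$ individual variables ranging over vertices, $X$ a set variable ranging over sets of vertices) by logical connectives ($\bot,\neg,\wedge,\vee,\rightarrow$) and quantifiers over individual and set variables. A vertex problem $\mathcal P$ is a set of pairs $(G,S)$ with $S\subseteq V(G)$; it is expressed by $\Phi=\exists Z_1\,\Phi'(Z_1)$, where $\Phi'$ is an $MSO_1$ formula whose only free variable is the set variable $Z_1$, if $(G,S)\in\mathcal P\iff G\models\Phi'(S)$. Let $q\ge 1$ be the number of quantified variables of $\Phi$ (occurrences of quantifiers, including $\exists Z_1$), and let $q_v$ be the number of those that are individual variables. A cliquewidth decomposition $\mathcal D$ of width $\omega$ is a rooted tree whose nodes are of the types: introduce one vertex of color $a\in[\omega]$ (leaf), disjoint union of two colored graphs, recolor $a\to b$, add all edges between distinct vertices of colors $a$ and $b$; it is a decomposition of $G$ if the graph constructed at its root is isomorphic to $G$. For a vertex $v$ of $G$ let $Leaf_{\mathcal D}(v)$ be the leaf introducing $v$. A dynamic programming core is an algorithm $\mathfrak C$ that takes a decomposition $\mathcal D$ (of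 any width) and produces a finite set $Accept_{\mathfrak C,\mathcal D}\subseteq\{0,1\}^*$ and, for each node $t$ with $\delta(t)$ children, a finite set $Process_{\mathfrak C,\mathcal D}(t)\subseteq(\{0,1\}^*)^{\delta(t)+1}$. Let $\tau(\mathfrak C,\mathcal D)$ be the number of steps it makes, each step being a constant-time operation on pointer structures (construction and inspection of binary trees, variable access, branching, call of a recursive function), and $Size(\mathfrak C,\mathcal D)=\max_t|Process_{\mathfrak C,\mathcal D}(t)|$. A $(\mathfrak C,\mathcal D)$-witness is a map $\alpha:V(\mathcal D)\to\{0,1\}^*$ such that $(\alpha(t),\alpha(t_1),\dots,\alpha(t_{\delta(t)}))\in Process_{\mathfrak C,\mathcal D}(t)$ for every node $t$ with children $t_1,\dots,t_{\delta(t)}$, and $\alpha(\mathrm{root})\in Accept_{\mathfrak C,\mathcal D}$. The core is monotone and solves $\mathcal P$ together with the vertex-membership function $\rho:\{0,1\}^*\to\{0,1\}$ if for every graph $G$, every cliquewidth decomposition $\mathcal D$ of $G$ and every $S\subseteq V(G)$: $(G,S)\in\mathcal P$ if and only if there is a $(\mathfrak C,\mathcal D)$-witness $\alpha$ with $S=\{v\in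 V(G):\rho(\alpha(Leaf_{\mathcal D}(v)))=1\}$. Let $T_0(x)=x$ and $T_{h+1}(x)=2^{T_h(x)}$, so that $T_h(x)$ is a tower of $h$ twos with $x$ on top. **Theorem.** There is a universal constant $c>0$ such that the following holds. Let $\mathcal P$ be a vertex problem expressed by an $MSO_1$ formula $\Phi=\exists Z_1\,\Phi'(Z_1)$ with $q$ quantified variables, $q_v$ of them individual variables. Then there exists a monotone dynamic programming core $\mathfrak C$ that, together with some vertex-membership function $\rho$, solves $\mathcal P$, and such that for every $\omega$ and every cliquewidth decomposition $\mathcal D$ of width $\omega$, $$\tau(\mathfrak C,\mathcal D)\le |V(\mathcal D)|\cdot T_{q+1}\bigl(c\cdot\max\{1,\,q_v(q+\log_2\omega)\}\bigr),\qquad Size(\mathfrak C,\mathcal D)\le T_q\bigl(c\cdot\max\{1,\,q_v(q+\log_2\omega)\}\bigr).$$ -/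

import Mathlib

/-! ### Monadic second-order logic of graphs -/

/-- `MSO₁` formulas with `n` free individual (vertex) variables and `m` free set variables, in
de Bruijn style: a quantifier binds the new variable `0` and shifts the other variables of its
kind by one. -/
inductive MSO1 : ℕ → ℕ → Type
  | falsum {n m : ℕ} : MSO1 n m
  | eq {n m : ℕ} (x y : Fin n) : MSO1 n m
  | adj {n m : ℕ} (x y : Fin n) : MSO1 n m
  | mem {n m : ℕ} (x : Fin n) (X : Fin m) : MSO1 n m
  | not {n m : ℕ} (φ : MSO1 n m) : MSO1 n m
  | and {n m : ℕ} (φ ψ : MSO1 n m) : MSO1 n m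
  | or {n m : ℕ} (φ ψ : MSO1 n m) : MSO1 n m
  | imp {n m : ℕ} (φ ψ : MSO1 n m) : MSO1 n m
  | exV {n m : ℕ} (φ : MSO1 (n + 1) m) : MSO1 n m
  | allV {n m : ℕ} (φ : MSO1 (n + 1) m) : MSO1 n m
  | exS {n m : ℕ} (φ : MSO1 n (m + 1)) : MSO1 n m
  | allS {n m : ℕ} (φ : MSO1 n (m + 1)) : MSO1 n m

namespace MSO1

/-- Satisfaction of a formula in the graph `G` under assignments of the free variables. -/
def Sat {V : Type} (G : SimpleGraph V) :
    {n m : ℕ} → MSO1 n m → (Fin n → V) → (Fin m → Set V) → Prop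
  | _, _, falsum, _, _ => False
  | _, _, eq x y, s, _ => s x = s y
  | _, _, adj x y, s, _ => G.Adj (s x) (s y)
  | _, _, mem x X, s, T => s x ∈ T X
  | _, _, not φ, s, T => ¬ φ.Sat G s T
  | _, _, and φ ψ, s, T => φ.Sat G s T ∧ ψ.Sat G s T
  | _, _, or φ ψ, s, T => φ.Sat G s T ∨ ψ.Sat G s T
  | _, _, imp φ ψ, s, T => φ.Sat G s T → ψ.Sat G s T
  | _, _, exV φ, s, T => ∃ v : V, φ.Sat G (Fin.cons v s) T
  | _, _, allV φ, s, T => ∀ v : V, φ.Sat G (Fin.cons v s) T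
  | _, _, exS φ, s, T => ∃ A : Set V, φ.Sat G s (Fin.cons A T)
  | _, _, allS φ, s, T => ∀ A : Set V, φ.Sat G s (Fin.cons A T)

/-- The number of quantified individual variables. -/
def numV : {n m : ℕ} → MSO1 n m → ℕ
  | _, _, falsum => 0
  | _, _, eq _ _ => 0
  | _, _, adj _ _ => 0
  | _, _, mem _ _ => 0
  | _, _, not φ => φ.numV
  | _, _, and φ ψ => φ.numV + ψ.numV
  | _, _, or φ ψ => φ.numV + ψ.numV
  | _, _, imp φ ψ => φ.numV + ψ.numV
  | _, _, exV φ => φ.numV + 1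
  | _, _, allV φ => φ.numV + 1
  | _, _, exS φ => φ.numV
  | _, _, allS φ => φ.numV

/-- The number of quantified set variables. -/
def numS : {n m : ℕ} → MSO1 n m → ℕ
  | _, _, falsum => 0
  | _, _, eq _ _ => 0
  | _, _, adj _ _ => 0
  | _, _, mem _ _ => 0
  | _, _, not φ => φ.numS
  | _, _, and φ ψ => φ.numS + ψ.numS
  | _, _, or φ ψ => φ.numS + ψ.numS
  | _, _, imp φ ψ => φ.numS + ψ.numS
  | _, _, exV φ => φ.numS
  | _, _, allV φ => φ.numS
  | _, _, exS φ => φ.numS + 1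
  | _, _, allS φ => φ.numS + 1

/-- The number of all quantified variables. -/
def numQ {n m : ℕ} (φ : MSO1 n m) : ℕ := φ.numV + φ.numS

end MSO1

/-- A vertex problem: a set of pairs `(G, S)`, `G` a simple graph and `S` a set of vertices. -/
def VertexProblem : Type 1 := (V : Type) → SimpleGraph V → Set V → Prop

/-- The formula `φ` with one free set variable expresses the vertex problem `P` (on finite
graphs): `(G, S) ∈ P` if and only if `G ⊨ φ(S)`. -/
def VertexProblem.ExpressedBy (P : VertexProblem) (φ : MSO1 0 1) : Prop :=
  ∀ (V : Type) [Finite V] (G : SimpleGraph V) (S : Set V),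
    P V G S ↔ φ.Sat G Fin.elim0 (fun _ => S)

/-! ### Cliquewidth decompositions -/

/-- Cliquewidth decompositions of width `ω`. The vertex introduced by a leaf is identified with
that leaf, so disjointness of the vertex sets in a disjoint union is automatic. -/
inductive CWDecomp (ω : ℕ) : Type
  | intro (a : Fin ω) : CWDecomp ω
  | join (l r : CWDecomp ω) : CWDecomp ω
  | recolor (a b : Fin ω) (t : CWDecomp ω) : CWDecomp ω
  | addEdges (a b : Fin ω) (t : CWDecomp ω) : CWDecomp ω

namespace CWDecomp

variable {ω : ℕ}

/-- The vertices of the constructed graph. -/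
def Vertex : CWDecomp ω → Type
  | intro _ => Unit
  | join l r => l.Vertex ⊕ r.Vertex
  | recolor _ _ t => t.Vertex
  | addEdges _ _ t => t.Vertex

/-- The colors of the vertices of the constructed graph. -/
def color : (D : CWDecomp ω) → D.Vertex → Fin ω
  | intro a, _ => a
  | join l r, v => Sum.elim l.color r.color v
  | recolor a b t, v => if t.color v = a then b else t.color v
  | addEdges _ _ t, v => t.color v

/-- The constructed graph. -/
def graph : (D : CWDecomp ω) → SimpleGraph D.Vertex
  | intro _ => (⊥ : SimpleGraph Unit)
  | join l r => l.graph ⊕g r.graph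
  | recolor _ _ t => t.graph
  | addEdges a b t => t.graph ⊔ SimpleGraph.fromRel (fun u v => t.color u = a ∧ t.color v = b)

/-- The nodes of the decomposition tree: the root, or a node of the subtree of a child. -/
inductive Node : CWDecomp ω → Type
  | introRoot {a : Fin ω} : Node (intro a)
  | joinRoot {l r : CWDecomp ω} : Node (join l r)
  | joinLeft {l r : CWDecomp ω} (s : Node l) : Node (join l r)
  | joinRight {l r : CWDecomp ω} (s : Node r) : Node (join l r)
  | recolorRoot {a b : Fin ω} {t : CWDecomp ω} : Node (recolor a b t)
  | recolorSub {a b : Fin ω} {t : CWDecomp ω} (s : Node t) : Node (recolor a b t)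
  | addEdgesRoot {a b : Fin ω} {t : CWDecomp ω} : Node (addEdges a b t)
  | addEdgesSub {a b : Fin ω} {t : CWDecomp ω} (s : Node t) : Node (addEdges a b t)

/-- The set of nodes is finite. -/
instance instFintypeNode : (D : CWDecomp ω) → Fintype D.Node
  | intro _ => ⟨{.introRoot}, by rintro ⟨⟩; simp⟩
  | join l r =>
      haveI := instFintypeNode l
      haveI := instFintypeNode r
      Fintype.ofEquiv (Option (l.Node ⊕ r.Node))
        { toFun := fun s => match s with
            | none => .joinRoot
            | some (.inl s) => .joinLeft s
            | some (.inr s) => .joinRight s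
          invFun := fun s => match s with
            | .joinRoot => none
            | .joinLeft s => some (.inl s)
            | .joinRight s => some (.inr s)
          left_inv := by rintro (_ | s | s) <;> rfl
          right_inv := by rintro (_ | s | s) <;> rfl }
  | recolor _ _ t =>
      haveI := instFintypeNode t
      Fintype.ofEquiv (Option t.Node)
        { toFun := fun s => match s with
            | none => .recolorRoot
            | some s => .recolorSub s
          invFun := fun s => match s with
            | .recolorRoot => none
            | .recolorSub s => some s
          left_inv := by rintro (_ | s) <;> rfl
          right_inv := by rintro (_ | s) <;> rfl }
  | addEdges _ _ t =>
      haveI := instFintypeNode t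
      Fintype.ofEquiv (Option t.Node)
        { toFun := fun s => match s with
            | none => .addEdgesRoot
            | some s => .addEdgesSub s
          invFun := fun s => match s with
            | .addEdgesRoot => none
            | .addEdgesSub s => some s
          left_inv := by rintro (_ | s) <;> rfl
          right_inv := by rintro (_ | s) <;> rfl }

/-- The root of the decomposition tree. -/
def root : (D : CWDecomp ω) → D.Node
  | intro _ => .introRoot
  | join _ _ => .joinRoot
  | recolor _ _ _ => .recolorRoot
  | addEdges _ _ _ => .addEdgesRoot

/-- The ordered list of the children of a node. -/
def children : {D : CWDecomp ω} → D.Node → List D.Node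
  | _, .introRoot => []
  | join l r, .joinRoot => [.joinLeft l.root, .joinRight r.root]
  | _, .joinLeft s => (children s).map .joinLeft
  | _, .joinRight s => (children s).map .joinRight
  | recolor _ _ t, .recolorRoot => [.recolorSub t.root]
  | _, .recolorSub s => (children s).map .recolorSub
  | addEdges _ _ t, .addEdgesRoot => [.addEdgesSub t.root]
  | _, .addEdgesSub s => (children s).map .addEdgesSub

/-- The leaf of the decomposition tree that introduces a given vertex. -/
def leaf : (D : CWDecomp ω) → D.Vertex → D.Node
  | intro _, _ => .introRoot
  | join l _, Sum.inl v => .joinLeft (l.leaf v)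
  | join _ r, Sum.inr v => .joinRight (r.leaf v)
  | recolor _ _ t, v => .recolorSub (t.leaf v)
  | addEdges _ _ t, v => .addEdgesSub (t.leaf v)

end CWDecomp

/-! ### The model of computation

First-order recursive programs over binary trees built from `nil` and `cons`. Evaluating an
expression costs one step for each elementary operation performed: access to a variable, `nil`,
`cons`, case distinction (which includes access to the two components of a tree), `let`, and
function call. Each of them takes constant time on a pointer machine. -/

/-- The data of the model: binary trees. -/
inductive Data : Type
  | nil : Data
  | cons (a b : Data) : Data

/-- Expressions. Variables are de Bruijn indices into the environment; functions are unary and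
are referred to by their number in the program. -/
inductive Expr : Type
  | var (i : ℕ) : Expr
  | nil : Expr
  | cons (a b : Expr) : Expr
  | case (e n c : Expr) : Expr
  | letIn (e b : Expr) : Expr
  | call (f : ℕ) (e : Expr) : Expr

/-- A program: the list of the bodies of its functions, each with one parameter, variable `0`. -/
abbrev Program : Type := List Expr

/-- `Eval P env e v k`: in the environment `env`, the expression `e` evaluates to `v` in exactly
`k` steps. -/
inductive Eval (P : Program) : List Data → Expr → Data → ℕ → Prop
  | var {env : List Data} {i : ℕ} {v : Data} (h : env[i]? = some v) : Eval P env (.var i) v 1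
  | nil {env : List Data} : Eval P env .nil .nil 1
  | cons {env : List Data} {a b : Expr} {u v : Data} {k l : ℕ}
      (ha : Eval P env a u k) (hb : Eval P env b v l) :
      Eval P env (.cons a b) (.cons u v) (k + l + 1)
  | caseNil {env : List Data} {e n c : Expr} {v : Data} {k l : ℕ}
      (he : Eval P env e .nil k) (hn : Eval P env n v l) :
      Eval P env (.case e n c) v (k + l + 1)
  | caseCons {env : List Data} {e n c : Expr} {u w v : Data} {k l : ℕ}
      (he : Eval P env e (.cons u w) k) (hc : Eval P (u :: w :: env) c v l) :
      Eval P env (.case e n c) v (k + l + 1)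
  | letIn {env : List Data} {e b : Expr} {u v : Data} {k l : ℕ}
      (he : Eval P env e u k) (hb : Eval P (u :: env) b v l) :
      Eval P env (.letIn e b) v (k + l + 1)
  | call {env : List Data} {f : ℕ} {e b : Expr} {u v : Data} {k l : ℕ}
      (he : Eval P env e u k) (hf : P[f]? = some b) (hb : Eval P [u] b v l) :
      Eval P env (.call f e) v (k + l + 1)

/-- Evaluation is deterministic, so that the result and the number of steps are well defined. -/
theorem Eval.unique {P : Program} {env : List Data} {e : Expr} {v v' : Data} {k k' : ℕ}
    (h : Eval P env e v k) (h' : Eval P env e v' k') : v = v' ∧ k = k' := by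
  induction h generalizing v' k' with
  | var h => cases h' with | var h2 => simp_all
  | nil => cases h' with | nil => simp
  | cons ha hb iha ihb =>
    cases h' with
    | cons ha' hb' =>
      obtain ⟨rfl, rfl⟩ := iha ha'
      obtain ⟨rfl, rfl⟩ := ihb hb'
      simp
  | caseNil he hn ihe ihn =>
    cases h' with
    | caseNil he' hn' =>
      obtain ⟨_, rfl⟩ := ihe he'
      obtain ⟨rfl, rfl⟩ := ihn hn'
      simp
    | caseCons he' hc' => exact absurd (ihe he').1 (by simp)
  | caseCons he hc ihe ihc =>
    cases h' with
    | caseNil he' hn' => exact absurd (ihe he').1 (by simp)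
    | caseCons he' hc' =>
      obtain ⟨h1, rfl⟩ := ihe he'
      cases h1
      obtain ⟨rfl, rfl⟩ := ihc hc'
      simp
  | letIn he hb ihe ihb =>
    cases h' with
    | letIn he' hb' =>
      obtain ⟨rfl, rfl⟩ := ihe he'
      obtain ⟨rfl, rfl⟩ := ihb hb'
      simp
  | call he hf hb ihe ihb =>
    cases h' with
    | call he' hf' hb' =>
      obtain ⟨rfl, rfl⟩ := ihe he'
      rw [hf] at hf'
      cases hf'
      obtain ⟨rfl, rfl⟩ := ihb hb'
      simp

/-- The program `P`, started with its function number `0` on the input `x`, halts with output `y`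
after exactly `k` steps. -/
def Program.Computes (P : Program) (x y : Data) (k : ℕ) : Prop :=
  Eval P [x] (.call 0 (.var 0)) y k

/-! ### Encodings of inputs and outputs -/

/-- Words over the alphabet `{0, 1}`. -/
abbrev Word : Type := List Bool

namespace Data

/-- Encoding of bits. -/
def ofBool : Bool → Data
  | false => nil
  | true => cons nil nil

/-- Encoding of lists. -/
def ofList {α : Type} (f : α → Data) : List α → Data
  | [] => nil
  | x :: l => cons (f x) (ofList f l)

/-- Encoding of words. -/
def ofWord (w : Word) : Data := ofList ofBool w

/-- Encoding of natural numbers, by their binary expansions. -/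
def ofNat (n : ℕ) : Data := ofWord n.bits

end Data

namespace CWDecomp

variable {ω : ℕ}

/-- Encoding of a decomposition tree: a two-bit tag for the type of the root, followed by its
colors and its subtrees. -/
def encode : CWDecomp ω → Data
  | intro a => .cons (.cons (.ofBool false) (.ofBool false)) (.ofNat a)
  | join l r => .cons (.cons (.ofBool false) (.ofBool true)) (.cons l.encode r.encode)
  | recolor a b t =>
      .cons (.cons (.ofBool true) (.ofBool false)) (.cons (.cons (.ofNat a) (.ofNat b)) t.encode)
  | addEdges a b t =>
      .cons (.cons (.ofBool true) (.ofBool true)) (.cons (.cons (.ofNat a) (.ofNat b)) t.encode)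

/-- The input of an algorithm that works on decompositions: the width and the tree. -/
def input (D : CWDecomp ω) : Data := .cons (.ofNat ω) D.encode

/-- Encoding of a table with one entry for each node, as a tree of the shape of `D`. -/
def encodeTable : (D : CWDecomp ω) → (D.Node → Data) → Data
  | intro _, f => f .introRoot
  | join l r, f =>
      .cons (f .joinRoot) (.cons (l.encodeTable (fun s => f (.joinLeft s)))
        (r.encodeTable (fun s => f (.joinRight s))))
  | recolor _ _ t, f => .cons (f .recolorRoot) (t.encodeTable (fun s => f (.recolorSub s)))
  | addEdges _ _ t, f => .cons (f .addEdgesRoot) (t.encodeTable (fun s => f (.addEdgesSub s)))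

end CWDecomp

/-! ### Dynamic programming cores -/

/-- A dynamic programming core: a program that, for every decomposition `D` of any width, computes
a finite set `accept D` of words and, for each node `t` with `δ` children, a finite set
`process D t` of `(δ + 1)`-tuples of words. Finite sets are given by lists of their elements,
tuples by lists; `time D` is the number of steps that the program makes on `D`. -/
structure DPCore where
  prog : Program
  accept : {ω : ℕ} → CWDecomp ω → List Word
  process : {ω : ℕ} → (D : CWDecomp ω) → D.Node → List (List Word)
  time : {ω : ℕ} → CWDecomp ω → ℕ
  length_eq : ∀ {ω : ℕ} (D : CWDecomp ω) (t : D.Node), ∀ e ∈ process D t,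
    e.length = (CWDecomp.children t).length + 1
  computes : ∀ {ω : ℕ} (D : CWDecomp ω),
    prog.Computes D.input
      (.cons (.ofList .ofWord (accept D))
        (D.encodeTable (fun t => .ofList (.ofList .ofWord) (process D t))))
      (time D)

namespace DPCore

variable {ω : ℕ}

/-- The maximal number of elements of a set `process D t`, over all nodes `t`. -/
def size (𝔠 : DPCore) (D : CWDecomp ω) : ℕ :=
  Finset.univ.sup (fun t : D.Node => (𝔠.process D t).toFinset.card)

/-- The function `α` from the nodes of `D` to words is an (accepting) witness. -/
def IsWitness (𝔠 : DPCore) (D : CWDecomp ω) (α : D.Node → Word) : Prop :=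
  (∀ t : D.Node, α t :: (CWDecomp.children t).map α ∈ 𝔠.process D t) ∧ α D.root ∈ 𝔠.accept D

/-- `ρ` is a vertex-membership function with which the core `𝔠` solves the vertex problem `P`. The
isomorphism `i` exhibits `D` as a cliquewidth decomposition of `G`. -/
def Solves (𝔠 : DPCore) (ρ : Word → Bool) (P : VertexProblem) : Prop :=
  ∀ (V : Type) (G : SimpleGraph V) (ω : ℕ) (D : CWDecomp ω) (i : G ≃g D.graph) (S : Set V),
    P V G S ↔ ∃ α : D.Node → Word, 𝔠.IsWitness D α ∧ S = {v : V | ρ (α (D.leaf (i v))) = true}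

/-- The core `𝔠` is monotone (for the vertex problem `P`): it has a vertex-membership function. -/
def Monotone (𝔠 : DPCore) (P : VertexProblem) : Prop :=
  ∃ ρ : Word → Bool, 𝔠.Solves ρ P

end DPCore

/-! ### Exponential towers -/

/-- The exponential tower of `h` twos with `x` on top. -/
noncomputable def expTower : ℕ → ℝ → ℝ
  | 0, x => x
  | h + 1, x => (2 : ℝ) ^ expTower h x

/-- The quantity `max {1, q_v (q + log ω)}`. -/
noncomputable def msoParam (q qv ω : ℕ) : ℝ :=
  max 1 ((qv : ℝ) * ((q : ℝ) + Real.logb 2 (ω : ℝ)))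

/-! The core is a deterministic bottom-up automaton on decompositions, obtained from a small base
automaton by one subset construction for each quantifier of Φ'; the bounds come from counting its
states.

`exists_prenex` brings Φ' into prenex form without changing the number of quantifiers of either
kind. A labelling gives each vertex one bit per variable, so vertex variables also denote vertex
sets. For each vertex variable the base automaton remembers whether its set is so far empty, has
several elements, or is a single vertex; in the last case also the color and label of this vertex
and its adjacency to the other vertex variables. Set variables need no memory, since their contents
can be read in the labels. Hence there are at most (2 + 2^O(q + log ω))^q_v = 2^O(q_v (q + log ω))
base states. `baseRun_vert` is the invariant of the records. `qsat_iff_satAt` passes from vertices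
to arbitrary sets: if a vertex variable does not receive exactly one vertex, the outermost such
variable decides, negatively under ∃ and positively under ∀.

Quantifiers are removed from the inside. A state of the next automaton is the set of states that the
previous one can reach when the bit of the quantified variable varies. Determinism of the previous
automaton makes this set a function of the sets at the children (`table_join`, `table_unary`,
`leaf_spec`). The set is accepted if some member is accepted, or if all are, according to the
quantifier (`acc_spec`), so ∀ costs no complementation. The q - 1 quantifiers of Φ' lead to
T_{q-1}(2^O(q_v (q + log ω))) states, a tower of height q.

A word of a witness is a bit followed by a state. At a leaf the bit is membership in S; elsewhere it
is arbitrary. The states are forced by the bits of the leaves (`rootState_of_isLocal`), and every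
choice of these bits extends to a locally consistent assignment (`exists_isLocal`).

The constant is universal because a single function, `nodeFn`, receives the description of the
formula as part of its input and is computable in time polynomial in `nodeMeasure`. The polynomial
is therefore the same for all formulas (`exists_core_of_params`). Towers absorb constant factors and
powers into their top (`mul_expTower_le`). If q_v = 0 the bounds may not depend on ω, and then the
colors are erased beforehand. -/

/-! ### Linking programs -/

namespace Expr

/-- Add `n` to all function numbers. -/
def shift (n : ℕ) : Expr → Expr
  | var i => var i
  | nil => nil
  | cons a b => cons (a.shift n) (b.shift n)
  | case e x y => case (e.shift n) (x.shift n) (y.shift n)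
  | letIn e b => letIn (e.shift n) (b.shift n)
  | call f e => call (n + f) (e.shift n)

/-- An expression that builds a given tree. -/
def ofData : Data → Expr
  | .nil => nil
  | .cons a b => cons (ofData a) (ofData b)

end Expr

theorem Eval.append {P : Program} (Q : Program) {env : List Data} {e : Expr} {v : Data} {k : ℕ}
    (h : Eval P env e v k) : Eval (P ++ Q) env e v k := by
  induction h with
  | var h => exact .var h
  | nil => exact .nil
  | cons _ _ iha ihb => exact .cons iha ihb
  | caseNil _ _ iha ihb => exact .caseNil iha ihb
  | caseCons _ _ iha ihb => exact .caseCons iha ihb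
  | letIn _ _ iha ihb => exact .letIn iha ihb
  | call _ hf _ iha ihb =>
    exact .call iha ((List.getElem?_append_left (List.getElem?_eq_some_iff.1 hf).1).trans hf) ihb

theorem Eval.shift (P : Program) {Q : Program} {env : List Data} {e : Expr} {v : Data} {k : ℕ}
    (h : Eval Q env e v k) : Eval (P ++ Q.map (Expr.shift P.length)) env (e.shift P.length) v k := by
  induction h with
  | var h => exact .var h
  | nil => exact .nil
  | cons _ _ iha ihb => exact .cons iha ihb
  | caseNil _ _ iha ihb => exact .caseNil iha ihb
  | caseCons _ _ iha ihb => exact .caseCons iha ihb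
  | letIn _ _ iha ihb => exact .letIn iha ihb
  | call _ hf _ iha ihb =>
    refine .call iha ?_ ihb
    rw [List.getElem?_append_right (by omega)]
    simp [hf]

/-! ### Evaluation with a time bound -/

/-- Evaluation in at most `n` steps. -/
def EvalLe (P : Program) (env : List Data) (e : Expr) (v : Data) (n : ℕ) : Prop :=
  ∃ k ≤ n, Eval P env e v k

namespace EvalLe

variable {P : Program} {env : List Data}

theorem mono {e : Expr} {v : Data} {n m : ℕ} (h : EvalLe P env e v n) (hnm : n ≤ m) :
    EvalLe P env e v m :=
  let ⟨k, hk, h⟩ := h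
  ⟨k, hk.trans hnm, h⟩

theorem var {i : ℕ} {v : Data} (h : env[i]? = some v) : EvalLe P env (.var i) v 1 :=
  ⟨1, le_rfl, .var h⟩

theorem nil : EvalLe P env .nil .nil 1 := ⟨1, le_rfl, .nil⟩

theorem cons {a b : Expr} {u v : Data} {k l : ℕ} (ha : EvalLe P env a u k)
    (hb : EvalLe P env b v l) : EvalLe P env (.cons a b) (.cons u v) (k + l + 1) :=
  let ⟨_, hk, ha⟩ := ha
  let ⟨_, hl, hb⟩ := hb
  ⟨_, by omega, .cons ha hb⟩

theorem caseNil {e n c : Expr} {v : Data} {k l : ℕ} (ha : EvalLe P env e .nil k)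
    (hb : EvalLe P env n v l) : EvalLe P env (.case e n c) v (k + l + 1) :=
  let ⟨_, hk, ha⟩ := ha
  let ⟨_, hl, hb⟩ := hb
  ⟨_, by omega, .caseNil ha hb⟩

theorem caseCons {e n c : Expr} {u w v : Data} {k l : ℕ} (ha : EvalLe P env e (.cons u w) k)
    (hb : EvalLe P (u :: w :: env) c v l) : EvalLe P env (.case e n c) v (k + l + 1) :=
  let ⟨_, hk, ha⟩ := ha
  let ⟨_, hl, hb⟩ := hb
  ⟨_, by omega, .caseCons ha hb⟩

theorem call {f : ℕ} {e b : Expr} {u v : Data} {k l : ℕ} (ha : EvalLe P env e u k)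
    (hf : P[f]? = some b) (hb : EvalLe P [u] b v l) : EvalLe P env (.call f e) v (k + l + 1) :=
  let ⟨_, hk, ha⟩ := ha
  let ⟨_, hl, hb⟩ := hb
  ⟨_, by omega, .call ha hf hb⟩

theorem append (Q : Program) {e : Expr} {v : Data} {n : ℕ} (h : EvalLe P env e v n) :
    EvalLe (P ++ Q) env e v n :=
  let ⟨k, hk, h⟩ := h
  ⟨k, hk, h.append Q⟩

theorem shift (Q : Program) {e : Expr} {v : Data} {n : ℕ} (h : EvalLe P env e v n) :
    EvalLe (Q ++ P.map (Expr.shift Q.length)) env (e.shift Q.length) v n :=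
  let ⟨k, hk, h⟩ := h
  ⟨k, hk, h.shift Q⟩

end EvalLe

/-! ### Typed encodings -/

/-- The number of nodes of a binary tree. -/
def Data.size : Data → ℕ
  | .nil => 1
  | .cons a b => a.size + b.size + 1

theorem EvalLe.ofData {P : Program} {env : List Data} (d : Data) :
    EvalLe P env (.ofData d) d d.size := by
  induction d with
  | nil => exact .nil
  | cons a b iha ihb => exact iha.cons ihb

/-- Types whose elements are represented by binary trees. -/
class Enc (α : Type) where
  enc : α → Data
  inj : Function.Injective enc

open Enc

instance : Enc Data := ⟨id, Function.injective_id⟩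

instance : Enc Bool := ⟨Data.ofBool, by rintro (_ | _) (_ | _) h <;> simp_all [Data.ofBool]⟩

instance {α : Type} [Enc α] : Enc (List α) :=
  ⟨Data.ofList enc, by
    intro l
    induction l with
    | nil => rintro (_ | _) h <;> simp_all [Data.ofList]
    | cons a l ih =>
      rintro (_ | _) h
      · simp_all [Data.ofList]
      · simp only [Data.ofList, Data.cons.injEq] at h
        rw [inj h.1, ih h.2]⟩

instance {α β : Type} [Enc α] [Enc β] : Enc (α × β) :=
  ⟨fun x => .cons (enc x.1) (enc x.2), by
    rintro ⟨a, b⟩ ⟨c, d⟩ h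
    simp only [Data.cons.injEq] at h
    rw [inj h.1, inj h.2]⟩

instance {α : Type} [Enc α] : Enc (Option α) :=
  ⟨fun x => x.elim .nil (fun a => .cons .nil (enc a)), by
    rintro (_ | a) (_ | b) h <;> simp_all
    exact inj h⟩

section

variable {α β γ δ ε : Type} [Enc α] [Enc β] [Enc γ] [Enc δ] [Enc ε]

/-- The size of the encoding. -/
def sz (x : α) : ℕ := (enc x).size

theorem enc_data (d : Data) : enc d = d := rfl
theorem enc_false : enc false = .nil := rfl
theorem enc_true : enc true = .cons .nil .nil := rfl
theorem enc_cons (a : α) (l : List α) : enc (a :: l) = .cons (enc a) (enc l) := rfl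
theorem enc_some (a : α) : enc (some a) = .cons .nil (enc a) := rfl

theorem size_pos (d : Data) : 1 ≤ d.size := by cases d <;> simp [Data.size]
theorem sz_pos (x : α) : 1 ≤ sz x := size_pos _
theorem sz_data (d : Data) : sz d = d.size := rfl
theorem sz_nil : sz ([] : List α) = 1 := rfl
theorem sz_cons (a : α) (l : List α) : sz (a :: l) = sz a + sz l + 1 := rfl
theorem sz_pair (a : α) (b : β) : sz (a, b) = sz a + sz b + 1 := rfl
theorem sz_none : sz (none : Option α) = 1 := rfl
theorem sz_some (a : α) : sz (some a) = sz a + 2 := by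
  simp only [sz, enc_some, Data.size]; omega
theorem sz_bool (b : Bool) : sz b ≤ 3 := by cases b <;> simp [sz, enc_true, enc_false, Data.size]

/-! ### Computable functions with a time bound -/

/-- Function number `i` of `P` computes `f` in time `B`. -/
def Impl (P : Program) (i : ℕ) (f : α → β) (B : α → ℕ) : Prop :=
  ∃ b, P[i]? = some b ∧ ∀ x, EvalLe P [enc x] b (enc (f x)) (B x)

/-- Some program computes `f` in time `B`. -/
def Comp (f : α → β) (B : α → ℕ) : Prop := ∃ P, Impl P 0 f B

theorem Impl.call {P : Program} {i : ℕ} {f : α → β} {B : α → ℕ} (h : Impl P i f B)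
    {env : List Data} {e : Expr} {x : α} {k : ℕ} (he : EvalLe P env e (enc x) k) :
    EvalLe P env (.call i e) (enc (f x)) (k + B x + 1) :=
  let ⟨_, hb, h⟩ := h
  he.call hb (h x)

theorem Impl.append {P : Program} (Q : Program) {i : ℕ} {f : α → β} {B : α → ℕ}
    (h : Impl P i f B) : Impl (P ++ Q) i f B :=
  let ⟨b, hb, h⟩ := h
  ⟨b, (List.getElem?_append_left (List.getElem?_eq_some_iff.1 hb).1).trans hb,
    fun x => (h x).append Q⟩

theorem Impl.shift {P : Program} (Q : Program) {i : ℕ} {f : α → β} {B : α → ℕ}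
    (h : Impl P i f B) : Impl (Q ++ P.map (Expr.shift Q.length)) (Q.length + i) f B :=
  let ⟨b, hb, h⟩ := h
  ⟨b.shift Q.length, by rw [List.getElem?_append_right (by omega)]; simp [hb],
    fun x => (h x).shift Q⟩

theorem Comp.mono {f : α → β} {B C : α → ℕ} (h : Comp f B) (hBC : ∀ x, B x ≤ C x) : Comp f C :=
  let ⟨P, b, hb, h⟩ := h
  ⟨P, b, hb, fun x => (h x).mono (hBC x)⟩

/-- `P` extends `H`. -/
def Extends (P H : Program) : Prop := ∀ {m : ℕ} {b : Expr}, H[m]? = some b → P[m]? = some b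

theorem link1 {f : α → β} {Bf : α → ℕ} (hf : Comp f Bf) (H : Program) :
    ∃ P, Extends P H ∧ Impl P H.length f Bf := by
  obtain ⟨P, hf⟩ := hf
  exact ⟨_, fun h => (List.getElem?_append_left (List.getElem?_eq_some_iff.1 h).1).trans h,
    hf.shift H⟩

/-- The positions `i` and `j` depend only on the length of the header `H`, so the bodies in `H` can
be written afterwards and call them. -/
theorem link2 {f : α → β} {Bf : α → ℕ} {g : γ → δ} {Bg : γ → ℕ} (hf : Comp f Bf) (hg : Comp g Bg)
    (n : ℕ) : ∃ i j, ∀ H : Program, H.length = n →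
      ∃ P, Extends P H ∧ Impl P i f Bf ∧ Impl P j g Bg := by
  obtain ⟨P, hf⟩ := hf
  refine ⟨n, n + P.length, ?_⟩
  rintro H rfl
  have h1 := hf.shift H
  obtain ⟨Q, h2, h3⟩ := link1 hg (H ++ P.map (Expr.shift H.length))
  obtain ⟨R, hR⟩ := hg
  refine ⟨_, fun h => ?_, h1.append (R.map (Expr.shift (H ++ P.map (Expr.shift H.length)).length)),
    ?_⟩
  · rw [List.append_assoc]
    exact (List.getElem?_append_left (List.getElem?_eq_some_iff.1 h).1).trans h
  · simpa using hR.shift (H ++ P.map (Expr.shift H.length))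

theorem Comp.of_expr {f : α → β} {B : α → ℕ} (b : Expr)
    (h : ∀ x, EvalLe [b] [enc x] b (enc (f x)) (B x)) : Comp f B :=
  ⟨[b], b, rfl, h⟩

theorem Comp.id : Comp (fun x : α => x) (fun _ => 1) := .of_expr (.var 0) fun _ => .var rfl

theorem Comp.cast {f : α → β} (h : ∀ x, enc (f x) = enc x) : Comp f (fun _ => 1) :=
  .of_expr (.var 0) fun _ => .var (by simp [h])

theorem Comp.const (c : β) : Comp (fun _ : α => c) (fun _ => sz c) :=
  .of_expr (.ofData (enc c)) fun _ => .ofData _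

theorem Comp.fst : Comp (fun x : α × β => x.1) (fun _ => 3) :=
  .of_expr (.case (.var 0) .nil (.var 0)) fun _ => .caseCons (.var rfl) (.var rfl)

theorem Comp.snd : Comp (fun x : α × β => x.2) (fun _ => 3) :=
  .of_expr (.case (.var 0) .nil (.var 1)) fun _ => .caseCons (.var rfl) (.var rfl)

theorem Comp.comp {f : α → β} {Bf : α → ℕ} {g : β → γ} {Bg : β → ℕ} (hg : Comp g Bg)
    (hf : Comp f Bf) : Comp (fun x => g (f x)) (fun x => Bf x + Bg (f x) + 3) := by
  obtain ⟨i, j, H⟩ := link2 hf hg 1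
  obtain ⟨P, hP, hf, hg⟩ := H [.call j (.call i (.var 0))] rfl
  exact ⟨P, _, hP (m := 0) rfl, fun x => (hg.call (hf.call (.var rfl))).mono
    (by simp only; omega)⟩

theorem Comp.pair {f : α → β} {Bf : α → ℕ} {g : α → γ} {Bg : α → ℕ} (hf : Comp f Bf)
    (hg : Comp g Bg) : Comp (fun x => (f x, g x)) (fun x => Bf x + Bg x + 5) := by
  obtain ⟨i, j, H⟩ := link2 hf hg 1
  obtain ⟨P, hP, hf, hg⟩ := H [.cons (.call i (.var 0)) (.call j (.var 0))] rfl
  exact ⟨P, _, hP (m := 0) rfl, fun x => ((hf.call (.var rfl)).cons (hg.call (.var rfl))).mono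
    (by simp only; omega)⟩

theorem Comp.cond {f : α → β} {Bf : α → ℕ} {g : α → β} {Bg : α → ℕ}
    (hf : Comp f Bf) (hg : Comp g Bg) :
    Comp (fun x : Bool × α => bif x.1 then f x.2 else g x.2) (fun x => Bf x.2 + Bg x.2 + 7) := by
  obtain ⟨i, j, H⟩ := link2 hf hg 1
  obtain ⟨P, hP, hf, hg⟩ := H [.case (.var 0) .nil
    (.case (.var 0) (.call j (.var 1)) (.call i (.var 3)))] rfl
  refine ⟨P, _, hP (m := 0) rfl, fun ⟨b, x⟩ => ?_⟩
  cases b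
  · exact (EvalLe.caseCons (.var rfl) (.caseNil (.var rfl) (hg.call (.var rfl)))).mono
      (by simp only; omega)
  · exact (EvalLe.caseCons (.var rfl) (.caseCons (.var rfl) (hf.call (.var rfl)))).mono
      (by simp only; omega)

theorem Comp.optionCase {f : α → β} {Bf : α → ℕ} {g : α × γ → β} {Bg : α × γ → ℕ}
    (hf : Comp f Bf) (hg : Comp g Bg) :
    Comp (fun x : α × Option γ => x.2.elim (f x.1) (fun a => g (x.1, a)))
      (fun x => x.2.elim (Bf x.1) (fun a => Bg (x.1, a)) + 9) := by
  obtain ⟨i, j, H⟩ := link2 hf hg 1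
  obtain ⟨P, hP, hf, hg⟩ := H [.case (.var 0) .nil
    (.case (.var 1) (.call i (.var 0)) (.call j (.cons (.var 2) (.var 1))))] rfl
  refine ⟨P, _, hP (m := 0) rfl, fun ⟨x, l⟩ => ?_⟩
  cases l with
  | none =>
    exact (EvalLe.caseCons (.var rfl) (.caseNil (.var rfl) (hf.call (.var rfl)))).mono
      (by simp only [Option.elim]; omega)
  | some a =>
    exact (EvalLe.caseCons (.var rfl) (.caseCons (.var rfl)
      (hg.call (x := (x, a)) (.cons (.var rfl) (.var rfl))))).mono
      (by simp only [Option.elim]; omega)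

/-- The time of the evaluation of a fold. -/
def foldTime (Bf : α → ℕ) (s : α × (γ × β) → β) (f : α → β) (Bs : α × (γ × β) → ℕ) (p : α) :
    List γ → ℕ
  | [] => Bf p + 7
  | a :: l => Bs (p, (a, l.foldr (fun a r => s (p, (a, r))) (f p))) +
      foldTime Bf s f Bs p l + 15

/-- The program recurses through its own entry `0`. Functions are unary and have no closures, so the
parameter travels with the list. -/
theorem Comp.foldr {f : α → β} {Bf : α → ℕ} {s : α × (γ × β) → β} {Bs : α × (γ × β) → ℕ}
    (hf : Comp f Bf) (hs : Comp s Bs) :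
    Comp (fun x : α × List γ => x.2.foldr (fun a r => s (x.1, (a, r))) (f x.1))
      (fun x => foldTime Bf s f Bs x.1 x.2) := by
  obtain ⟨i, j, H⟩ := link2 hf hs 1
  obtain ⟨P, hP, hf, hs⟩ := H [.case (.var 0) .nil (.case (.var 1) (.call i (.var 0))
    (.call j (.cons (.var 2) (.cons (.var 0) (.call 0 (.cons (.var 2) (.var 1)))))))] rfl
  refine ⟨P, _, hP (m := 0) rfl, fun ⟨p, l⟩ => ?_⟩
  induction l with
  | nil =>
    exact (EvalLe.caseCons (.var rfl) (.caseNil (.var rfl) (hf.call (.var rfl)))).mono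
      (by simp only [foldTime]; omega)
  | cons a l ih =>
    exact (EvalLe.caseCons (.var rfl) (.caseCons (.var rfl) (hs.call
      (x := (p, (a, l.foldr (fun a r => s (p, (a, r))) (f p))))
      (.cons (.var rfl) (.cons (.var rfl) (.call (.cons (.var rfl) (.var rfl)) (hP (m := 0) rfl) ih)))))).mono
      (by simp only [foldTime]; omega)

theorem Comp.zip : Comp (fun x : List α × List β => x.1.zip x.2) (fun x => 20 * x.1.length + 10) := by
  let b : Expr := .case (.var 0) .nil (.case (.var 0) .nil (.case (.var 3) .nil
    (.cons (.cons (.var 2) (.var 0)) (.call 0 (.cons (.var 3) (.var 1))))))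
  refine .of_expr b fun ⟨l, m⟩ => ?_
  induction l generalizing m with
  | nil => exact (EvalLe.caseCons (.var rfl) (.caseNil (.var rfl) .nil)).mono (by simp)
  | cons a l ih =>
    cases m with
    | nil =>
      exact (EvalLe.caseCons (.var rfl) (.caseCons (.var rfl) (.caseNil (.var rfl) .nil))).mono
        (by simp only [List.length_cons]; omega)
    | cons c m =>
      exact (EvalLe.caseCons (.var rfl) (.caseCons (.var rfl) (.caseCons (.var rfl)
        (.cons (.cons (.var rfl) (.var rfl)) (.call (.cons (.var rfl) (.var rfl)) rfl
          (ih m)))))).mono (by simp only [List.length_cons]; omega)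

/-- Equality of binary trees. -/
def Data.beq : Data → Data → Bool
  | .nil, .nil => true
  | .nil, .cons _ _ => false
  | .cons _ _, .nil => false
  | .cons a b, .cons c d => bif a.beq c then b.beq d else false

theorem Data.beq_iff (x y : Data) : x.beq y = true ↔ x = y := by
  induction x generalizing y with
  | nil => cases y <;> simp [Data.beq]
  | cons a b iha ihb => cases y <;> simp [Data.beq, ← iha, ← ihb, Bool.cond_eq_ite]

theorem Comp.dataBeq : Comp (fun x : Data × Data => x.1.beq x.2) (fun x => 30 * x.1.size) := by
  let t : Expr := .cons .nil .nil
  let b : Expr := .case (.var 0) .nil (.case (.var 0) (.case (.var 1) t .nil)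
    (.case (.var 3) .nil (.case (.call 0 (.cons (.var 2) (.var 0))) .nil
      (.call 0 (.cons (.var 5) (.var 3))))))
  refine .of_expr b fun ⟨x, y⟩ => ?_
  simp only
  induction x generalizing y with
  | nil =>
    cases y with
    | nil =>
      exact (EvalLe.caseCons (.var rfl) (.caseNil (.var rfl) (.caseNil (.var rfl)
        (.cons .nil .nil)))).mono (by simp [Data.size])
    | cons c d =>
      exact (EvalLe.caseCons (.var rfl) (.caseNil (.var rfl) (.caseCons (.var rfl)
        .nil))).mono (by simp [Data.size])
  | cons a b iha ihb =>
    cases y with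
    | nil =>
      exact (EvalLe.caseCons (.var rfl) (.caseCons (.var rfl) (.caseNil (.var rfl)
        .nil))).mono (by simp only [Data.size]; omega)
    | cons c d =>
      have iha := iha c
      have ihb := ihb d
      rw [Data.beq]
      cases h : a.beq c with
      | false =>
        rw [h] at iha
        exact (EvalLe.caseCons (.var rfl) (.caseCons (.var rfl) (.caseCons (.var rfl)
          (.caseNil (.call (.cons (.var rfl) (.var rfl)) rfl iha) .nil)))).mono
          (by simp only [Data.size]; omega)
      | true =>
        rw [h] at iha
        exact (EvalLe.caseCons (.var rfl) (.caseCons (.var rfl) (.caseCons (.var rfl)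
          (.caseCons (.call (.cons (.var rfl) (.var rfl)) rfl iha)
            (.call (.cons (.var rfl) (.var rfl)) rfl ihb))))).mono
          (by simp only [Data.size]; omega)

end

section

variable {α β γ δ ε : Type} [Enc α] [Enc β] [Enc γ] [Enc δ] [Enc ε]

/-! ### Polynomial bounds -/

/-- The function `g` is bounded by a polynomial in the measure `μ`. -/
def PolyBd {ε : Type} (μ g : ε → ℕ) : Prop := ∃ C k : ℕ, ∀ x, g x ≤ C * (μ x + 1) ^ k

namespace PolyBd

variable {ε α : Type} {μ g h : ε → ℕ}

theorem mono (hh : PolyBd μ h) (hgh : ∀ x, g x ≤ h x) : PolyBd μ g :=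
  let ⟨C, k, hC⟩ := hh
  ⟨C, k, fun x => (hgh x).trans (hC x)⟩

theorem const (c : ℕ) : PolyBd μ (fun _ => c) := ⟨c, 0, fun x => by simp⟩

theorem self : PolyBd μ μ := ⟨1, 1, fun x => by simp⟩

theorem add (hg : PolyBd μ g) (hh : PolyBd μ h) : PolyBd μ (fun x => g x + h x) := by
  obtain ⟨C, k, hC⟩ := hg
  obtain ⟨D, l, hD⟩ := hh
  refine ⟨C + D, k + l, fun x => ?_⟩
  have h1 : (μ x + 1) ^ k ≤ (μ x + 1) ^ (k + l) := Nat.pow_le_pow_right (by omega) (by omega)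
  have h2 : (μ x + 1) ^ l ≤ (μ x + 1) ^ (k + l) := Nat.pow_le_pow_right (by omega) (by omega)
  calc g x + h x ≤ C * (μ x + 1) ^ k + D * (μ x + 1) ^ l := add_le_add (hC x) (hD x)
    _ ≤ C * (μ x + 1) ^ (k + l) + D * (μ x + 1) ^ (k + l) := by gcongr
    _ = _ := by ring

theorem mul (hg : PolyBd μ g) (hh : PolyBd μ h) : PolyBd μ (fun x => g x * h x) := by
  obtain ⟨C, k, hC⟩ := hg
  obtain ⟨D, l, hD⟩ := hh
  refine ⟨C * D, k + l, fun x => ?_⟩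
  calc g x * h x ≤ (C * (μ x + 1) ^ k) * (D * (μ x + 1) ^ l) := mul_le_mul' (hC x) (hD x)
    _ = _ := by ring

theorem pow (hg : PolyBd μ g) (n : ℕ) : PolyBd μ (fun x => g x ^ n) := by
  induction n with
  | zero => simpa using const 1
  | succ n ih => simpa [pow_succ] using ih.mul hg

theorem comp {ν k : α → ℕ} (hk : PolyBd ν k) {f : ε → α} (hf : PolyBd μ (fun x => ν (f x))) :
    PolyBd μ (fun x => k (f x)) := by
  obtain ⟨C, k, hC⟩ := hk
  exact (((const C).mul ((hf.add (const 1)).pow k))).mono fun x => hC (f x)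

end PolyBd

/-! ### Functions computable in polynomial time -/

/-- The function `f` is computable in time polynomial in the measure `μ`, and so is the size of its
values. -/
def PTm {ε : Type} [Enc ε] (μ : ε → ℕ) (f : ε → β) : Prop :=
  PolyBd μ (fun x => sz (f x)) ∧ ∃ B, PolyBd μ B ∧ Comp f B

/-- The function `f` is computable in polynomial time. -/
@[fun_prop]
def PT (f : α → β) : Prop := PTm sz f

/-- Times compose because `PTm` also bounds the size of the intermediate value. -/
theorem PTm.comp {μ : ε → ℕ} {g : α → β} {f : ε → α} (hg : PT g) (hf : PTm μ f) :
    PTm μ (fun x => g (f x)) := by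
  obtain ⟨hg1, B, hB, hg2⟩ := hg
  obtain ⟨hf1, C, hC, hf2⟩ := hf
  exact ⟨hg1.comp hf1, _, (hC.add (hB.comp hf1)).add (.const 3), hg2.comp hf2⟩

theorem PTm.pair {μ : ε → ℕ} {g : ε → β} {f : ε → α} (hf : PTm μ f) (hg : PTm μ g) :
    PTm μ (fun x => (f x, g x)) := by
  obtain ⟨hg1, B, hB, hg2⟩ := hg
  obtain ⟨hf1, C, hC, hf2⟩ := hf
  exact ⟨(hf1.add hg1).add (.const 1), _, (hC.add hB).add (.const 5), hf2.pair hg2⟩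

theorem PTm.of_pt {μ : ε → ℕ} {f : ε → β} (hf : PT f) (hμ : PolyBd μ sz) : PTm μ f := by
  obtain ⟨hf1, C, hC, hf2⟩ := hf
  exact ⟨hf1.comp (f := fun x => x) hμ, C, hC.comp (f := fun x => x) hμ, hf2⟩

theorem sz_le_of_forall {l : List α} {m : ℕ} (h : ∀ a ∈ l, sz a ≤ m) :
    sz l ≤ l.length * (m + 1) + 1 := by
  induction l with
  | nil => simp [sz_nil]
  | cons a l ih =>
    have h1 := ih fun b hb => h b (by simp [hb])
    have h2 := h a (by simp)
    simp only [sz_cons, List.length_cons, Nat.add_mul]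
    omega

theorem length_le_sz (l : List α) : l.length ≤ sz l := by
  induction l with
  | nil => simp
  | cons a l ih => simp only [sz_cons, List.length_cons]; have := sz_pos a; omega

theorem sz_le_of_mem {l : List α} {a : α} (h : a ∈ l) : sz a ≤ sz l := by
  induction l with
  | nil => simp at h
  | cons b l ih =>
    rw [sz_cons]
    rcases List.mem_cons.1 h with rfl | h
    · omega
    · have := ih h; omega

theorem List.Sublist.sz_le {l m : List α} (h : l.Sublist m) : sz l ≤ sz m := by
  induction h with
  | slnil => simp
  | cons a _ ih => rw [sz_cons]; omega
  | cons_cons a _ ih => rw [sz_cons, sz_cons]; omega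

omit [Enc α] [Enc β] [Enc γ] in
theorem foldTime_le {Bf : α → ℕ} {s : α × (γ × β) → β} {f : α → β} {Bs : α × (γ × β) → ℕ} {p : α}
    {l : List γ} {M : ℕ} (h : ∀ a l', (a :: l') <:+ l →
      Bs (p, (a, l'.foldr (fun a r => s (p, (a, r))) (f p))) ≤ M) :
    foldTime Bf s f Bs p l ≤ Bf p + 7 + l.length * (M + 15) := by
  induction l with
  | nil => simp [foldTime]
  | cons a l ih =>
    have h1 := ih fun b l' hl => h b l' (hl.trans (List.suffix_cons a l))
    have h2 := h a l (List.suffix_refl _)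
    simp only [foldTime, List.length_cons, Nat.add_mul]
    omega

/-- A fold is polynomial in a measure that bounds all its intermediate results and steps. -/
theorem PTm.foldrm {μ g : ε → ℕ} {p : ε → α} {l : ε → List γ} {f : α → β} {s : α × (γ × β) → β}
    {Bs : α × (γ × β) → ℕ} (hp : PTm μ p) (hl : PTm μ l) (hf : PT f) (hs : Comp s Bs)
    (hg : PolyBd μ g)
    (hsz : ∀ e, sz ((l e).foldr (fun a r => s (p e, (a, r))) (f (p e))) ≤ g e)
    (hBs : ∀ e a l', (a :: l') <:+ l e →
      Bs (p e, (a, l'.foldr (fun a r => s (p e, (a, r))) (f (p e)))) ≤ g e) :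
    PTm μ (fun e => (l e).foldr (fun a r => s (p e, (a, r))) (f (p e))) := by
  obtain ⟨B, hB, hpl⟩ := (hp.pair hl).2
  obtain ⟨-, Bf, hBf, hf⟩ := hf
  refine ⟨hg.mono hsz, _, ?_, (Comp.foldr hf hs).comp hpl⟩
  refine (hB.add ?_).add (.const 3)
  refine PolyBd.mono (h := fun e => Bf (p e) + 7 + sz (l e) * (g e + 15)) ?_ fun e => ?_
  · exact ((hBf.comp hp.1).add (.const 7)).add (hl.1.mul (hg.add (.const 15)))
  · refine (foldTime_le fun a l' h => hBs e a l' h).trans ?_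
    have := length_le_sz (l e)
    gcongr

/-- Iterating a polynomial step may still produce exponentially large values. The bound `g` on all
partial folds excludes this, and then every step has an input of bounded size. -/
theorem PTm.foldr {μ g : ε → ℕ} {p : ε → α} {l : ε → List γ} {f : α → β} {s : α × (γ × β) → β}
    (hp : PTm μ p) (hl : PTm μ l) (hf : PT f) (hs : PT s) (hg : PolyBd μ g)
    (hsz : ∀ e l', l' <:+ l e → sz (l'.foldr (fun a r => s (p e, (a, r))) (f (p e))) ≤ g e) :
    PTm μ (fun e => (l e).foldr (fun a r => s (p e, (a, r))) (f (p e))) := by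
  obtain ⟨-, Bs, ⟨C, k, hC⟩, hs⟩ := hs
  refine PTm.foldrm (g := fun e => g e + C * (sz (p e) + sz (l e) + g e + 3) ^ k) hp hl hf hs
    (hg.add ((PolyBd.const C).mul ((((hp.1.add hl.1).add hg).add (.const 3)).pow k)))
    (fun e => le_add_right (hsz e _ (List.suffix_refl _))) fun e a l' h => ?_
  refine le_add_left ((hC _).trans ?_)
  have h1 : sz a ≤ sz (l e) := sz_le_of_mem (h.subset (by simp))
  have h2 := hsz e l' ((List.suffix_cons a l').trans h)
  refine Nat.mul_le_mul_left _ (Nat.pow_le_pow_left ?_ _)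
  simp only [sz_pair]
  omega

/-! ### Closure properties -/

namespace PT

@[fun_prop]
theorem id : PT (fun x : α => x) := ⟨.self, _, .const 1, .id⟩

@[fun_prop]
theorem const (c : β) : PT (fun _ : α => c) := ⟨.const _, _, .const _, .const c⟩

@[fun_prop]
theorem comp {g : α → β} {f : ε → α} (hg : PT g) (hf : PT f) : PT (fun x => g (f x)) :=
  PTm.comp hg hf

@[fun_prop]
theorem prodMk {f : ε → α} {g : ε → β} (hf : PT f) (hg : PT g) : PT (fun x => (f x, g x)) :=
  PTm.pair hf hg

@[fun_prop]
theorem fst {f : ε → α × β} (hf : PT f) : PT (fun x => (f x).1) :=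
  comp ⟨PolyBd.self.mono fun ⟨x, y⟩ => by simp only [sz_pair]; omega, _, .const 3,
    .fst⟩ hf

@[fun_prop]
theorem snd {f : ε → α × β} (hf : PT f) : PT (fun x => (f x).2) :=
  comp ⟨PolyBd.self.mono fun ⟨x, y⟩ => by simp only [sz_pair]; omega, _, .const 3,
    .snd⟩ hf

theorem of_enc_eq {g : α → β} (h : ∀ x, enc (g x) = enc x) : PT g :=
  ⟨PolyBd.self.mono fun x => by rw [sz, h, ← sz], _, .const 1, .cast h⟩

@[fun_prop]
theorem cons {f : ε → α} {g : ε → List α} (hf : PT f) (hg : PT g) : PT (fun x => f x :: g x) :=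
  comp (g := fun z : α × List α => z.1 :: z.2) (of_enc_eq fun _ => rfl) (prodMk hf hg)

@[fun_prop]
theorem some {f : ε → α} (hf : PT f) : PT (fun x => some (f x)) :=
  comp (g := fun z : Data × α => Option.some z.2) ⟨(PolyBd.self.add (.const 2)).mono fun ⟨x, y⟩ => by
    simp only [sz_some, sz_pair]; omega, _, .const 5,
    .of_expr (.case (.var 0) .nil (.cons .nil (.var 1))) fun _ =>
      .caseCons (.var rfl) (.cons .nil (.var rfl))⟩ (prodMk (const Data.nil) hf)

@[fun_prop]
theorem cond {b : ε → Bool} {f g : ε → β} (hb : PT b) (hf : PT f) (hg : PT g) :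
    PT (fun x => bif b x then f x else g x) := by
  have h : PT (fun z : Bool × ε => bif z.1 then f z.2 else g z.2) := by
    obtain ⟨hf1, B, hB, hf2⟩ := comp hf (snd (f := fun z : Bool × ε => z) id)
    obtain ⟨hg1, C, hC, hg2⟩ := comp hg (snd (f := fun z : Bool × ε => z) id)
    have h := (hf2.cond hg2).comp (Comp.pair (Comp.fst (α := Bool) (β := ε)) Comp.id)
    refine ⟨(hf1.add hg1).mono ?_, _, ?_, h⟩
    · rintro ⟨_ | _, z⟩ <;> simp only [cond_true, cond_false] <;> omega
    · exact ((PolyBd.const _).add ((hB.add hC).add (.const 7))).add (.const 3)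
  exact comp h (prodMk hb id)

@[fun_prop]
theorem optionElim {o : ε → Option γ} {f : ε → β} {g : ε → γ → β} (ho : PT o)
    (hf : PT f) (hg : PT (fun z : ε × γ => g z.1 z.2)) : PT (fun x => (o x).elim (f x) (g x)) := by
  have h : PT (fun z : ε × Option γ => z.2.elim (f z.1) (g z.1)) := by
    obtain ⟨hf1, B, ⟨Cf, kf, hB⟩, hf2⟩ := hf
    obtain ⟨⟨Cz, kz, hg1⟩, C, ⟨Cg, kg, hC⟩, hg2⟩ := hg
    obtain ⟨Cy, ky, hf1⟩ := hf1
    refine ⟨PolyBd.mono (h := fun z => Cy * (sz z + 1) ^ ky + Cz * (sz z + 1) ^ kz) ?_ ?_, _,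
      PolyBd.mono (h := fun z => Cf * (sz z + 1) ^ kf + Cg * (sz z + 1) ^ kg + 9) ?_ ?_, hf2.optionCase hg2⟩
    · exact ((PolyBd.const _).mul ((PolyBd.self.add (.const 1)).pow _)).add
        ((PolyBd.const _).mul ((PolyBd.self.add (.const 1)).pow _))
    · rintro ⟨x, _ | a⟩
      · refine le_add_right ((hf1 x).trans ?_)
        gcongr
        rw [sz_pair]; omega
      · refine le_add_left ((hg1 (x, a)).trans ?_)
        gcongr
        rw [sz_pair, sz_pair, sz_some]; omega
    · exact (((PolyBd.const _).mul ((PolyBd.self.add (.const 1)).pow _)).add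
        ((PolyBd.const _).mul ((PolyBd.self.add (.const 1)).pow _))).add (.const 9)
    · rintro ⟨x, _ | a⟩
      · refine Nat.add_le_add_right (le_add_right ((hB x).trans ?_)) 9
        gcongr
        rw [sz_pair]; omega
      · refine Nat.add_le_add_right (le_add_left ((hC (x, a)).trans ?_)) 9
        gcongr
        rw [sz_pair, sz_pair, sz_some]; omega
  exact comp h (prodMk id ho)

@[fun_prop]
theorem head? {f : ε → List α} (hf : PT f) : PT (fun x => (f x).head?) := by
  refine comp (g := fun l : List α => l.head?) ⟨(PolyBd.self.add (.const 2)).mono ?_, _, .const 6,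
    .of_expr (.case (.var 0) .nil (.cons .nil (.var 0))) ?_⟩ hf
  · rintro (_ | ⟨a, l⟩)
    · simp [sz_none]
    · simp only [List.head?_cons, sz_some, sz_cons]; omega
  · rintro (_ | ⟨a, l⟩)
    · exact (EvalLe.caseNil (.var rfl) .nil).mono (by omega)
    · exact (EvalLe.caseCons (.var rfl) (.cons .nil (.var rfl))).mono (by omega)

@[fun_prop]
theorem tail {f : ε → List α} (hf : PT f) : PT (fun x => (f x).tail) := by
  refine comp ⟨PolyBd.self.mono fun x => (List.tail_sublist x).sz_le, _, .const 4,
    .of_expr (.case (.var 0) .nil (.var 1)) ?_⟩ hf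
  rintro (_ | ⟨a, l⟩)
  · exact (EvalLe.caseNil (.var rfl) .nil).mono (by omega)
  · exact (EvalLe.caseCons (.var rfl) (.var rfl)).mono (by omega)

/-- A fold whose values have polynomial size. -/
theorem foldr {l : ε → List γ} {f : ε → β} {s : ε → γ → β → β} {g : ε × List γ → ℕ} (hl : PT l)
    (hf : PT f) (hs : PT (fun z : ε × (γ × β) => s z.1 z.2.1 z.2.2)) (hg : PolyBd sz g)
    (hsz : ∀ e m, sz (m.foldr (s e) (f e)) ≤ g (e, m)) :
    PT (fun e => (l e).foldr (s e) (f e)) := by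
  obtain ⟨C, k, hC⟩ := hg
  refine PTm.foldr (g := fun e => C * (sz e + sz (l e) + 2) ^ k) (p := fun x => x) id hl hf hs ?_ ?_
  · exact (PolyBd.const _).mul (((PolyBd.self.add hl.1).add (.const _)).pow _)
  · intro e m hm
    refine ((hsz e m).trans (hC _)).trans ?_
    have := hm.sublist.sz_le
    refine Nat.mul_le_mul_left _ (Nat.pow_le_pow_left ?_ _)
    rw [sz_pair]; omega

@[fun_prop]
theorem map {l : ε → List γ} {f : ε → γ → β} (hl : PT l) (hf : PT (fun z : ε × γ => f z.1 z.2)) :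
    PT (fun e => (l e).map (f e)) := by
  obtain ⟨C, k, hC⟩ := hf.1
  have h := foldr (s := fun e a r => f e a :: r) (f := fun _ => []) (g := fun z : ε × List γ =>
    sz z * (C * (sz z + 1) ^ k + 1) + 1) hl (const _) ?_ ?_ ?_
  · simpa only [List.map_eq_foldr] using h
  · exact cons (comp hf (prodMk (fst id) (fst (snd id)))) (snd (snd id))
  · exact (PolyBd.self.mul (((PolyBd.const _).mul ((PolyBd.self.add (.const 1)).pow _)).add
      (.const _))).add (.const _)
  · intro e m
    rw [← List.map_eq_foldr]
    refine (sz_le_of_forall (m := C * (sz (e, m) + 1) ^ k) fun b hb => ?_).trans ?_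
    · obtain ⟨a, ha, rfl⟩ := List.mem_map.1 hb
      refine (hC (e, a)).trans ?_
      have := sz_le_of_mem ha
      gcongr
      rw [sz_pair, sz_pair]
      omega
    · have := length_le_sz m
      gcongr
      rw [sz_pair, List.length_map]
      omega

theorem append' : PT (fun x : List α × List α => x.1 ++ x.2) := by
  have h := foldr (ε := List α × List α) (s := fun e a r => a :: r) (f := fun e => e.2) (l := fun e => e.1)
    (g := fun z => sz z) (by fun_prop) (by fun_prop) ?_ .self ?_
  · simpa only [List.foldr_cons_eq_append'] using h
  · exact cons (fst (snd id)) (snd (snd id))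
  · rintro ⟨l, l'⟩ m
    simp only [sz_pair]
    induction m with
    | nil => simp; omega
    | cons a m ih => simp only [List.foldr_cons, sz_cons]; omega

@[fun_prop]
theorem append {f g : ε → List α} (hf : PT f) (hg : PT g) : PT (fun x => f x ++ g x) :=
  comp append' (prodMk hf hg)

theorem foldrBool {l : ε → List γ} {f : ε → Bool} {s : ε → γ → Bool → Bool} (hl : PT l)
    (hf : PT f) (hs : PT (fun z : ε × (γ × Bool) => s z.1 z.2.1 z.2.2)) :
    PT (fun e => (l e).foldr (s e) (f e)) :=
  foldr hl hf hs (.const 3) fun _ _ => sz_bool _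

@[fun_prop]
theorem and {f g : ε → Bool} (hf : PT f) (hg : PT g) : PT (fun x => f x && g x) := by
  simpa only [Bool.cond_false_right] using cond hf hg (const false)

@[fun_prop]
theorem or {f g : ε → Bool} (hf : PT f) (hg : PT g) : PT (fun x => f x || g x) := by
  simpa only [Bool.cond_true_left] using cond hf (const true) hg

@[fun_prop]
theorem any {l : ε → List γ} {f : ε → γ → Bool} (hl : PT l)
    (hf : PT (fun z : ε × γ => f z.1 z.2)) : PT (fun e => (l e).any (f e)) := by
  have h := foldrBool (s := fun e a r => f e a || r) (f := fun _ => false) hl (const _)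
    (or (comp hf (prodMk (fst id) (fst (snd id)))) (snd (snd id)))
  convert h using 2 with e
  induction l e <;> simp_all

@[fun_prop]
theorem all {l : ε → List γ} {f : ε → γ → Bool} (hl : PT l)
    (hf : PT (fun z : ε × γ => f z.1 z.2)) : PT (fun e => (l e).all (f e)) := by
  have h := foldrBool (s := fun e a r => f e a && r) (f := fun _ => true) hl (const _)
    (and (comp hf (prodMk (fst id) (fst (snd id)))) (snd (snd id)))
  convert h using 2 with e
  induction l e <;> simp_all

@[fun_prop]
theorem filter {l : ε → List γ} {f : ε → γ → Bool} (hl : PT l)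
    (hf : PT (fun z : ε × γ => f z.1 z.2)) : PT (fun e => (l e).filter (f e)) := by
  have key : ∀ e m, (m : List γ).foldr (fun a r => bif f e a then a :: r else r) [] =
      m.filter (f e) := by
    intro e m
    induction m with
    | nil => rfl
    | cons a m ih => rw [List.foldr_cons, ih, List.filter_cons]; cases f e a <;> rfl
  have h := foldr (s := fun e a r => bif f e a then a :: r else r) (f := fun _ => [])
    (g := fun z : ε × List γ => sz z) hl (const _) ?_ .self ?_
  · simpa only [key] using h
  · exact cond (comp hf (prodMk (fst id) (fst (snd id)))) (cons (fst (snd id)) (snd (snd id)))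
      (snd (snd id))
  · intro e m
    rw [key, sz_pair]
    have := (List.filter_sublist (l := m) (p := f e)).sz_le
    omega

@[fun_prop]
theorem flatMap {l : ε → List γ} {f : ε → γ → List β} (hl : PT l)
    (hf : PT (fun z : ε × γ => f z.1 z.2)) : PT (fun e => (l e).flatMap (f e)) := by
  have key : ∀ e m, (m : List γ).foldr (fun a r => f e a ++ r) [] = m.flatMap (f e) := by
    intro e m
    induction m <;> simp_all
  have hap : ∀ l m : List β, sz (l ++ m) ≤ sz l + sz m := by
    intro l m
    induction l with
    | nil => simp
    | cons a l ih => simp only [List.cons_append, sz_cons]; omega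
  obtain ⟨C, k, hC⟩ := hf.1
  have h := foldr (s := fun e a r => f e a ++ r) (f := fun _ => [])
    (g := fun z : ε × List γ => sz z * (C * (sz z + 1) ^ k) + 1) hl (const _) ?_ ?_ ?_
  · simpa only [key] using h
  · exact append (comp hf (prodMk (fst id) (fst (snd id)))) (snd (snd id))
  · exact (PolyBd.self.mul ((PolyBd.const _).mul ((PolyBd.self.add (.const 1)).pow _))).add
      (.const _)
  · intro e m
    induction m with
    | nil => simp [sz_nil]
    | cons a m ih =>
      have h1 := hC (e, a)
      simp only [List.foldr_cons]
      refine (hap _ _).trans ((add_le_add h1 ih).trans ?_)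
      have h2 : (sz (e, a) + 1) ^ k ≤ (sz (e, a :: m) + 1) ^ k := by
        gcongr; simp only [sz_pair, sz_cons]; omega
      have h3 : (sz (e, m) + 1) ^ k ≤ (sz (e, a :: m) + 1) ^ k := by
        gcongr; simp only [sz_pair, sz_cons]; omega
      have h4 : 1 + sz (e, m) ≤ sz (e, a :: m) := by simp only [sz_pair, sz_cons]; omega
      calc C * (sz (e, a) + 1) ^ k + (sz (e, m) * (C * (sz (e, m) + 1) ^ k) + 1)
          ≤ C * (sz (e, a :: m) + 1) ^ k + (sz (e, m) * (C * (sz (e, a :: m) + 1) ^ k) + 1) := by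
            gcongr
        _ = (1 + sz (e, m)) * (C * (sz (e, a :: m) + 1) ^ k) + 1 := by ring
        _ ≤ _ := by gcongr

@[fun_prop]
theorem zip {f : ε → List α} {g : ε → List β} (hf : PT f) (hg : PT g) :
    PT (fun x => (f x).zip (g x)) := by
  refine comp (g := fun x : List α × List β => x.1.zip x.2) ⟨PolyBd.self.mono ?_, _, ?_, .zip⟩
    (prodMk hf hg)
  · rintro ⟨l, m⟩
    simp only [sz_pair]
    induction l generalizing m with
    | nil => simp only [List.zip_nil_left, sz_nil]; omega
    | cons a l ih =>
      cases m with
      | nil => simp [sz_nil]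
      | cons b m => have := ih m; simp only [List.zip_cons_cons, sz_cons, sz_pair]; omega
  · refine (((PolyBd.const 20).mul .self).add (.const 10)).mono ?_
    rintro ⟨l, m⟩
    have := length_le_sz l
    simp only [sz_pair]
    omega

end PT

/-- Equality of encodings. -/
def encEq (x y : α) : Bool := (enc x).beq (enc y)

theorem encEq_iff {x y : α} : encEq x y = true ↔ x = y := by
  rw [encEq, Data.beq_iff, inj.eq_iff]

@[fun_prop]
theorem PT.encEq {f g : ε → α} (hf : PT f) (hg : PT g) : PT (fun x => encEq (f x) (g x)) := by
  have he : PT (fun x : α => enc x) := .of_enc_eq fun _ => rfl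
  refine comp (g := fun x : Data × Data => x.1.beq x.2) ⟨(PolyBd.const 3).mono fun _ => sz_bool _, _,
    ?_, .dataBeq⟩ (prodMk (he.comp hf) (he.comp hg))
  refine ((PolyBd.const 30).mul .self).mono ?_
  rintro ⟨x, y⟩
  simp only [sz_pair, sz_data]
  omega

end

/-! ### The base automaton -/

/-- Color, label and adjacencies of the vertex assigned to a variable. -/
abbrev Info : Type := Word × (Word × Word)

/-- What is known about a variable: no vertex, several vertices, or one vertex. -/
abbrev VRec : Type := Option (Option Info)

/-- The state of the base automaton: one record for each variable. -/
abbrev BState : Type := List VRec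

/-- A node type, given by its two-bit tag and its colors. -/
abbrev Op : Type := (Bool × Bool) × (Word × Word)

def joinRec (x y : VRec) : VRec := x.elim y (fun _ => y.elim x (fun _ => some none))

def mapInfo (f : Info → Info) (x : VRec) : VRec :=
  x.elim none (fun y => some (y.elim none (fun i => some (f i))))

def recolorInfo (c : Word × Word) (i : Info) : Info :=
  (bif encEq i.1 c.1 then c.2 else i.1, i.2)

/-- Only colors are compared, so a vertex may appear linked to itself when both colors of `c` agree;
`stateAdj` discards such bits. -/
def linkBit (c : Word × Word) (k : Word) (r : VRec) : Bool :=
  r.elim false (fun y => y.elim false (fun i =>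
    (encEq k c.1 && encEq i.1 c.2) || (encEq k c.2 && encEq i.1 c.1)))

def addInfo (c : Word × Word) (s : BState) (i : Info) : Info :=
  (i.1, (i.2.1, (s.zip i.2.2).map (fun z => z.2 || linkBit c i.1 z.1)))

def joinState (s t : BState) : BState := (s.zip t).map (fun z => joinRec z.1 z.2)

def recolorState (c : Word × Word) (s : BState) : BState := s.map (mapInfo (recolorInfo c))

def addState (c : Word × Word) (s : BState) : BState := s.map (mapInfo (addInfo c s))

/-- A set variable has the record `none` throughout: its contents are visible in the labels of the
vertices. -/
def introState (kinds : List Bool) (a b : Word) : BState :=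
  (kinds.zip b).map (fun z =>
    bif z.1 && z.2 then some (some (a, (b, kinds.map (fun _ => false)))) else none)

/-- The tag of a leaf falls into the join branch; the resulting table is ignored by `nodeOut`. -/
def baseOp (o : Op) (ks : List BState) : BState :=
  bif o.1.1 then
    (bif o.1.2 then addState o.2 (ks.head?.elim [] (fun s => s))
      else recolorState o.2 (ks.head?.elim [] (fun s => s)))
  else joinState (ks.head?.elim [] (fun s => s)) (ks.tail.head?.elim [] (fun s => s))

/-- Forget the color. -/
def stripState (s : BState) : BState := s.map (mapInfo (fun i => ([], i.2)))

/-! ### Enumerations -/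

/-- The words that are as long as a given list. -/
def allWords {γ : Type} (l : List γ) : List Word :=
  l.foldr (fun _ r => r.map (fun w => false :: w) ++ r.map (fun w => true :: w)) [[]]

/-- The words that are at most as long as a given list. -/
def upWords {γ : Type} (l : List γ) : List Word :=
  l.foldr (fun _ r => [] :: (r.map (fun w => false :: w) ++ r.map (fun w => true :: w))) [[]]

def allRecs (colors ws : List Word) : List VRec :=
  none :: some none :: colors.flatMap (fun c => ws.flatMap (fun r => ws.map (fun d =>
    some (some (c, (r, d))))))

/-- Only vertex variables (kind `true`) have a choice of record; thus the exponent in the number of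
states is `q_v` and not `q`. -/
def allStates (recs : List VRec) (kinds : List Bool) : List BState :=
  kinds.foldr (fun k r => (bif k then recs else [none]).flatMap (fun a => r.map (fun s => a :: s)))
    [[]]

/-- The tuples of children. -/
def keys {α : Type} (unary : Bool) (U : List α) : List (List α) :=
  bif unary then U.map (fun a => [a]) else U.flatMap (fun a => U.map (fun b => [a, b]))

/-! ### Levels -/

def Data.toList : Data → List Data
  | .nil => []
  | .cons a b => a :: b.toList

def Data.isCons : Data → Bool
  | .nil => false
  | .cons _ _ => true

/-- The characteristic word of a subset of a list. -/
def mask {α : Type} (U : List α) (p : α → Bool) : Data := enc (U.map p)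

/-- The subset of a list with a given characteristic word. -/
def elems {α : Type} (U : List α) (A : Data) : List α :=
  ((U.zip A.toList).filter (fun z => z.2.isCons)).map (fun z => z.1)

/-- The universe, the labelled states of a leaf, the table of a node and the accepting states. -/
abbrev Level : Type := List Data × (List (Word × Data) × (List (List Data) × List Data))

/-- The innermost variable owns the first bit of a label. The new state collects the states of all
labels with the given tail; the list keeps its length, and repetitions in it are harmless. -/
def liftLeaf (U : List Data) (L : List (Word × Data)) : List (Word × Data) :=
  L.map (fun e => (e.1.tail, mask U (fun x =>
    L.any (fun e' => encEq e'.1.tail e.1.tail && encEq e'.2 x))))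

/-- The subset construction: the set at the parent consists of the heads of those old rows whose
children are taken from the given sets. -/
def liftTable (unary : Bool) (U : List Data) (T : List (List Data)) (U' : List Data) :
    List (List Data) :=
  (keys unary U').map (fun As => mask U (fun x => T.any (fun t => encEq t.head? (some x) &&
    (t.tail.zip As).all (fun z => (elems U z.2).any (fun y => encEq z.1 y)))) :: As)

/-- A set holds the states reached under all choices for the variable, so both quantifiers are read
off from the same set. -/
def liftAcc (ex : Bool) (U acc U' : List Data) : List Data :=
  U'.filter (fun A => bif ex then (elems U A).any (fun x => acc.any (fun y => encEq x y))
    else (elems U A).all (fun x => acc.any (fun y => encEq x y)))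

/-- The new universe is exponentially large, hence an argument: relative to it everything else takes
polynomial time. -/
def liftLevelWith (unary ex : Bool) (X : Level) (U' : List Data) : Level :=
  (U', (liftLeaf X.1 X.2.1, (liftTable unary X.1 X.2.2.1 U', liftAcc ex X.1 X.2.2.2 U')))

/-- Project one variable away. -/
def liftLevel (unary ex : Bool) (X : Level) : Level :=
  liftLevelWith unary ex X ((allWords X.1).map (fun w => enc w))

/-! ### Polynomial time of the operations on states and levels. -/

section PTFacts

variable {α β γ δ ε : Type} [Enc α] [Enc β] [Enc γ] [Enc δ] [Enc ε]

@[fun_prop]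
theorem PT.joinRec {f g : ε → VRec} (hf : PT f) (hg : PT g) :
    PT (fun x => joinRec (f x) (g x)) := by
  unfold _root_.joinRec; fun_prop

@[fun_prop]
theorem PT.mapInfo {f : ε → Info → Info} {g : ε → VRec} (hf : PT (fun z : ε × Info => f z.1 z.2))
    (hg : PT g) : PT (fun x => mapInfo (f x) (g x)) := by
  have : PT (fun z : (ε × Option Info) × Info => f z.1.1 z.2) :=
    hf.comp (f := fun z : (ε × Option Info) × Info => (z.1.1, z.2)) (by fun_prop)
  unfold _root_.mapInfo; fun_prop

@[fun_prop]
theorem PT.recolorInfo {f : ε → Word × Word} {g : ε → Info} (hf : PT f) (hg : PT g) :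
    PT (fun x => recolorInfo (f x) (g x)) := by
  unfold _root_.recolorInfo; fun_prop

@[fun_prop]
theorem PT.linkBit {f : ε → Word × Word} {g : ε → Word} {h : ε → VRec} (hf : PT f) (hg : PT g)
    (hh : PT h) : PT (fun x => linkBit (f x) (g x) (h x)) := by
  unfold _root_.linkBit; fun_prop

@[fun_prop]
theorem PT.addInfo {f : ε → Word × Word} {g : ε → BState} {h : ε → Info} (hf : PT f) (hg : PT g)
    (hh : PT h) : PT (fun x => addInfo (f x) (g x) (h x)) := by
  unfold _root_.addInfo; fun_prop

@[fun_prop]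
theorem PT.joinState {f g : ε → BState} (hf : PT f) (hg : PT g) :
    PT (fun x => joinState (f x) (g x)) := by
  unfold _root_.joinState; fun_prop

@[fun_prop]
theorem PT.recolorState {f : ε → Word × Word} {g : ε → BState} (hf : PT f) (hg : PT g) :
    PT (fun x => recolorState (f x) (g x)) := by
  unfold _root_.recolorState; fun_prop

@[fun_prop]
theorem PT.addState {f : ε → Word × Word} {g : ε → BState} (hf : PT f) (hg : PT g) :
    PT (fun x => addState (f x) (g x)) := by
  unfold _root_.addState; fun_prop

@[fun_prop]
theorem PT.introState {k : ε → List Bool} {f g : ε → Word} (hk : PT k) (hf : PT f) (hg : PT g) :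
    PT (fun x => introState (k x) (f x) (g x)) := by
  unfold _root_.introState; fun_prop

@[fun_prop]
theorem PT.baseOp {f : ε → Op} {g : ε → List BState} (hf : PT f) (hg : PT g) :
    PT (fun x => baseOp (f x) (g x)) := by
  unfold _root_.baseOp; fun_prop

@[fun_prop]
theorem PT.stripState {f : ε → BState} (hf : PT f) : PT (fun x => stripState (f x)) := by
  unfold _root_.stripState; fun_prop

@[fun_prop]
theorem PT.allRecs {f g : ε → List Word} (hf : PT f) (hg : PT g) :
    PT (fun x => allRecs (f x) (g x)) := by
  unfold _root_.allRecs; fun_prop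

@[fun_prop]
theorem PT.keys {f : ε → Bool} {g : ε → List α} (hf : PT f) (hg : PT g) :
    PT (fun x => keys (f x) (g x)) := by
  unfold _root_.keys; fun_prop

/-- Each tree already is the encoding of the list along its right spine, so the conversion is free.
-/
theorem enc_toList (d : Data) : enc d.toList = d := by
  induction d with
  | nil => rfl
  | cons a b _ ih => rw [Data.toList, enc_cons, ih, enc_data]

@[fun_prop]
theorem PT.toList {f : ε → Data} (hf : PT f) : PT (fun x => (f x).toList) :=
  .comp (.of_enc_eq enc_toList) hf

@[fun_prop]
theorem PT.isCons {f : ε → Data} (hf : PT f) : PT (fun x => (f x).isCons) := by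
  refine .comp ⟨(PolyBd.const 3).mono fun _ => sz_bool _, _, .const 6,
    .of_expr (.case (.var 0) .nil (.cons .nil .nil)) ?_⟩ hf
  rintro (_ | ⟨a, l⟩)
  · exact (EvalLe.caseNil (.var rfl) .nil).mono (by omega)
  · exact (EvalLe.caseCons (.var rfl) (.cons .nil .nil)).mono (by omega)

@[fun_prop]
theorem PT.enc {f : ε → α} (hf : PT f) : PT (fun x => enc (f x)) :=
  .comp (.of_enc_eq fun _ => rfl) hf

@[fun_prop]
theorem PT.mask {f : ε → List α} {p : ε → α → Bool} (hf : PT f)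
    (hp : PT (fun z : ε × α => p z.1 z.2)) : PT (fun x => mask (f x) (p x)) := by
  unfold _root_.mask; fun_prop

@[fun_prop]
theorem PT.elems {f : ε → List α} {g : ε → Data} (hf : PT f) (hg : PT g) :
    PT (fun x => elems (f x) (g x)) := by
  unfold _root_.elems; fun_prop

theorem PT.liftLevelWith : PT (fun z : (Bool × Bool) × (Level × List Data) =>
    liftLevelWith z.1.1 z.1.2 z.2.1 z.2.2) := by
  unfold _root_.liftLevelWith liftLeaf liftTable liftAcc; fun_prop

end PTFacts

/-! ### The tables of a node -/

/-- Kinds of the variables (innermost first), types of the quantifiers (outermost first) and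
accepting states of the base automaton. -/
abbrev Params : Type := List Bool × (List Bool × List BState)

/-- Parameters, width and type of a node. -/
abbrev NodeInput : Type := (Params × Word) × Op

namespace NodeInput

def kinds (e : NodeInput) : List Bool := e.1.1.1
def flags (e : NodeInput) : List Bool := e.1.1.2.1
def matrix (e : NodeInput) : List BState := e.1.1.2.2
def width (e : NodeInput) : Word := e.1.2

end NodeInput

def baseStates (kinds : List Bool) (width : Word) : List BState :=
  allStates (allRecs (upWords width) (allWords kinds)) kinds

def baseWith (e : NodeInput) (ws : List Word) (U : List BState) : Level :=
  (U.map (fun s => enc s),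
    (ws.map (fun b => (b, enc (introState e.1.1.1 e.2.2.1 b))),
      ((keys e.2.1.1 U).map (fun k => (baseOp e.2 k :: k).map (fun s => enc s)),
        -- Acceptance is tested after erasing the colors; the list of accepting states in the
        -- parameters then serves all widths.
        (U.filter (fun s => e.1.1.2.2.any (fun t => encEq (stripState s) t))).map
          (fun s => enc s))))

def baseLevel (e : NodeInput) : Level :=
  baseWith e (allWords e.kinds) (baseStates e.kinds e.width)

def levelAt (e : NodeInput) (m : List Bool) : Level :=
  m.foldr (fun f X => liftLevel e.2.1.1 f X) (baseLevel e)

def toWord (d : Data) : Word := d.toList.map (fun a => a.isCons)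

/-- A child may be a leaf, whose bit carries information, or an inner node with an arbitrary bit, so
rows are offered with all combinations of bits. -/
def prefixes (unary : Bool) : List Word :=
  bif unary then allWords [true, true] else allWords [true, true, true]

def nodeOut (o : Op) (X : Level) : List (List Word) :=
  bif o.1.1 || o.1.2 then
    (prefixes o.1.1).flatMap (fun p => X.2.2.1.map (fun t =>
      (p.zip t).map (fun z => z.1 :: toWord z.2)))
  -- At the top level the label of a leaf is one bit, that of the free variable, and becomes the
  -- membership bit.
  else X.2.1.map (fun y => [y.1 ++ toWord y.2])

def acceptOut (X : Level) : List Word :=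
  X.2.2.2.flatMap (fun x => [false :: toWord x, true :: toWord x])

def nodeFn (e : NodeInput) : List (List Word) := nodeOut e.2 (levelAt e e.flags)

def acceptFn (e : NodeInput) : List Word := acceptOut (levelAt e e.flags)

/-! ### Members, lengths and sizes of the enumerations. -/

theorem length_allWords {γ : Type} (l : List γ) : (allWords l).length = 2 ^ l.length := by
  induction l with
  | nil => rfl
  | cons a l ih =>
    rw [allWords] at ih
    simp only [allWords, List.foldr_cons, List.length_append, List.length_map, ih,
      List.length_cons]
    ring

theorem mem_allWords {γ : Type} {l : List γ} {w : Word} :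
    w ∈ allWords l ↔ w.length = l.length := by
  induction l generalizing w with
  | nil => simp [allWords]
  | cons a l ih =>
    have h : allWords (a :: l) = (allWords l).map (fun w => false :: w) ++
      (allWords l).map (fun w => true :: w) := rfl
    rw [h]
    rcases w with _ | ⟨_ | _, w⟩ <;> simp [ih]

theorem length_upWords {γ : Type} (l : List γ) :
    (upWords l).length + 1 = 2 ^ (l.length + 1) := by
  induction l with
  | nil => rfl
  | cons a l ih =>
    have h : upWords (a :: l) = [] :: ((upWords l).map (fun w => false :: w) ++
      (upWords l).map (fun w => true :: w)) := rfl
    rw [h, List.length_cons, pow_succ, List.length_cons, ← ih]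
    simp only [List.length_append, List.length_map]
    ring

theorem mem_upWords {γ : Type} {l : List γ} {w : Word} :
    w ∈ upWords l ↔ w.length ≤ l.length := by
  induction l generalizing w with
  | nil => simp [upWords]
  | cons a l ih =>
    have h : upWords (a :: l) = [] :: ((upWords l).map (fun w => false :: w) ++
      (upWords l).map (fun w => true :: w)) := rfl
    rw [h]
    rcases w with _ | ⟨_ | _, w⟩ <;> simp [ih]

theorem sz_word_le (w : Word) : sz w ≤ w.length * 4 + 1 :=
  sz_le_of_forall fun b _ => sz_bool b

theorem sz_words_le {L : List Word} {n : ℕ} (h : ∀ w ∈ L, w.length ≤ n) :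
    sz L ≤ L.length * (n * 4 + 2) + 1 :=
  sz_le_of_forall fun w hw => (sz_word_le w).trans (by have := h w hw; omega)

section PTmFacts

variable {α β γ δ ε : Type} [Enc α] [Enc β] [Enc γ] [Enc δ] [Enc ε]

/-- The output is exponential in the input, so the measure is required to dominate the number of
words. -/
theorem PTm.allWords {μ : ε → ℕ} {f : ε → List α} (hf : PTm μ f)
    (hμ : PolyBd μ (fun e => 2 ^ (f e).length)) : PTm μ (fun e => allWords (f e)) := by
  refine PTm.foldr (α := List α) (β := List Word)
    (g := fun e => 2 ^ (f e).length * (sz (f e) * 4 + 2) + 1)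
    (p := f) (l := f) (f := fun _ => [[]])
    (s := fun z => z.2.2.map (fun w => false :: w) ++ z.2.2.map (fun w => true :: w))
    hf hf (by fun_prop) (by fun_prop) ?_ fun e m hm => ?_
  · exact (hμ.mul ((hf.1.mul (.const 4)).add (.const 2))).add (.const 1)
  · change sz (_root_.allWords m) ≤ _
    refine (sz_words_le (n := m.length) fun w hw => (mem_allWords.1 hw).le).trans ?_
    rw [length_allWords]
    have h1 := hm.length_le
    have h2 := length_le_sz (f e)
    gcongr <;> omega

theorem PTm.upWords {μ : ε → ℕ} {f : ε → List α} (hf : PTm μ f)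
    (hμ : PolyBd μ (fun e => 2 ^ ((f e).length + 1))) : PTm μ (fun e => upWords (f e)) := by
  refine PTm.foldr (α := List α) (β := List Word)
    (g := fun e => 2 ^ ((f e).length + 1) * (sz (f e) * 4 + 2) + 1)
    (p := f) (l := f) (f := fun _ => [[]])
    (s := fun z => [] :: (z.2.2.map (fun w => false :: w) ++ z.2.2.map (fun w => true :: w)))
    hf hf (by fun_prop) (by fun_prop) ?_ fun e m hm => ?_
  · exact (hμ.mul ((hf.1.mul (.const 4)).add (.const 2))).add (.const 1)
  · change sz (_root_.upWords m) ≤ _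
    refine (sz_words_le (n := m.length) fun w hw => mem_upWords.1 hw).trans ?_
    have h0 := length_upWords m
    have h1 := hm.length_le
    have h2 := length_le_sz (f e)
    have h3 : (_root_.upWords m).length ≤ 2 ^ ((f e).length + 1) := by
      have : 2 ^ (m.length + 1) ≤ 2 ^ ((f e).length + 1) :=
        Nat.pow_le_pow_right (by norm_num) (by omega)
      omega
    gcongr
    omega

theorem mem_allStates {recs : List VRec} {kinds : List Bool} {s : BState} :
    s ∈ allStates recs kinds ↔
      List.Forall₂ (fun k r => if k = true then r ∈ recs else r = none) kinds s := by
  induction kinds generalizing s with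
  | nil => simp [allStates]
  | cons k kinds ih =>
    have h : allStates recs (k :: kinds) = (bif k then recs else [none]).flatMap
      (fun a => (allStates recs kinds).map (fun s => a :: s)) := rfl
    rw [h]
    cases s with
    | nil => simp
    | cons r s => cases k <;> simp [ih, and_comm, eq_comm]

theorem length_allStates (recs : List VRec) (kinds : List Bool) :
    (allStates recs kinds).length = recs.length ^ kinds.count true := by
  induction kinds with
  | nil => simp [allStates]
  | cons k kinds ih =>
    have h : allStates recs (k :: kinds) = (bif k then recs else [none]).flatMap
      (fun a => (allStates recs kinds).map (fun s => a :: s)) := rfl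
    rw [h]
    cases k <;> simp [List.length_flatMap, ih, pow_succ, mul_comm]

theorem sz_of_mem_allStates {recs : List VRec} {kinds : List Bool} {s : BState}
    (hs : s ∈ allStates recs kinds) : sz s ≤ kinds.length * (sz recs + 2) + 1 := by
  rw [mem_allStates] at hs
  rw [hs.length_eq]
  refine sz_le_of_forall fun r hr => ?_
  obtain ⟨i, hi, rfl⟩ := List.getElem_of_mem hr
  have h := hs.get (i := i) (hs.length_eq ▸ hi) hi
  simp only [List.get_eq_getElem] at h
  split_ifs at h with h1
  · have := sz_le_of_mem h; omega
  · rw [h, sz_none]; have := sz_pos recs; omega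

theorem length_recs_pos (colors ws : List Word) : 0 < (allRecs colors ws).length := by
  simp [allRecs]

theorem PTm.allStates {μ : ε → ℕ} {f : ε → List VRec} {k : ε → List Bool} (hf : PTm μ f)
    (hk : PTm μ k) (hpos : ∀ e, 0 < (f e).length)
    (hμ : PolyBd μ (fun e => (allStates (f e) (k e)).length)) :
    PTm μ (fun e => allStates (f e) (k e)) := by
  refine PTm.foldr (α := List VRec) (β := List BState)
    (g := fun e => (_root_.allStates (f e) (k e)).length * (sz (k e) * (sz (f e) + 2) + 2) + 1)
    (p := f) (l := k) (f := fun _ => [[]])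
    (s := fun z => (bif z.2.1 then z.1 else [none]).flatMap
      (fun a => z.2.2.map (fun s => a :: s)))
    hf hk (by fun_prop) (by fun_prop) ?_ fun e m hm => ?_
  · exact (hμ.mul ((hk.1.mul (hf.1.add (.const 2))).add (.const 2))).add (.const 1)
  · change sz (_root_.allStates (f e) m) ≤ _
    refine (sz_le_of_forall fun s hs => sz_of_mem_allStates hs).trans ?_
    have h1 := hm.length_le
    have h2 := length_le_sz (k e)
    have h3 : (_root_.allStates (f e) m).length ≤ (_root_.allStates (f e) (k e)).length := by
      rw [length_allStates, length_allStates]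
      -- Without any record, a longer list of kinds could have fewer states than a suffix of it.
      exact Nat.pow_le_pow_right (hpos e) (hm.sublist.count_le _)
    have h4 : m.length * (sz (f e) + 2) ≤ sz (k e) * (sz (f e) + 2) :=
      Nat.mul_le_mul_right _ (by omega)
    gcongr ?_ * ?_ + 1
    omega

end PTmFacts

/-! ### Sizes -/

/-- The measure of inputs in which the tables are computed in polynomial time. -/
def nodeMeasure (e : NodeInput) : ℕ :=
  sz e + 2 ^ (e.width.length + 1) + 2 ^ e.kinds.length + (levelAt e e.flags).1.length

theorem sz_le_nodeMeasure (e : NodeInput) : sz e ≤ nodeMeasure e := by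
  unfold nodeMeasure; rw [add_assoc, add_assoc]; exact Nat.le_add_right _ _

theorem pow_width_le_nodeMeasure (e : NodeInput) : 2 ^ (e.width.length + 1) ≤ nodeMeasure e := by
  unfold nodeMeasure; rw [add_assoc, add_assoc]
  exact le_add_left (Nat.le_add_right _ _)

theorem pow_kinds_le_nodeMeasure (e : NodeInput) : 2 ^ e.kinds.length ≤ nodeMeasure e := by
  unfold nodeMeasure; rw [add_assoc]
  exact le_add_left (Nat.le_add_right _ _)

theorem length_le_nodeMeasure (e : NodeInput) :
    (levelAt e e.flags).1.length ≤ nodeMeasure e := Nat.le_add_left _ _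

theorem PolyBd.sz_nodeMeasure : PolyBd nodeMeasure (sz (α := NodeInput)) :=
  PolyBd.self.mono sz_le_nodeMeasure

theorem levelAt_cons (e : NodeInput) (f : Bool) (m : List Bool) :
    levelAt e (f :: m) = liftLevel e.2.1.1 f (levelAt e m) := rfl

theorem length_levelAt_cons (e : NodeInput) (f : Bool) (m : List Bool) :
    (levelAt e (f :: m)).1.length = 2 ^ (levelAt e m).1.length := by
  rw [levelAt_cons, liftLevel, liftLevelWith, List.length_map, length_allWords]

/-- Since n < 2^n, universes grow from level to level, and the one on top bounds all others. -/
theorem length_levelAt_mono (e : NodeInput) {m l : List Bool} (h : m <:+ l) :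
    (levelAt e m).1.length ≤ (levelAt e l).1.length := by
  induction l with
  | nil => rw [List.suffix_nil.1 h]
  | cons a l ih =>
    rcases List.suffix_cons_iff.1 h with rfl | h
    · rfl
    · rw [length_levelAt_cons]
      exact (ih h).trans Nat.lt_two_pow_self.le

theorem length_keys {α : Type} (u : Bool) (U : List α) :
    (keys u U).length ≤ U.length + U.length ^ 2 := by
  cases u <;> simp [keys, List.length_flatMap, sq]

theorem sz_of_mem_keys {α : Type} [Enc α] {u : Bool} {U k : List α} {D : ℕ}
    (hU : ∀ a ∈ U, sz a ≤ D) (hk : k ∈ keys u U) : sz k ≤ 2 * D + 3 := by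
  cases u
  · simp only [keys, cond_false, List.mem_flatMap, List.mem_map] at hk
    obtain ⟨a, ha, b, hb, rfl⟩ := hk
    have := hU a ha
    have := hU b hb
    simp only [sz_cons, sz_nil]
    omega
  · simp only [keys, cond_true, List.mem_map] at hk
    obtain ⟨a, ha, rfl⟩ := hk
    have := hU a ha
    simp only [sz_cons, sz_nil]
    omega

theorem sz_mask {α : Type} (U : List α) (p : α → Bool) : sz (mask U p) ≤ U.length * 4 + 1 := by
  have h := sz_word_le (U.map p)
  rwa [List.length_map] at h

/-- A size bound for levels. -/
structure LevelBd (N Q D : ℕ) (X : Level) : Prop where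
  length_univ : X.1.length ≤ N
  sz_univ : ∀ x ∈ X.1, sz x ≤ D
  length_leaf : X.2.1.length ≤ Q
  sz_leaf : ∀ y ∈ X.2.1, sz y.1 ≤ D ∧ sz y.2 ≤ D
  length_table : X.2.2.1.length ≤ N + N ^ 2
  sz_table : ∀ t ∈ X.2.2.1, sz t ≤ 3 * D + 4
  acc_sub : X.2.2.2.Sublist X.1

/-- New states are masks over the old universe, of size at most `4 * N + 1` whatever the size of the
old states. Hence the same `N`, `Q`, `D` serve at all levels and do not deteriorate with the number
of quantifiers. -/
theorem LevelBd.lift {N Q D : ℕ} {X : Level} (h : LevelBd N Q D X) (hD : 4 * N + 1 ≤ D)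
    (u f : Bool) (hN : 2 ^ X.1.length ≤ N) : LevelBd N Q D (liftLevel u f X) := by
  have hU : ∀ p, sz (mask X.1 p) ≤ D := fun p => (sz_mask _ _).trans (by
    have := h.length_univ; omega)
  have hl : ((allWords X.1).map (fun w => (enc w : Data))).length = 2 ^ X.1.length := by
    rw [List.length_map, length_allWords]
  have hU' : ∀ x ∈ (allWords X.1).map (fun w => (enc w : Data)), sz x ≤ D := by
    intro x hx
    obtain ⟨w, hw, rfl⟩ := List.mem_map.1 hx
    have h1 := sz_word_le w
    rw [mem_allWords.1 hw] at h1
    have h2 := h.length_univ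
    change sz w ≤ D
    omega
  refine ⟨?_, hU', ?_, ?_, ?_, ?_, ?_⟩
  · simpa only [liftLevel, liftLevelWith, hl]
  · simpa [liftLevel, liftLevelWith, liftLeaf] using h.length_leaf
  · intro y hy
    simp only [liftLevel, liftLevelWith, liftLeaf, List.mem_map] at hy
    obtain ⟨e, he, rfl⟩ := hy
    exact ⟨(List.tail_sublist _).sz_le.trans (h.sz_leaf e he).1, hU _⟩
  · simp only [liftLevel, liftLevelWith, liftTable, List.length_map]
    refine (length_keys _ _).trans ?_
    rw [hl]
    gcongr
  · intro t ht
    simp only [liftLevel, liftLevelWith, liftTable, List.mem_map] at ht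
    obtain ⟨k, hk, rfl⟩ := ht
    have h1 := sz_of_mem_keys (D := D) (by simpa using hU') hk
    rw [sz_cons]
    have h2 := hU (fun x => X.2.2.1.any (fun t => encEq t.head? (some x) &&
      (t.tail.zip k).all (fun z => (elems X.1 z.2).any (fun y => encEq z.1 y))))
    omega
  · exact List.filter_sublist

theorem LevelBd.sz_le {N Q D : ℕ} {X : Level} (h : LevelBd N Q D X) :
    sz X ≤ 2 * (N * (D + 1) + 1) + (Q * (2 * D + 2) + 1) + ((N + N ^ 2) * (3 * D + 5) + 1) + 3 := by
  obtain ⟨U, L, T, A⟩ := X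
  obtain ⟨h1, h2, h3, h4, h5, h6, h7⟩ := h
  simp only at *
  have hU := (sz_le_of_forall h2).trans (Nat.add_le_add_right (Nat.mul_le_mul_right _ h1) 1)
  have hA := h7.sz_le
  have hL := (sz_le_of_forall (m := 2 * D + 1) fun y hy => by
    have := h4 y hy; rw [← Prod.mk.eta (p := y), sz_pair]; omega).trans
    (Nat.add_le_add_right (Nat.mul_le_mul_right _ h3) 1)
  have hT := (sz_le_of_forall h6).trans (Nat.add_le_add_right (Nat.mul_le_mul_right _ h5) 1)
  have e1 : 2 * D + 1 + 1 = 2 * D + 2 := rfl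
  have e2 : 3 * D + 4 + 1 = 3 * D + 5 := rfl
  rw [e1] at hL
  rw [e2] at hT
  simp only [sz_pair]
  omega

theorem PTm.baseLevel : PTm nodeMeasure baseLevel := by
  have hsz := PolyBd.sz_nodeMeasure
  have hk : PTm nodeMeasure (fun e : NodeInput => e.kinds) :=
    .of_pt (by unfold NodeInput.kinds; fun_prop) hsz
  have hw : PTm nodeMeasure (fun e : NodeInput => e.width) :=
    .of_pt (by unfold NodeInput.width; fun_prop) hsz
  have hws := PTm.allWords hk (PolyBd.self.mono pow_kinds_le_nodeMeasure)
  have hcs := PTm.upWords hw (PolyBd.self.mono pow_width_le_nodeMeasure)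
  have hrecs := PTm.comp (g := fun z : List Word × List Word => allRecs z.1 z.2) (by fun_prop)
    (hcs.pair hws)
  -- The number of base states is at most the size of the top universe, which is part of the
  -- measure.
  have hU := PTm.allStates hrecs hk (fun e => length_recs_pos _ _) (PolyBd.self.mono fun e => by
    have h := length_levelAt_mono e (List.nil_suffix (l := e.flags))
    have h' : (levelAt e []).1.length = (baseStates e.kinds e.width).length := by
      simp [levelAt, _root_.baseLevel, baseWith]
    rw [h', baseStates] at h
    exact h.trans (length_le_nodeMeasure e))
  exact PTm.comp (g := fun z : NodeInput × (List Word × List BState) => baseWith z.1 z.2.1 z.2.2)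
    (by unfold baseWith; fun_prop) ((PTm.of_pt .id hsz).pair (hws.pair hU))

theorem LevelBd.levelAt (e : NodeInput) {N D : ℕ}
    (hN : N = (levelAt e e.flags).1.length) (hD : 4 * N + 1 + sz (baseLevel e) ≤ D)
    {m : List Bool} (hm : m <:+ e.flags) :
    LevelBd N (2 ^ e.kinds.length) D (levelAt e m) := by
  induction m with
  | nil =>
    have h1 : sz (baseLevel e).1 + sz (baseLevel e).2.1 + sz (baseLevel e).2.2.1 +
        sz (baseLevel e).2.2.2 ≤ sz (baseLevel e) := by
      rcases baseLevel e with ⟨U, L, T, A⟩; simp only [sz_pair]; omega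
    have hl := length_levelAt_mono e hm
    rw [← hN] at hl
    refine ⟨hl, fun x hx => ?_, ?_, fun y hy => ?_, ?_, fun t ht => ?_, ?_⟩
    · have := sz_le_of_mem hx; simp only [_root_.levelAt, List.foldr_nil] at this; omega
    · simp [_root_.levelAt, baseLevel, baseWith, length_allWords]
    · have := sz_le_of_mem hy
      rw [← Prod.mk.eta (p := y), sz_pair] at this
      simp only [_root_.levelAt, List.foldr_nil] at this; omega
    · have h2 : (_root_.levelAt e []).2.2.1.length ≤ (baseStates e.kinds e.width).length +
          (baseStates e.kinds e.width).length ^ 2 := by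
        simp only [_root_.levelAt, List.foldr_nil, baseLevel, baseWith, List.length_map]
        exact length_keys _ _
      refine h2.trans ?_
      have h3 : (baseStates e.kinds e.width).length ≤ N := by
        simpa [_root_.levelAt, baseLevel, baseWith] using hl
      gcongr
    · have := sz_le_of_mem ht; simp only [_root_.levelAt, List.foldr_nil] at this; omega
    · exact List.Sublist.map _ List.filter_sublist
  | cons f m ih =>
    refine (ih ((List.suffix_cons f m).trans hm)).lift (by omega) _ _ ?_
    rw [← length_levelAt_cons e f, hN]
    exact length_levelAt_mono e hm

/-- The argument has the shape of a fold step; the level `z.1.1` is the start value in the fold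
parameter and is not used. The summand `2 ^ z.2.2.1.length` is the size of the new universe. -/
theorem PTm.liftLevel : PTm
    (fun z : (Level × Bool) × (Bool × Level) => sz z + 2 ^ z.2.2.1.length)
    (fun z => liftLevel z.1.2 z.2.1 z.2.2) := by
  have hsz : PolyBd (fun z : (Level × Bool) × (Bool × Level) => sz z + 2 ^ z.2.2.1.length) sz :=
    PolyBd.self.mono fun e => Nat.le_add_right _ _
  have h := PTm.allWords (ε := (Level × Bool) × (Bool × Level))
    (μ := fun z => sz z + 2 ^ z.2.2.1.length) (f := fun z => z.2.2.1)
    (.of_pt (by fun_prop) hsz) (PolyBd.self.mono fun e => by omega)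
  have h' := PTm.comp (g := fun z : List Word => z.map (fun w => (enc w : Data))) (by fun_prop) h
  exact PTm.comp PT.liftLevelWith ((PTm.of_pt (f := fun z : (Level × Bool) × (Bool × Level) =>
    (z.1.2, z.2.1)) (by fun_prop) hsz).pair
    ((PTm.of_pt (f := fun z : (Level × Bool) × (Bool × Level) => z.2.2) (by fun_prop) hsz).pair h'))

/-- One step is exponential in its input, so `PT` closure does not apply. All intermediate levels
and all steps are instead bounded through the top universe. -/
theorem PTm.topLevel : PTm nodeMeasure (fun e => levelAt e e.flags) := by
  have hsz := PolyBd.sz_nodeMeasure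
  have hfl : PTm nodeMeasure (fun e : NodeInput => e.flags) :=
    .of_pt (by unfold NodeInput.flags; fun_prop) hsz
  have hp := PTm.baseLevel.pair (PTm.of_pt (f := fun e : NodeInput => e.2.1.1) (by fun_prop) hsz)
  obtain ⟨-, B, ⟨C, k, hB⟩, hs⟩ := PTm.liftLevel
  let S : NodeInput → ℕ := fun e =>
    let N := (levelAt e e.flags).1.length
    let D := 4 * N + 1 + sz (_root_.baseLevel e)
    2 * (N * (D + 1) + 1) + (2 ^ e.kinds.length * (2 * D + 2) + 1) +
      ((N + N ^ 2) * (3 * D + 5) + 1) + 3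
  have hS : ∀ (e : NodeInput) (m : List Bool), m <:+ e.flags → sz (levelAt e m) ≤ S e :=
    fun e m hm => (LevelBd.levelAt e rfl le_rfl hm).sz_le
  have hSp : PolyBd nodeMeasure S := by
    have hN : PolyBd nodeMeasure (fun e => (levelAt e e.flags).1.length) :=
      PolyBd.self.mono length_le_nodeMeasure
    have hQ : PolyBd nodeMeasure (fun e => 2 ^ e.kinds.length) :=
      PolyBd.self.mono pow_kinds_le_nodeMeasure
    have hD := (((PolyBd.const 4).mul hN).add (.const 1)).add PTm.baseLevel.1
    exact ((((PolyBd.const 2).mul ((hN.mul (hD.add (.const 1))).add (.const 1))).add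
      ((hQ.mul (((PolyBd.const 2).mul hD).add (.const 2))).add (.const 1))).add
      (((hN.add (hN.pow 2)).mul (((PolyBd.const 3).mul hD).add (.const 5))).add (.const 1))).add
      (.const 3)
  refine PTm.foldrm (p := fun e => (_root_.baseLevel e, e.2.1.1))
    (f := fun z => z.1) (s := fun z => _root_.liftLevel z.1.2 z.2.1 z.2.2) (Bs := B)
    (g := fun e => S e + C * (sz (_root_.baseLevel e, e.2.1.1) + S e + 5 +
      nodeMeasure e + 1) ^ k)
    hp hfl (by fun_prop) hs ?_ ?_ ?_
  · exact hSp.add ((PolyBd.const _).mul (((((hp.1.add hSp).add (.const 5)).add .self).add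
      (.const 1)).pow k))
  · exact fun e => le_add_right (hS e _ (List.suffix_refl _))
  · intro e a m hm
    refine le_add_left ((hB _).trans (Nat.mul_le_mul_left _ (Nat.pow_le_pow_left ?_ _)))
    have h1 := hS e m ((List.suffix_cons a m).trans hm)
    have h2 := length_levelAt_mono e hm
    -- The exponential term in the cost of a step is the size of the next universe, hence at most
    -- that of the top one.
    rw [length_levelAt_cons] at h2
    have h3 := length_le_nodeMeasure e
    have h4 := sz_bool a
    simp only [sz_pair] at *
    change _ + (sz a + sz (levelAt e m) + 1) + 1 + 2 ^ (levelAt e m).1.length + 1 ≤ _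
    omega

@[fun_prop]
theorem PT.toWord {ε : Type} [Enc ε] {f : ε → Data} (hf : PT f) : PT (fun x => toWord (f x)) := by
  unfold _root_.toWord; fun_prop

theorem PTm.nodeFn : PTm nodeMeasure nodeFn := by
  have hsz := PolyBd.sz_nodeMeasure
  exact PTm.comp (g := fun z : Op × Level => nodeOut z.1 z.2)
    (by unfold nodeOut prefixes; fun_prop) ((PTm.of_pt (by fun_prop) hsz).pair PTm.topLevel)

theorem PTm.acceptFn : PTm nodeMeasure acceptFn :=
  PTm.comp (g := fun z : Level => acceptOut z) (by unfold acceptOut; fun_prop) PTm.topLevel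

/-- At most 8 prefixes combine with one row per tuple of one or two children; the last term accounts
for leaves. -/
theorem length_nodeFn_le (e : NodeInput) : (nodeFn e).length ≤
    8 * ((levelAt e e.flags).1.length + (levelAt e e.flags).1.length ^ 2) + 2 ^ e.kinds.length := by
  have h := LevelBd.levelAt e rfl le_rfl (List.suffix_refl _)
  have h1 := h.length_leaf
  have h2 := h.length_table
  have h3 : ∀ u, (prefixes u).length ≤ 8 := by rintro (_ | _) <;> simp [prefixes, length_allWords]
  unfold nodeFn nodeOut
  cases e.2.1.1 || e.2.1.2
  · simpa using le_add_left h1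
  · simp only [cond_true, List.length_flatMap, List.length_map, List.map_const', List.sum_replicate,
      smul_eq_mul]
    exact le_add_right (Nat.mul_le_mul (h3 _) h2)

/-! ### Runs of the automata -/

theorem enc_mask_getElem {α : Type} (U : List α) (p : α → Bool) :
    (mask U p).toList = U.map (fun x => Data.ofBool (p x)) := by
  induction U with
  | nil => rfl
  | cons a U ih =>
    have : mask (a :: U) p = .cons (.ofBool (p a)) (mask U p) := rfl
    rw [this, Data.toList, ih, List.map_cons]

theorem isCons_ofBool (b : Bool) : (Data.ofBool b).isCons = b := by cases b <;> rfl

theorem elems_mask {α : Type} (U : List α) (p : α → Bool) : elems U (mask U p) = U.filter p := by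
  rw [elems, enc_mask_getElem]
  induction U with
  | nil => rfl
  | cons a U ih =>
    simp only [List.map_cons, List.zip_cons_cons, List.filter_cons, isCons_ofBool]
    cases p a <;> simp [ih]

theorem mask_congr {α : Type} {U : List α} {p p' : α → Bool} (h : ∀ x ∈ U, p x = p' x) :
    mask U p = mask U p' := by
  rw [mask, mask, List.map_congr_left h]

/-- The states of a level. -/
def univ (kinds : List Bool) (width : Word) : List Bool → List Data
  | [] => (baseStates kinds width).map (fun s => enc s)
  | _ :: m => (allWords (univ kinds width m)).map (fun w => enc w)

theorem levelAt_univ (e : NodeInput) (m : List Bool) :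
    (levelAt e m).1 = univ e.kinds e.width m := by
  induction m with
  | nil => rfl
  | cons f m ih => rw [levelAt_cons, liftLevel, liftLevelWith, univ, ih]

theorem mask_mem_univ (kinds : List Bool) (width : Word) (f : Bool) (m : List Bool)
    (p : Data → Bool) : mask (univ kinds width m) p ∈ univ kinds width (f :: m) := by
  rw [univ, List.mem_map]
  exact ⟨_, mem_allWords.2 (List.length_map _), rfl⟩

section

variable {ω : ℕ} (kinds : List Bool) (κ : Fin ω → Word)

/-- The run of the base automaton on a decomposition with labelled vertices. -/
def baseRun : (D : CWDecomp ω) → (D.Vertex → List Bool) → BState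
  | .intro a, lab => introState kinds (κ a) (lab ())
  | .join l r, lab =>
      joinState (baseRun l (fun v => lab (Sum.inl v))) (baseRun r (fun v => lab (Sum.inr v)))
  | .recolor a b t, lab => recolorState (κ a, κ b) (baseRun t lab)
  | .addEdges a b t, lab => addState (κ a, κ b) (baseRun t lab)

variable (width : Word)

open Classical in
/-- The run of the automaton of a level, in which the innermost variables are quantified. -/
noncomputable def runAt : List Bool → (D : CWDecomp ω) → (D.Vertex → List Bool) → Data
  | [], D, lab => enc (baseRun kinds κ D lab)
  | _ :: m, D, lab => mask (univ kinds width m)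
      (fun x => decide (∃ b : D.Vertex → Bool, x = runAt m D (fun v => b v :: lab v)))

/-- The type of the root of a decomposition. -/
def rootOp : CWDecomp ω → Op
  | .intro a => ((false, false), (κ a, []))
  | .join _ _ => ((false, true), ([], []))
  | .recolor a b _ => ((true, false), (κ a, κ b))
  | .addEdges a b _ => ((true, true), (κ a, κ b))

/-- All labels have the length of a level. -/
def Labelled (m : List Bool) {V : Type} (lab : V → List Bool) : Prop :=
  ∀ v, (lab v).length + m.length = kinds.length

/-- The records that can occur. -/
def WFRec (r : VRec) : Prop := r ∈ allRecs (upWords width) (allWords kinds)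

theorem wfRec_iff (r : VRec) : WFRec kinds width r ↔ ∀ c w d, r = some (some (c, (w, d))) →
    c.length ≤ width.length ∧ w.length = kinds.length ∧ d.length = kinds.length := by
  rcases r with _ | _ | ⟨c, w, d⟩ <;>
    simp [WFRec, allRecs, mem_allWords, mem_upWords]

variable {kinds κ width}

theorem baseRun_mem (hκ : true ∈ kinds → ∀ a, (κ a).length ≤ width.length) (D : CWDecomp ω)
    (lab : D.Vertex → List Bool) (hlab : Labelled kinds [] lab) :
    baseRun kinds κ D lab ∈ baseStates kinds width := by
  rw [baseStates, mem_allStates]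
  have hlen : ∀ s : BState, (List.Forall₂ (fun k r => if k = true then
      r ∈ allRecs (upWords width) (allWords kinds) else r = none) kinds s) ↔
      s.length = kinds.length ∧ ∀ i (h : i < kinds.length) (h' : i < s.length),
        if kinds[i] = true then WFRec kinds width s[i] else s[i] = none := by
    intro s
    rw [List.forall₂_iff_get]
    simp only [List.get_eq_getElem, WFRec, eq_comm]
  rw [hlen]
  induction D with
  | intro a =>
    have h0 := hlab ()
    simp only [List.length_nil, add_zero] at h0
    refine ⟨by simp [baseRun, introState, h0], fun i h h' => ?_⟩
    simp only [baseRun, introState, List.getElem_map, List.getElem_zip]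
    cases hk : kinds[i]
    · simp
    · have hmem : true ∈ kinds := hk ▸ List.getElem_mem h
      simp only [if_true, Bool.true_and, wfRec_iff]
      intro c w d
      cases (lab ())[i]
      · simp
      · simp only [cond_true, Option.some.injEq, Prod.mk.injEq]
        rintro ⟨rfl, rfl, rfl⟩
        exact ⟨hκ hmem a, h0, by simp⟩
  | join l r ihl ihr =>
    obtain ⟨h1, h2⟩ := ihl (fun v => lab (Sum.inl v)) (fun v => hlab _)
    obtain ⟨h3, h4⟩ := ihr (fun v => lab (Sum.inr v)) (fun v => hlab _)
    refine ⟨by simp [baseRun, joinState, h1, h3], fun i h h' => ?_⟩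
    have h5 := h2 i h (by omega)
    have h6 := h4 i h (by omega)
    simp only [baseRun, joinState, List.getElem_map, List.getElem_zip]
    cases hk : kinds[i]
    · simp only [hk, Bool.false_eq_true, if_false] at h5 h6 ⊢
      rw [h5, h6]; rfl
    · simp only [hk, if_true, wfRec_iff] at h5 h6 ⊢
      generalize (baseRun kinds κ l fun v => lab (Sum.inl v))[i] = x at *
      generalize (baseRun kinds κ r fun v => lab (Sum.inr v))[i] = y at *
      rcases x with _ | x
      · simpa [joinRec] using h6
      · rcases y with _ | y
        · simpa [joinRec] using h5
        · simp [joinRec]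
  | recolor a b t ih =>
    obtain ⟨h1, h2⟩ := ih lab hlab
    refine ⟨by simp [baseRun, recolorState, h1], fun i h h' => ?_⟩
    have h5 := h2 i h (by omega)
    simp only [baseRun, recolorState, List.getElem_map]
    cases hk : kinds[i]
    · simp only [hk, Bool.false_eq_true, if_false] at h5 ⊢
      rw [h5]; rfl
    · have hmem : true ∈ kinds := hk ▸ List.getElem_mem h
      simp only [hk, if_true, wfRec_iff] at h5 ⊢
      generalize (baseRun kinds κ t lab)[i] = x at *
      rcases x with _ | _ | ⟨c, w, d⟩
      · simp [mapInfo]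
      · simp [mapInfo]
      · have h6 := h5 c w d rfl
        rintro c' w' d' h7
        simp only [mapInfo, recolorInfo, Option.elim, Option.some.injEq, Prod.mk.injEq] at h7
        obtain ⟨rfl, rfl, rfl⟩ := h7
        refine ⟨?_, h6.2⟩
        cases encEq c (κ a)
        · exact h6.1
        · exact hκ hmem b
  | addEdges a b t ih =>
    obtain ⟨h1, h2⟩ := ih lab hlab
    refine ⟨by simp [baseRun, addState, h1], fun i h h' => ?_⟩
    have h5 := h2 i h (by omega)
    simp only [baseRun, addState, List.getElem_map]
    cases hk : kinds[i]
    · simp only [hk, Bool.false_eq_true, if_false] at h5 ⊢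
      rw [h5]; rfl
    · simp only [hk, if_true, wfRec_iff] at h5 ⊢
      generalize (baseRun kinds κ t lab)[i] = x at *
      rcases x with _ | _ | ⟨c, w, d⟩
      · simp [mapInfo]
      · simp [mapInfo]
      · have h6 := h5 c w d rfl
        rintro c' w' d' h7
        simp only [mapInfo, addInfo, Option.elim, Option.some.injEq, Prod.mk.injEq] at h7
        obtain ⟨rfl, rfl, rfl⟩ := h7
        exact ⟨h6.1, h6.2.1, by simp [h1, h6.2.2]⟩

theorem runAt_mem (hκ : true ∈ kinds → ∀ a, (κ a).length ≤ width.length) (m : List Bool)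
    (D : CWDecomp ω) (lab : D.Vertex → List Bool) (hlab : Labelled kinds m lab) :
    runAt kinds κ width m D lab ∈ univ kinds width m := by
  cases m with
  | nil => exact List.mem_map_of_mem (baseRun_mem hκ D lab hlab)
  | cons f m => exact mask_mem_univ _ _ _ _ _

theorem Labelled.cons {f : Bool} {m : List Bool} {V : Type} {lab : V → List Bool}
    (h : Labelled kinds (f :: m) lab) (b : V → Bool) : Labelled kinds m (fun v => b v :: lab v) :=
  fun v => by have := h v; simp only [List.length_cons] at *; omega

theorem Labelled.inl {m : List Bool} {V W : Type} {lab : V ⊕ W → List Bool}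
    (h : Labelled kinds m lab) : Labelled kinds m (fun v => lab (Sum.inl v)) := fun _ => h _

theorem Labelled.inr {m : List Bool} {V W : Type} {lab : V ⊕ W → List Bool}
    (h : Labelled kinds m lab) : Labelled kinds m (fun v => lab (Sum.inr v)) := fun _ => h _

theorem mem_elems_runAt {f : Bool} {m : List Bool} {D : CWDecomp ω} {lab : D.Vertex → List Bool}
    {x : Data} : x ∈ elems (univ kinds width m) (runAt kinds κ width (f :: m) D lab) ↔
      x ∈ univ kinds width m ∧
        ∃ b : D.Vertex → Bool, x = runAt kinds κ width m D (fun v => b v :: lab v) := by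
  rw [runAt, elems_mask, List.mem_filter, @decide_eq_true_iff]

/-! ### Tables -/

/-- The rows of a table are determined by the states of the children, which are in `U`. -/
def IsTable (unary : Bool) (U : List Data) (T : List (List Data)) : Prop :=
  ∃ F : List Data → Data, T = (keys unary U).map (fun k => F k :: k)

theorem isTable_levelAt (e : NodeInput) (m : List Bool) :
    IsTable e.2.1.1 (levelAt e m).1 (levelAt e m).2.2.1 := by
  cases m with
  | cons f m => exact ⟨_, rfl⟩
  | nil =>
    have hkeys : keys e.2.1.1 ((baseStates e.kinds e.width).map (fun s => (enc s : Data))) =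
        (keys e.2.1.1 (baseStates e.kinds e.width)).map
          (fun k => k.map (fun s => (enc s : Data))) := by
      cases e.2.1.1 <;> simp [keys, List.map_flatMap, List.flatMap_map, Function.comp_def]
    have hinj : Function.Injective (fun k : List BState => k.map (fun s => (enc s : Data))) :=
      List.map_injective_iff.2 inj
    -- The row function decodes its argument first; it is well defined on keys because encodings are
    -- injective.
    refine ⟨fun k => enc (baseOp e.2 (Function.invFun
      (fun k : List BState => k.map (fun s => (enc s : Data))) k)), ?_⟩
    simp only [levelAt, List.foldr_nil, baseLevel, baseWith]
    rw [hkeys, List.map_map]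
    refine List.map_congr_left fun k _ => ?_
    simp only [Function.comp, List.map_cons, Function.leftInverse_invFun hinj k]

/-- Determinism of the automaton of a level. -/
theorem IsTable.unique {u : Bool} {U : List Data} {T : List (List Data)} (h : IsTable u U T)
    {x y : Data} {k : List Data} (hx : x :: k ∈ T) (hy : y :: k ∈ T) : x = y := by
  obtain ⟨F, rfl⟩ := h
  simp only [List.mem_map, List.cons.injEq] at hx hy
  obtain ⟨_, _, rfl, rfl⟩ := hx
  obtain ⟨_, _, rfl, rfl⟩ := hy
  rfl

theorem IsTable.binary {U : List Data} {T : List (List Data)} (h : IsTable false U T)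
    {t : List Data} (ht : t ∈ T) : ∃ x a b, a ∈ U ∧ b ∈ U ∧ t = [x, a, b] := by
  obtain ⟨F, rfl⟩ := h
  simp only [keys, cond_false, List.mem_map, List.mem_flatMap] at ht
  obtain ⟨_, ⟨a, ha, b, hb, rfl⟩, rfl⟩ := ht
  exact ⟨_, a, b, ha, hb, rfl⟩

theorem IsTable.unary {U : List Data} {T : List (List Data)} (h : IsTable true U T)
    {t : List Data} (ht : t ∈ T) : ∃ x a, a ∈ U ∧ t = [x, a] := by
  obtain ⟨F, rfl⟩ := h
  simp only [keys, cond_true, List.mem_map] at ht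
  obtain ⟨_, ⟨a, ha, rfl⟩, rfl⟩ := ht
  exact ⟨_, a, ha, rfl⟩

theorem mem_keys_pair {α : Type} {U : List α} {a b : α} (ha : a ∈ U) (hb : b ∈ U) :
    [a, b] ∈ keys false U := by
  simp only [keys, cond_false, List.mem_flatMap, List.mem_map]
  exact ⟨a, ha, b, hb, rfl⟩

theorem mem_keys_single {α : Type} {U : List α} {a : α} (ha : a ∈ U) : [a] ∈ keys true U := by
  simp only [keys, cond_true, List.mem_map]
  exact ⟨a, ha, rfl⟩

/-- Induction over the levels. If an old row starts from members of the two sets, these members are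
runs for choices `i` and `j` on the two parts; by determinism its head is the run for `Sum.elim i
j`. Conversely, a choice on the union restricts to both parts. -/
theorem table_join (hκ : true ∈ kinds → ∀ a, (κ a).length ≤ width.length) (e : NodeInput)
    (hek : e.kinds = kinds) (hew : e.width = width) (l r : CWDecomp ω)
    (ho : e.2 = rootOp κ (.join l r)) (m : List Bool) (lab : (CWDecomp.join l r).Vertex → List Bool)
    (hlab : Labelled kinds m lab) :
    [runAt kinds κ width m (.join l r) lab, runAt kinds κ width m l (fun v => lab (Sum.inl v)),
      runAt kinds κ width m r (fun v => lab (Sum.inr v))] ∈ (levelAt e m).2.2.1 := by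
  have hu : ∀ m, (levelAt e m).1 = univ kinds width m := by
    intro m; rw [levelAt_univ, hek, hew]
  subst hek hew
  have hun : e.2.1.1 = false := by rw [ho]; rfl
  induction m generalizing lab with
  | nil =>
    simp only [levelAt, List.foldr_nil, baseLevel, baseWith]
    rw [List.mem_map]
    refine ⟨[baseRun e.kinds κ l (fun v => lab (Sum.inl v)),
      baseRun e.kinds κ r (fun v => lab (Sum.inr v))], ?_, ?_⟩
    · rw [hun]
      exact mem_keys_pair (baseRun_mem hκ l _ hlab.inl) (baseRun_mem hκ r _ hlab.inr)
    · simp only [List.map_cons, List.map_nil, runAt, ho]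
      rfl
  | cons f m ih =>
    have hT := isTable_levelAt e m
    rw [hu, hun] at hT
    rw [levelAt_cons, liftLevel, liftLevelWith]
    simp only [liftTable]
    rw [List.mem_map]
    refine ⟨_, ?_, List.cons_eq_cons.2 ⟨?_, rfl⟩⟩
    · rw [hun, hu]
      exact mem_keys_pair (runAt_mem hκ (f :: m) l _ hlab.inl) (runAt_mem hκ (f :: m) r _ hlab.inr)
    · rw [hu]
      refine mask_congr fun x hx => ?_
      rw [Bool.eq_iff_iff, @decide_eq_true_iff, List.any_eq_true]
      constructor
      · rintro ⟨t, ht, h⟩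
        obtain ⟨y, a, b, ha, hb, rfl⟩ := hT.binary ht
        simp only [List.head?_cons, encEq_iff, Option.some.injEq, List.tail_cons,
          List.zip_cons_cons, List.zip_nil_left, List.all_cons, List.all_nil, Bool.and_true,
          Bool.and_eq_true, List.any_eq_true, exists_eq_right', mem_elems_runAt] at h
        obtain ⟨rfl, ⟨_, i, rfl⟩, _, j, rfl⟩ := h
        exact ⟨Sum.elim i j, hT.unique ht (ih (fun v => (Sum.elim i j v : Bool) :: lab v)
          (hlab.cons _))⟩
      · rintro ⟨b, rfl⟩
        refine ⟨_, ih _ (hlab.cons b), ?_⟩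
        simp only [List.head?_cons, encEq_iff, List.tail_cons,
          List.zip_cons_cons, List.zip_nil_left, List.all_cons, List.all_nil, Bool.and_true,
          Bool.and_eq_true, List.any_eq_true, exists_eq_right', mem_elems_runAt]
        refine ⟨trivial, ⟨runAt_mem hκ m l _ (hlab.cons b).inl, fun v => b (Sum.inl v), rfl⟩,
          runAt_mem hκ m r _ (hlab.cons b).inr, fun v => b (Sum.inr v), rfl⟩

/-- The run on a decomposition whose root has one child. -/
theorem table_unary (hκ : true ∈ kinds → ∀ a, (κ a).length ≤ width.length) (e : NodeInput)
    (hek : e.kinds = kinds) (hew : e.width = width) (D t : CWDecomp ω)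
    -- For a recoloring and for an insertion of edges this equality holds by definition, so one
    -- proof covers both.
    (hV : D.Vertex = t.Vertex) (hun : e.2.1.1 = true)
    (hrun : ∀ lab : t.Vertex → List Bool,
      baseRun kinds κ D (fun v => lab (cast hV v)) = baseOp e.2 [baseRun kinds κ t lab])
    (m : List Bool) (lab : t.Vertex → List Bool) (hlab : Labelled kinds m lab) :
    [runAt kinds κ width m D (fun v => lab (cast hV v)), runAt kinds κ width m t lab] ∈
      (levelAt e m).2.2.1 := by
  have hu : ∀ m, (levelAt e m).1 = univ kinds width m := by
    intro m; rw [levelAt_univ, hek, hew]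
  subst hek hew
  induction m generalizing lab with
  | nil =>
    simp only [levelAt, List.foldr_nil, baseLevel, baseWith]
    rw [List.mem_map]
    refine ⟨[baseRun e.kinds κ t lab], ?_, ?_⟩
    · rw [hun]
      exact mem_keys_single (baseRun_mem hκ t _ hlab)
    · simp only [List.map_cons, List.map_nil, runAt, hrun]
  | cons f m ih =>
    have hT := isTable_levelAt e m
    rw [hu, hun] at hT
    rw [levelAt_cons, liftLevel, liftLevelWith]
    simp only [liftTable]
    rw [List.mem_map]
    refine ⟨_, ?_, List.cons_eq_cons.2 ⟨?_, rfl⟩⟩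
    · rw [hun, hu]
      exact mem_keys_single (runAt_mem hκ (f :: m) t _ hlab)
    · rw [hu]
      refine mask_congr fun x hx => ?_
      rw [Bool.eq_iff_iff, @decide_eq_true_iff, List.any_eq_true]
      constructor
      · rintro ⟨s, ht, h⟩
        obtain ⟨y, a, ha, rfl⟩ := hT.unary ht
        simp only [List.head?_cons, encEq_iff, Option.some.injEq, List.tail_cons,
          List.zip_cons_cons, List.zip_nil_left, List.all_cons, List.all_nil, Bool.and_true,
          Bool.and_eq_true, List.any_eq_true, exists_eq_right', mem_elems_runAt] at h
        obtain ⟨rfl, _, i, rfl⟩ := h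
        exact ⟨fun v => i (cast hV v), hT.unique ht (ih (fun v => i v :: lab v) (hlab.cons _))⟩
      · rintro ⟨b, rfl⟩
        have h1 := ih (fun v => b (cast hV.symm v) :: lab v) (hlab.cons _)
        simp only [cast_cast, cast_eq] at h1
        refine ⟨_, h1, ?_⟩
        simp only [List.head?_cons, encEq_iff, List.tail_cons,
          List.zip_cons_cons, List.zip_nil_left, List.all_cons, List.all_nil, Bool.and_true,
          Bool.and_eq_true, List.any_eq_true, exists_eq_right', mem_elems_runAt]
        exact ⟨trivial, runAt_mem hκ m t _ (hlab.cons _), _, rfl⟩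

/-- The labelled states of a leaf are correct. -/
theorem leaf_spec (hκ : true ∈ kinds → ∀ a, (κ a).length ≤ width.length) (e : NodeInput)
    (hek : e.kinds = kinds) (hew : e.width = width) (a : Fin ω)
    (ho : e.2 = rootOp κ (.intro a)) (m : List Bool) (hm : m.length ≤ kinds.length) :
    (∀ y ∈ (levelAt e m).2.1, y.1.length + m.length = kinds.length ∧
      y.2 = runAt kinds κ width m (.intro a) (fun _ => y.1)) ∧
    ∀ w : Word, w.length + m.length = kinds.length → ∃ y ∈ (levelAt e m).2.1, y.1 = w := by
  have hu : ∀ m, (levelAt e m).1 = univ kinds width m := by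
    intro m; rw [levelAt_univ, hek, hew]
  subst hek hew
  induction m with
  | nil =>
    simp only [levelAt, List.foldr_nil, baseLevel, baseWith]
    constructor
    · intro y hy
      obtain ⟨b, hb, rfl⟩ := List.mem_map.1 hy
      refine ⟨mem_allWords.1 hb, ?_⟩
      simp only [runAt, ho]
      rfl
    · intro w hw
      exact ⟨_, List.mem_map_of_mem (mem_allWords.2 hw), rfl⟩
  | cons f m ih =>
    simp only [List.length_cons] at hm
    obtain ⟨ih1, ih2⟩ := ih (by omega)
    rw [levelAt_cons, liftLevel, liftLevelWith]
    simp only [liftLeaf]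
    constructor
    · intro y hy
      obtain ⟨z, hz, rfl⟩ := List.mem_map.1 hy
      have hz1 := (ih1 z hz).1
      simp only [List.length_tail, List.length_cons]
      refine ⟨by omega, ?_⟩
      rw [hu, runAt]
      refine mask_congr fun x _ => ?_
      rw [Bool.eq_iff_iff, @decide_eq_true_iff, List.any_eq_true]
      simp only [Bool.and_eq_true, encEq_iff]
      constructor
      · rintro ⟨z', hz', h1, rfl⟩
        obtain ⟨h2, h3⟩ := ih1 z' hz'
        have h4 : z'.1 ≠ [] := by
          intro h; rw [h] at h2; simp only [List.length_nil] at h2; omega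
        refine ⟨fun _ => z'.1.head h4, ?_⟩
        simp only [h3, ← h1, List.cons_head_tail]
      · rintro ⟨b, rfl⟩
        obtain ⟨z', hz', h1⟩ := ih2 (b () :: z.1.tail)
          (by simp only [List.length_cons, List.length_tail]; omega)
        refine ⟨z', hz', by rw [h1, List.tail_cons], ?_⟩
        rw [(ih1 z' hz').2, h1]
        rfl
    · intro w hw
      -- Any extension of `w` by one bit would do.
      obtain ⟨z, hz, h1⟩ := ih2 (false :: w) (by simp only [List.length_cons] at *; omega)
      exact ⟨_, List.mem_map_of_mem hz, by simp [h1]⟩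

/-! ### Acceptance -/

/-- Quantification over the innermost variables, as sets. -/
def SatAt {V : Type} (K : (V → List Bool) → Prop) : List Bool → (V → List Bool) → Prop
  | [], lab => K lab
  | f :: m, lab => if f = true then ∃ b : V → Bool, SatAt K m (fun v => b v :: lab v)
      else ∀ b : V → Bool, SatAt K m (fun v => b v :: lab v)

/-- The members of the set reached at a level are exactly the runs of the level below for the
possible choices `b`; so "some member" is ∃ and "all members" is ∀. -/
theorem acc_spec (hκ : true ∈ kinds → ∀ a, (κ a).length ≤ width.length) (e : NodeInput)
    (hek : e.kinds = kinds) (hew : e.width = width) (D : CWDecomp ω) (m : List Bool)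
    (lab : D.Vertex → List Bool) (hlab : Labelled kinds m lab) :
    runAt kinds κ width m D lab ∈ (levelAt e m).2.2.2 ↔
      SatAt (fun lab => stripState (baseRun kinds κ D lab) ∈ e.matrix) m lab := by
  have hu : ∀ m, (levelAt e m).1 = univ kinds width m := by
    intro m; rw [levelAt_univ, hek, hew]
  subst hek hew
  induction m generalizing lab with
  | nil =>
    simp only [levelAt, List.foldr_nil, baseLevel, baseWith, SatAt, runAt]
    rw [List.mem_map_of_injective inj, List.mem_filter, List.any_eq_true]
    simp only [encEq_iff, exists_eq_right']
    exact and_iff_right (baseRun_mem hκ D lab hlab)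
  | cons f m ih =>
    have hmem : runAt e.kinds κ e.width (f :: m) D lab ∈
        (allWords (levelAt e m).1).map (fun w => (enc w : Data)) := by
      rw [hu]; exact runAt_mem hκ (f :: m) D lab hlab
    have ih' := fun b : D.Vertex → Bool => ih _ (hlab.cons b)
    have hm := fun b : D.Vertex → Bool => runAt_mem hκ m D _ (hlab.cons b)
    rw [levelAt_cons, liftLevel, liftLevelWith, SatAt]
    simp only [liftAcc]
    rw [List.mem_filter, and_iff_right hmem, hu]
    cases f
    · simp only [cond_false, List.all_eq_true, List.any_eq_true, encEq_iff, exists_eq_right',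
        mem_elems_runAt, Bool.false_eq_true, if_false]
      constructor
      · exact fun h b => (ih' b).1 (h _ ⟨hm b, b, rfl⟩)
      · rintro h _ ⟨_, b, rfl⟩
        exact (ih' b).2 (h b)
    · simp only [cond_true, List.any_eq_true, encEq_iff, exists_eq_right',
        mem_elems_runAt, if_true]
      constructor
      · rintro ⟨_, ⟨_, b, rfl⟩, h⟩
        exact ⟨b, (ih' b).1 h⟩
      · rintro ⟨b, h⟩
        exact ⟨_, ⟨hm b, b, rfl⟩, (ih' b).2 h⟩

end

/-! ### Witnesses -/

theorem toWord_enc (w : Word) : toWord (enc w) = w := by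
  induction w with
  | nil => rfl
  | cons b w ih =>
    have : toWord (enc (b :: w)) = (enc b : Data).isCons :: toWord (enc w) := rfl
    rw [this, ih]
    cases b <;> rfl

/-- `toWord` forgets everything inside the entries of a list but whether they are `nil`, so it is
faithful only on encoded words. Masks are such encodings; a base state is one if all its records are
`none`, which holds when there is no vertex variable. -/
theorem exists_word_of_mem_univ {kinds : List Bool} {width : Word} {m : List Bool}
    (h : m ≠ [] ∨ true ∉ kinds) {x : Data} (hx : x ∈ univ kinds width m) :
    ∃ w : Word, x = enc w := by
  cases m with
  | cons f m =>
    obtain ⟨w, _, rfl⟩ := List.mem_map.1 hx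
    exact ⟨w, rfl⟩
  | nil =>
    simp only [ne_eq, not_true, false_or] at h
    obtain ⟨s, hs, rfl⟩ := List.mem_map.1 hx
    rw [baseStates, mem_allStates] at hs
    refine ⟨s.map (fun _ => false), ?_⟩
    clear hx
    generalize allRecs (upWords width) (allWords kinds) = recs at hs
    induction hs with
    | nil => rfl
    | @cons k r _ _ hr _ ih =>
      simp only [List.mem_cons, not_or] at h
      have hk : ¬ k = true := fun hk => h.1 hk.symm
      rw [if_neg hk] at hr
      rw [hr, enc_cons, ih h.2, List.map_cons, enc_cons]
      rfl

theorem toWord_inj {kinds : List Bool} {width : Word} {m : List Bool}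
    (h : m ≠ [] ∨ true ∉ kinds) {x y : Data} (hx : x ∈ univ kinds width m)
    (hy : y ∈ univ kinds width m) (hxy : toWord x = toWord y) : x = y := by
  obtain ⟨v, rfl⟩ := exists_word_of_mem_univ h hx
  obtain ⟨w, rfl⟩ := exists_word_of_mem_univ h hy
  rw [toWord_enc, toWord_enc] at hxy
  rw [hxy]

theorem mem_nodeOut {o : Op} (ho : (o.1.1 || o.1.2) = true) {X : Level} {t : List Word} :
    t ∈ nodeOut o X ↔ ∃ p ∈ prefixes o.1.1, ∃ s ∈ X.2.2.1,
      t = (p.zip s).map (fun z => z.1 :: toWord z.2) := by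
  simp only [nodeOut, ho, cond_true, List.mem_flatMap, List.mem_map, eq_comm]

theorem mem_acceptOut {X : Level} {b : Bool} {w : Word} :
    b :: w ∈ acceptOut X ↔ ∃ x ∈ X.2.2.2, w = toWord x := by
  simp only [acceptOut, List.mem_flatMap, List.mem_cons, List.cons.injEq, List.not_mem_nil,
    or_false]
  cases b <;> simp

theorem mem_prefixes_false {p : Word} : p ∈ prefixes false ↔ ∃ a b c, p = [a, b, c] := by
  simp only [prefixes, cond_false, mem_allWords, List.length_cons, List.length_nil]
  exact List.length_eq_three

theorem mem_prefixes_true {p : Word} : p ∈ prefixes true ↔ ∃ a b, p = [a, b] := by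
  simp only [prefixes, cond_true, mem_allWords, List.length_cons, List.length_nil]
  exact List.length_eq_two

/-- Vertex membership is stored in the first bit. -/
def memBit (w : Word) : Bool := w.headD false

section

variable {ω : ℕ} (P : Params) (κ : Fin ω → Word) (width : Word)

/-- The type of a node. -/
def opAt : {D : CWDecomp ω} → D.Node → Op
  | .intro a, .introRoot => rootOp κ (.intro a)
  | .join l r, .joinRoot => rootOp κ (.join l r)
  | .join _ _, .joinLeft s => opAt s
  | .join _ _, .joinRight s => opAt s
  | .recolor a b t, .recolorRoot => rootOp κ (.recolor a b t)
  | .recolor _ _ _, .recolorSub s => opAt s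
  | .addEdges a b t, .addEdgesRoot => rootOp κ (.addEdges a b t)
  | .addEdges _ _ _, .addEdgesSub s => opAt s

/-- The local part of the definition of witnesses. -/
def IsLocal (D : CWDecomp ω) (α : D.Node → Word) : Prop :=
  ∀ t : D.Node, α t :: (CWDecomp.children t).map α ∈ nodeFn ((P, width), opAt κ t)

/-- The state of the root of `D`, for a vertex set `S`. -/
noncomputable def rootState (D : CWDecomp ω) (S : D.Vertex → Bool) : Word :=
  toWord (runAt P.1 κ width P.2.1 D (fun v => [S v]))

variable {P κ width}

theorem isLocal_join {l r : CWDecomp ω} {α : (CWDecomp.join l r).Node → Word} :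
    IsLocal P κ width (.join l r) α ↔
      [α .joinRoot, α (.joinLeft l.root), α (.joinRight r.root)] ∈
        nodeFn ((P, width), rootOp κ (.join l r)) ∧
      IsLocal P κ width l (fun s => α (.joinLeft s)) ∧
      IsLocal P κ width r (fun s => α (.joinRight s)) := by
  constructor
  · intro h
    refine ⟨h .joinRoot, fun s => ?_, fun s => ?_⟩
    · have := h (.joinLeft s)
      rwa [CWDecomp.children, List.map_map] at this
    · have := h (.joinRight s)
      rwa [CWDecomp.children, List.map_map] at this
  · rintro ⟨h1, h2, h3⟩ t
    cases t with
    | joinRoot => exact h1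
    | joinLeft s =>
      have := h2 s
      rw [CWDecomp.children, List.map_map]
      exact this
    | joinRight s =>
      have := h3 s
      rw [CWDecomp.children, List.map_map]
      exact this

theorem isLocal_recolor {a b : Fin ω} {t : CWDecomp ω} {α : (CWDecomp.recolor a b t).Node → Word} :
    IsLocal P κ width (.recolor a b t) α ↔
      [α .recolorRoot, α (.recolorSub t.root)] ∈
        nodeFn ((P, width), rootOp κ (.recolor a b t)) ∧
      IsLocal P κ width t (fun s => α (.recolorSub s)) := by
  constructor
  · intro h
    refine ⟨h .recolorRoot, fun s => ?_⟩
    have := h (.recolorSub s)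
    rwa [CWDecomp.children, List.map_map] at this
  · rintro ⟨h1, h2⟩ t
    cases t with
    | recolorRoot => exact h1
    | recolorSub s =>
      have := h2 s
      rw [CWDecomp.children, List.map_map]
      exact this

theorem isLocal_addEdges {a b : Fin ω} {t : CWDecomp ω}
    {α : (CWDecomp.addEdges a b t).Node → Word} :
    IsLocal P κ width (.addEdges a b t) α ↔
      [α .addEdgesRoot, α (.addEdgesSub t.root)] ∈
        nodeFn ((P, width), rootOp κ (.addEdges a b t)) ∧
      IsLocal P κ width t (fun s => α (.addEdgesSub s)) := by
  constructor
  · intro h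
    refine ⟨h .addEdgesRoot, fun s => ?_⟩
    have := h (.addEdgesSub s)
    rwa [CWDecomp.children, List.map_map] at this
  · rintro ⟨h1, h2⟩ t
    cases t with
    | addEdgesRoot => exact h1
    | addEdgesSub s =>
      have := h2 s
      rw [CWDecomp.children, List.map_map]
      exact this

variable (hκ : true ∈ P.1 → ∀ a, (κ a).length ≤ width.length)
  (hlen : P.1.length = P.2.1.length + 1) (hw : P.2.1 ≠ [] ∨ true ∉ P.1)

include hκ hlen

theorem mem_nodeFn_intro {a : Fin ω} {t : List Word} :
    t ∈ nodeFn ((P, width), rootOp κ (.intro a)) ↔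
      ∃ b, t = [b :: rootState P κ width (.intro a) (fun _ => b)] := by
  obtain ⟨h1, h2⟩ := leaf_spec hκ ((P, width), rootOp κ (.intro a)) rfl rfl a rfl P.2.1 (by omega)
  change t ∈ (_ : Level).2.1.map _ ↔ _
  rw [List.mem_map]
  constructor
  · rintro ⟨y, hy, rfl⟩
    obtain ⟨h3, h4⟩ := h1 y hy
    -- The quantified variables have consumed all bits of the label except that of the free
    -- variable.
    obtain ⟨b, hb⟩ := List.length_eq_one_iff.1 (by omega : y.1.length = 1)
    refine ⟨b, ?_⟩
    simp only [rootState]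
    rw [h4, hb]
    rfl
  · rintro ⟨b, rfl⟩
    obtain ⟨y, hy, hb⟩ := h2 [b] (by rw [hlen, List.length_singleton, add_comm])
    refine ⟨y, hy, ?_⟩
    rw [(h1 y hy).2, hb]
    rfl

omit hκ in
theorem labelled_single {V : Type} (S : V → Bool) : Labelled P.1 P.2.1 (fun v => [S v]) :=
  fun _ => by rw [hlen, List.length_singleton, add_comm]

theorem mem_nodeFn_join (l r : CWDecomp ω) (S : (CWDecomp.join l r).Vertex → Bool) (a b c : Bool) :
    [a :: rootState P κ width (.join l r) S,
      b :: rootState P κ width l (fun v => S (Sum.inl v)),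
      c :: rootState P κ width r (fun v => S (Sum.inr v))] ∈
        nodeFn ((P, width), rootOp κ (.join l r)) := by
  rw [nodeFn, mem_nodeOut rfl]
  exact ⟨_, mem_prefixes_false.2 ⟨a, b, c, rfl⟩, _, table_join hκ _ rfl rfl l r rfl _ _
    (labelled_single hlen S), rfl⟩

theorem mem_nodeFn_recolor (i j : Fin ω) (t : CWDecomp ω) (S : t.Vertex → Bool) (a b : Bool) :
    [a :: rootState P κ width (.recolor i j t) S, b :: rootState P κ width t S] ∈
        nodeFn ((P, width), rootOp κ (.recolor i j t)) := by
  rw [nodeFn, mem_nodeOut rfl]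
  exact ⟨_, mem_prefixes_true.2 ⟨a, b, rfl⟩, _, table_unary hκ _ rfl rfl (.recolor i j t) t rfl rfl
    (fun _ => rfl) _ _ (labelled_single hlen S), rfl⟩

theorem mem_nodeFn_addEdges (i j : Fin ω) (t : CWDecomp ω) (S : t.Vertex → Bool) (a b : Bool) :
    [a :: rootState P κ width (.addEdges i j t) S, b :: rootState P κ width t S] ∈
        nodeFn ((P, width), rootOp κ (.addEdges i j t)) := by
  rw [nodeFn, mem_nodeOut rfl]
  exact ⟨_, mem_prefixes_true.2 ⟨a, b, rfl⟩, _, table_unary hκ _ rfl rfl (.addEdges i j t) t rfl rfl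
    (fun _ => rfl) _ _ (labelled_single hlen S), rfl⟩

include hw

-- Equal words of the children come from equal states by `toWord_inj`, and then determinism of the
-- table applies; only the leading bit stays free.
omit hκ hlen in
theorem nodeFn_unique {o : Op} (ho : (o.1.1 || o.1.2) = true) {x y : Bool} {u v : Word}
    {ws : List Word} (hx : (x :: u) :: ws ∈ nodeFn ((P, width), o))
    (hy : (y :: v) :: ws ∈ nodeFn ((P, width), o)) : u = v := by
  have hT := isTable_levelAt ((P, width), o) P.2.1
  rw [levelAt_univ] at hT
  rw [nodeFn, mem_nodeOut ho] at hx hy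
  obtain ⟨p, hp, s, hs, h1⟩ := hx
  obtain ⟨p', hp', s', hs', h2⟩ := hy
  simp only at hT hp hp'
  cases hu : o.1.1
  · rw [hu] at hT hp hp'
    obtain ⟨a0, a1, a2, rfl⟩ := mem_prefixes_false.1 hp
    obtain ⟨b0, b1, b2, rfl⟩ := mem_prefixes_false.1 hp'
    obtain ⟨x1, x2, x3, hx2, hx3, rfl⟩ := hT.binary hs
    obtain ⟨y1, y2, y3, hy2, hy3, rfl⟩ := hT.binary hs'
    simp only [List.zip_cons_cons, List.zip_nil_left, List.map_cons, List.map_nil,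
      List.cons.injEq] at h1 h2
    obtain ⟨⟨rfl, rfl⟩, rfl⟩ := h1
    obtain ⟨⟨rfl, rfl⟩, h2⟩ := h2
    simp only [List.cons.injEq, and_true] at h2
    have e2 := toWord_inj hw hx2 hy2 h2.1.2
    have e3 := toWord_inj hw hx3 hy3 h2.2.2
    subst e2 e3
    rw [hT.unique hs hs']
  · rw [hu] at hT hp hp'
    obtain ⟨a0, a1, rfl⟩ := mem_prefixes_true.1 hp
    obtain ⟨b0, b1, rfl⟩ := mem_prefixes_true.1 hp'
    obtain ⟨x1, x2, hx2, rfl⟩ := hT.unary hs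
    obtain ⟨y1, y2, hy2, rfl⟩ := hT.unary hs'
    simp only [List.zip_cons_cons, List.zip_nil_left, List.map_cons, List.map_nil,
      List.cons.injEq] at h1 h2
    obtain ⟨⟨rfl, rfl⟩, rfl⟩ := h1
    obtain ⟨⟨rfl, rfl⟩, h2⟩ := h2
    simp only [List.cons.injEq, and_true] at h2
    have e2 := toWord_inj hw hx2 hy2 h2.2
    subst e2
    rw [hT.unique hs hs']

omit hκ hlen hw in
theorem exists_cons_of_mem_nodeFn {o : Op} (ho : (o.1.1 || o.1.2) = true) {w : Word}
    {ws : List Word} (h : w :: ws ∈ nodeFn ((P, width), o)) : ∃ c u, w = c :: u := by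
  rw [nodeFn, mem_nodeOut ho] at h
  obtain ⟨p, hp, s, hs, h⟩ := h
  rcases p with _ | ⟨c, p⟩
  · simp at h
  · rcases s with _ | ⟨x, s⟩
    · simp at h
    · exact ⟨_, _, (List.cons.inj h).1⟩

/-- By induction the states of the children are the runs for the labelling read off from the leaves.
The table contains the row of this run and no other row for the same children. -/
theorem rootState_of_isLocal (D : CWDecomp ω) (α : D.Node → Word) (h : IsLocal P κ width D α) :
    ∃ c, α D.root = c :: rootState P κ width D (fun v => memBit (α (D.leaf v))) := by
  induction D with
  | intro a =>
    have h1 := h .introRoot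
    rw [CWDecomp.children, List.map_nil, opAt, mem_nodeFn_intro hκ hlen] at h1
    obtain ⟨b, hb⟩ := h1
    have hb' : α .introRoot = b :: rootState P κ width (.intro a) (fun _ => b) := by simpa using hb
    refine ⟨b, ?_⟩
    change α .introRoot = b :: rootState P κ width (.intro a) (fun _ => memBit (α .introRoot))
    rw [hb']
    rfl
  | join l r ihl ihr =>
    obtain ⟨h1, h2, h3⟩ := isLocal_join.1 h
    obtain ⟨c2, e2⟩ := ihl _ h2
    obtain ⟨c3, e3⟩ := ihr _ h3
    rw [e2, e3] at h1
    have h4 := mem_nodeFn_join hκ hlen l r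
      -- The bits of the children must be the given ones for the rows to be comparable; the bit of
      -- the root is irrelevant.
      (fun v => memBit (α ((CWDecomp.join l r).leaf v))) false c2 c3
    obtain ⟨c, u, hu⟩ := exists_cons_of_mem_nodeFn rfl h1
    rw [hu] at h1
    exact ⟨c, hu.trans (by rw [nodeFn_unique hw rfl h1 h4])⟩
  | recolor a b t ih =>
    obtain ⟨h1, h2⟩ := isLocal_recolor.1 h
    obtain ⟨c2, e2⟩ := ih _ h2
    rw [e2] at h1
    have h4 := mem_nodeFn_recolor hκ hlen a b t
      (fun v => memBit (α ((CWDecomp.recolor a b t).leaf v))) false c2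
    obtain ⟨c, u, hu⟩ := exists_cons_of_mem_nodeFn rfl h1
    rw [hu] at h1
    exact ⟨c, hu.trans (by rw [nodeFn_unique hw rfl h1 h4]; rfl)⟩
  | addEdges a b t ih =>
    obtain ⟨h1, h2⟩ := isLocal_addEdges.1 h
    obtain ⟨c2, e2⟩ := ih _ h2
    rw [e2] at h1
    have h4 := mem_nodeFn_addEdges hκ hlen a b t
      (fun v => memBit (α ((CWDecomp.addEdges a b t).leaf v))) false c2
    obtain ⟨c, u, hu⟩ := exists_cons_of_mem_nodeFn rfl h1
    rw [hu] at h1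
    exact ⟨c, hu.trans (by rw [nodeFn_unique hw rfl h1 h4]; rfl)⟩

-- The run itself is the assignment, with the bits of `S` at the leaves and `false` at inner nodes.
omit hw in
theorem exists_isLocal (D : CWDecomp ω) (S : D.Vertex → Bool) :
    ∃ α : D.Node → Word, IsLocal P κ width D α ∧ (∀ v, memBit (α (D.leaf v)) = S v) ∧
      ∃ c, α D.root = c :: rootState P κ width D S := by
  induction D with
  | intro a =>
    refine ⟨fun _ => S () :: rootState P κ width (.intro a) S, ?_, fun _ => rfl, _, rfl⟩
    rintro ⟨⟩
    rw [CWDecomp.children, List.map_nil, opAt, mem_nodeFn_intro hκ hlen]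
    exact ⟨S (), rfl⟩
  | join l r ihl ihr =>
    obtain ⟨α, h1, h2, c, h3⟩ := ihl (fun v => S (Sum.inl v))
    obtain ⟨β, h4, h5, d, h6⟩ := ihr (fun v => S (Sum.inr v))
    refine ⟨fun s => match s with
      | .joinRoot => false :: rootState P κ width (.join l r) S
      | .joinLeft s => α s
      | .joinRight s => β s, isLocal_join.2 ⟨?_, h1, h4⟩, ?_, false, rfl⟩
    · simp only [h3, h6]
      exact mem_nodeFn_join hκ hlen l r S _ _ _
    · rintro (v | v)
      · exact h2 v
      · exact h5 v
  | recolor a b t ih =>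
    obtain ⟨α, h1, h2, c, h3⟩ := ih S
    refine ⟨fun s => match s with
      | .recolorRoot => false :: rootState P κ width (.recolor a b t) S
      | .recolorSub s => α s, isLocal_recolor.2 ⟨?_, h1⟩, h2, false, rfl⟩
    simp only [h3]
    exact mem_nodeFn_recolor hκ hlen a b t S _ _
  | addEdges a b t ih =>
    obtain ⟨α, h1, h2, c, h3⟩ := ih S
    refine ⟨fun s => match s with
      | .addEdgesRoot => false :: rootState P κ width (.addEdges a b t) S
      | .addEdgesSub s => α s, isLocal_addEdges.2 ⟨?_, h1⟩, h2, false, rfl⟩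
    simp only [h3]
    exact mem_nodeFn_addEdges hκ hlen a b t S _ _

/-- Witnesses correspond to accepted vertex sets. -/
theorem exists_witness_iff (D : CWDecomp ω) (o : Op) (S : D.Vertex → Bool) :
    (∃ α : D.Node → Word, (IsLocal P κ width D α ∧ α D.root ∈ acceptFn ((P, width), o)) ∧
      ∀ v, memBit (α (D.leaf v)) = S v) ↔
      SatAt (fun lab => stripState (baseRun P.1 κ D lab) ∈ P.2.2) P.2.1 (fun v => [S v]) := by
  have hacc := acc_spec hκ ((P, width), o) rfl rfl D P.2.1 _ (labelled_single hlen S)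
  have hmem := runAt_mem hκ P.2.1 D _ (labelled_single hlen S)
  have hsub := (LevelBd.levelAt ((P, width), o) rfl le_rfl (List.suffix_refl _)).acc_sub
  rw [levelAt_univ] at hsub
  have key : ∀ c, c :: rootState P κ width D S ∈ acceptFn ((P, width), o) ↔
      SatAt (fun lab => stripState (baseRun P.1 κ D lab) ∈ P.2.2) P.2.1 (fun v => [S v]) := by
    intro c
    refine Iff.trans ?_ hacc
    rw [acceptFn, mem_acceptOut]
    constructor
    · rintro ⟨x, hx, h⟩
      rw [toWord_inj hw hmem (hsub.subset hx) h]
      exact hx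
    · exact fun h => ⟨_, h, rfl⟩
  constructor
  · rintro ⟨α, ⟨h1, h2⟩, h3⟩
    obtain ⟨c, hc⟩ := rootState_of_isLocal hκ hlen hw D α h1
    simp only [h3] at hc
    rw [hc] at h2
    exact (key c).1 h2
  · intro h
    obtain ⟨α, h1, h2, c, h3⟩ := exists_isLocal hκ hlen D S
    exact ⟨α, ⟨h1, h3 ▸ (key c).2 h⟩, h2⟩

end

/-! ### Prenex normal form -/

/-- Values of variables. -/
inductive Val (V : Type) : Type
  | vert (v : V) : Val V
  | set (A : Set V) : Val V

namespace Val

variable {V : Type}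

def isVert : Val V → Bool
  | vert _ => true
  | set _ => false

def asSet : Val V → Set V
  | vert v => {v}
  | set A => A

end Val

/-- A quantifier: over vertices or not, existential or not. -/
abbrev Quant : Type := Bool × Bool

/-- A quantifier-free formula, as a property of the membership and the adjacency relation of the
variables. -/
abbrev Matrx : Type := (ℕ → ℕ → Prop) → (ℕ → ℕ → Prop) → Prop

section

variable {V : Type}

/-- A vertex counts as a singleton on the right-hand side, so this relation also expresses equality
of vertices. -/
def memRel (env : List (Val V)) (i j : ℕ) : Prop :=
  ∃ v x, env[i]? = some (.vert v) ∧ env[j]? = some x ∧ v ∈ x.asSet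

def adjRel (G : SimpleGraph V) (env : List (Val V)) (i j : ℕ) : Prop :=
  ∃ v w, env[i]? = some (.vert v) ∧ env[j]? = some (.vert w) ∧ G.Adj v w

def Matrx.Holds (M : Matrx) (G : SimpleGraph V) (env : List (Val V)) : Prop :=
  M (memRel env) (adjRel G env)

def Matrx.reindex (M : Matrx) (f : ℕ → ℕ) : Matrx :=
  fun R A => M (fun i j => R (f i) (f j)) (fun i j => A (f i) (f j))

theorem Matrx.holds_reindex (M : Matrx) (f : ℕ → ℕ) (G : SimpleGraph V) {env env' : List (Val V)}
    (h : ∀ i, env'[f i]? = env[i]?) : (M.reindex f).Holds G env' ↔ M.Holds G env := by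
  simp only [Matrx.Holds, Matrx.reindex, memRel, adjRel, h]
  rfl

/-- Satisfaction of a quantified property. -/
def QSat : List Quant → (List (Val V) → Prop) → List (Val V) → Prop
  | [], K, env => K env
  | q :: Q, K, env => if q.2 = true then ∃ x : Val V, x.isVert = q.1 ∧ QSat Q K (x :: env)
      else ∀ x : Val V, x.isVert = q.1 → QSat Q K (x :: env)

theorem QSat.append (Q R : List Quant) (K : List (Val V) → Prop) (env : List (Val V)) :
    QSat (Q ++ R) K env ↔ QSat Q (QSat R K) env := by
  induction Q generalizing env with
  | nil => rfl
  | cons q Q ih => simp only [List.cons_append, QSat, ih]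

theorem QSat.not (Q : List Quant) (K : List (Val V) → Prop) (env : List (Val V)) :
    ¬ QSat Q K env ↔ QSat (Q.map (fun q => (q.1, !q.2))) (fun e => ¬ K e) env := by
  induction Q generalizing env with
  | nil => rfl
  | cons q Q ih =>
    simp only [List.map_cons, QSat, ← ih]
    cases q.2 <;> simp

theorem QSat.congr {Q : List Quant} {K K' : List (Val V) → Prop} {env env' : List (Val V)}
    (h : ∀ xs : List (Val V), xs.length = Q.length → (K (xs ++ env) ↔ K' (xs ++ env'))) :
    QSat Q K env ↔ QSat Q K' env' := by
  induction Q generalizing env env' with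
  | nil => exact h [] rfl
  | cons q Q ih =>
    have h' : ∀ x, QSat Q K (x :: env) ↔ QSat Q K' (x :: env') := fun x =>
      ih fun xs hxs => by
        have := h (xs ++ [x]) (by simp [hxs])
        simpa using this
    simp only [QSat, h']

/-- Extracting `Y` from under a universal vertex quantifier needs a vertex. Graphs of decompositions
always have one. -/
theorem QSat.and_const [Nonempty V] (Q : List Quant) (K : List (Val V) → Prop) (Y : Prop)
    (env : List (Val V)) : (QSat Q K env ∧ Y) ↔ QSat Q (fun e => K e ∧ Y) env := by
  have hne : ∀ k, ∃ x : Val V, x.isVert = k := by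
    rintro (_ | _)
    · exact ⟨.set ∅, rfl⟩
    · exact ⟨.vert (Classical.arbitrary V), rfl⟩
  induction Q generalizing env with
  | nil => rfl
  | cons q Q ih =>
    simp only [QSat, ← ih]
    obtain ⟨x, hx⟩ := hne q.1
    cases q.2
    · simp only [Bool.false_eq_true, if_false]
      exact ⟨fun h y hy => ⟨h.1 y hy, h.2⟩, fun h => ⟨fun y hy => (h y hy).1, (h x hx).2⟩⟩
    · simp only [if_true]
      constructor
      · rintro ⟨⟨y, hy, h1⟩, h2⟩; exact ⟨y, hy, h1, h2⟩
      · rintro ⟨y, hy, h1, h2⟩; exact ⟨⟨y, hy, h1⟩, h2⟩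

/-- The conjunction of two prenex formulas with `n` and `m` quantifiers. -/
def Matrx.conj (n m : ℕ) (M N : Matrx) : Matrx := fun R A =>
  -- The quantifiers of `N` are innermost and own the indices below `m`. For `M` everything moves up
  -- by `m`; for `N` only its outer variables move, past the `n` quantifiers of `M`.
  M.reindex (fun i => m + i) R A ∧ N.reindex (fun i => if i < m then i else n + i) R A

/-- Each formula is constant with respect to the variables of the other, so `QSat.and_const` is
applied twice. -/
theorem QSat.and [Nonempty V] (Q R : List Quant) (M N : Matrx) (G : SimpleGraph V)
    (env : List (Val V)) : (QSat Q (M.Holds G) env ∧ QSat R (N.Holds G) env) ↔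
      QSat (Q ++ R) ((Matrx.conj Q.length R.length M N).Holds G) env := by
  rw [QSat.append, QSat.and_const]
  refine QSat.congr fun xs hxs => ?_
  have h1 : QSat R (N.Holds G) env ↔
      QSat R ((N.reindex (fun i => if i < R.length then i else Q.length + i)).Holds G)
        (xs ++ env) := by
    refine QSat.congr fun ys hys => (Matrx.holds_reindex _ _ _ fun i => ?_).symm
    split_ifs with hi
    · rw [List.getElem?_append_left (by omega), List.getElem?_append_left (by omega)]
    · rw [List.getElem?_append_right (by omega), List.getElem?_append_right (by omega),
        List.getElem?_append_right (by omega)]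
      congr 1; omega
  rw [h1, and_comm, QSat.and_const]
  refine QSat.congr fun ys hys => ?_
  refine and_comm.trans
    (and_congr (Matrx.holds_reindex M (fun i => R.length + i) G fun i => ?_).symm Iff.rfl)
  rw [List.getElem?_append_right (by omega)]
  congr 1; omega

end

theorem count_map_not (Q : List Quant) (k : Bool) :
    ((Q.map (fun q => (q.1, !q.2))).map Prod.fst).count k = (Q.map Prod.fst).count k := by
  rw [List.map_map]; rfl

/-- Every formula has a prenex form with the same number of quantifiers of each kind. -/
theorem exists_prenex {n m : ℕ} (φ : MSO1 n m) (iv : Fin n → ℕ) (sv : Fin m → ℕ) :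
    ∃ (Q : List Quant) (M : Matrx), (Q.map Prod.fst).count true = φ.numV ∧
      (Q.map Prod.fst).count false = φ.numS ∧
      ∀ (V : Type) [Nonempty V] (G : SimpleGraph V) (s : Fin n → V) (T : Fin m → Set V)
        (env : List (Val V)), (∀ i, env[iv i]? = some (.vert (s i))) →
        (∀ i, env[sv i]? = some (.set (T i))) → (φ.Sat G s T ↔ QSat Q (M.Holds G) env) := by
  induction φ with
  | falsum => exact ⟨[], fun _ _ => False, rfl, rfl, fun V _ G s T env h1 h2 => Iff.rfl⟩
  | eq x y =>
    refine ⟨[], fun R _ => R (iv x) (iv y), rfl, rfl, fun V _ G s T env h1 h2 => ?_⟩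
    simp [MSO1.Sat, QSat, Matrx.Holds, memRel, h1, Val.asSet]
  | adj x y =>
    refine ⟨[], fun _ A => A (iv x) (iv y), rfl, rfl, fun V _ G s T env h1 h2 => ?_⟩
    simp [MSO1.Sat, QSat, Matrx.Holds, adjRel, h1]
  | mem x X =>
    refine ⟨[], fun R _ => R (iv x) (sv X), rfl, rfl, fun V _ G s T env h1 h2 => ?_⟩
    simp [MSO1.Sat, QSat, Matrx.Holds, memRel, h1, h2, Val.asSet]
  | not φ ih =>
    obtain ⟨Q, M, hv, hs, h⟩ := ih iv sv
    refine ⟨_, fun R A => ¬ M R A, (count_map_not Q true).trans hv,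
      (count_map_not Q false).trans hs, fun V _ G s T env h1 h2 => ?_⟩
    rw [MSO1.Sat, h V G s T env h1 h2, QSat.not]
    rfl
  | and φ ψ ih1 ih2 =>
    obtain ⟨Q, M, hv, hs, h⟩ := ih1 iv sv
    obtain ⟨Q', M', hv', hs', h'⟩ := ih2 iv sv
    refine ⟨Q ++ Q', M.conj Q.length Q'.length M', ?_, ?_, fun V _ G s T env h1 h2 => ?_⟩
    · rw [List.map_append, List.count_append, hv, hv', MSO1.numV]
    · rw [List.map_append, List.count_append, hs, hs', MSO1.numS]
    · rw [MSO1.Sat, h V G s T env h1 h2, h' V G s T env h1 h2, QSat.and]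
  | or φ ψ ih1 ih2 =>
    obtain ⟨Q, M, hv, hs, h⟩ := ih1 iv sv
    obtain ⟨Q', M', hv', hs', h'⟩ := ih2 iv sv
    -- Disjunction reduces to conjunction by De Morgan. Dualizing a prefix keeps the kinds of the
    -- variables, so no quantifier is duplicated or changes its sort.
    let N : Quant → Quant := fun q => (q.1, !q.2)
    refine ⟨(Q.map N ++ Q'.map N).map N, fun R A => ¬ Matrx.conj (Q.map N).length (Q'.map N).length
      (fun R A => ¬ M R A) (fun R A => ¬ M' R A) R A, ?_, ?_, fun V _ G s T env h1 h2 => ?_⟩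
    · rw [count_map_not, List.map_append, List.count_append, count_map_not, count_map_not, hv, hv',
        MSO1.numV]
    · rw [count_map_not, List.map_append, List.count_append, count_map_not, count_map_not, hs, hs',
        MSO1.numS]
    · rw [MSO1.Sat, h V G s T env h1 h2, h' V G s T env h1 h2, or_iff_not_and_not, QSat.not, QSat.not]
      refine (not_congr (QSat.and (Q.map N) (Q'.map N) (fun R A => ¬ M R A)
        (fun R A => ¬ M' R A) G env)).trans ?_
      rw [QSat.not]
      rfl
  | imp φ ψ ih1 ih2 =>
    obtain ⟨Q, M, hv, hs, h⟩ := ih1 iv sv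
    obtain ⟨Q', M', hv', hs', h'⟩ := ih2 iv sv
    let N : Quant → Quant := fun q => (q.1, !q.2)
    refine ⟨(Q ++ Q'.map N).map N, fun R A => ¬ Matrx.conj Q.length (Q'.map N).length
      M (fun R A => ¬ M' R A) R A, ?_, ?_, fun V _ G s T env h1 h2 => ?_⟩
    · rw [count_map_not, List.map_append, List.count_append, count_map_not, hv, hv', MSO1.numV]
    · rw [count_map_not, List.map_append, List.count_append, count_map_not, hs, hs', MSO1.numS]
    · rw [MSO1.Sat, h V G s T env h1 h2, h' V G s T env h1 h2, ← not_and_not_right, QSat.not]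
      refine (not_congr (QSat.and Q (Q'.map N) M (fun R A => ¬ M' R A) G env)).trans ?_
      rw [QSat.not]
      rfl
  | exV φ ih =>
    obtain ⟨Q, M, hv, hs, h⟩ := ih (Fin.cons 0 (fun i => iv i + 1)) (fun i => sv i + 1)
    refine ⟨(true, true) :: Q, M, by simp [hv, MSO1.numV], by simp [hs, MSO1.numS],
      fun V _ G s T env h1 h2 => ?_⟩
    have h' := fun v => h V G (Fin.cons v s) T (.vert v :: env)
      (fun i => by cases i using Fin.cases <;> simp [h1]) (fun i => by simp [h2])
    simp only [MSO1.Sat, QSat, if_true, h']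
    constructor
    · rintro ⟨v, hv⟩; exact ⟨.vert v, rfl, hv⟩
    · rintro ⟨v | A, hx, hv⟩
      · exact ⟨v, hv⟩
      · cases hx
  | allV φ ih =>
    obtain ⟨Q, M, hv, hs, h⟩ := ih (Fin.cons 0 (fun i => iv i + 1)) (fun i => sv i + 1)
    refine ⟨(true, false) :: Q, M, by simp [hv, MSO1.numV], by simp [hs, MSO1.numS],
      fun V _ G s T env h1 h2 => ?_⟩
    have h' := fun v => h V G (Fin.cons v s) T (.vert v :: env)
      (fun i => by cases i using Fin.cases <;> simp [h1]) (fun i => by simp [h2])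
    simp only [MSO1.Sat, QSat, Bool.false_eq_true, if_false, h']
    constructor
    · rintro hv (v | A) hx
      · exact hv v
      · cases hx
    · exact fun hv v => hv (.vert v) rfl
  | exS φ ih =>
    obtain ⟨Q, M, hv, hs, h⟩ := ih (fun i => iv i + 1) (Fin.cons 0 (fun i => sv i + 1))
    refine ⟨(false, true) :: Q, M, by simp [hv, MSO1.numV], by simp [hs, MSO1.numS],
      fun V _ G s T env h1 h2 => ?_⟩
    have h' := fun A => h V G s (Fin.cons A T) (.set A :: env)
      (fun i => by simp [h1]) (fun i => by cases i using Fin.cases <;> simp [h2])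
    simp only [MSO1.Sat, QSat, if_true, h']
    constructor
    · rintro ⟨v, hv⟩; exact ⟨.set v, rfl, hv⟩
    · rintro ⟨v | A, hx, hv⟩
      · cases hx
      · exact ⟨A, hv⟩
  | allS φ ih =>
    obtain ⟨Q, M, hv, hs, h⟩ := ih (fun i => iv i + 1) (Fin.cons 0 (fun i => sv i + 1))
    refine ⟨(false, false) :: Q, M, by simp [hv, MSO1.numV], by simp [hs, MSO1.numS],
      fun V _ G s T env h1 h2 => ?_⟩
    have h' := fun A => h V G s (Fin.cons A T) (.set A :: env)
      (fun i => by simp [h1]) (fun i => by cases i using Fin.cases <;> simp [h2])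
    simp only [MSO1.Sat, QSat, Bool.false_eq_true, if_false, h']
    constructor
    · rintro hv (v | A) hx
      · cases hx
      · exact hv A
    · exact fun hv v => hv (.set v) rfl

/-- Satisfaction is invariant under isomorphisms. -/
theorem MSO1.sat_iso {V W : Type} {G : SimpleGraph V} {H : SimpleGraph W} (i : G ≃g H) {n m : ℕ}
    (φ : MSO1 n m) (s : Fin n → V) (T : Fin m → Set V) :
    φ.Sat G s T ↔ φ.Sat H (fun k => i (s k)) (fun k => i '' T k) := by
  induction φ with
  | falsum => rfl
  | eq x y => simp [MSO1.Sat]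
  | adj x y => exact i.map_adj_iff.symm
  | mem x X => simp [MSO1.Sat]
  | not φ ih => simp only [MSO1.Sat, ih]
  | and φ ψ ih1 ih2 => simp only [MSO1.Sat, ih1, ih2]
  | or φ ψ ih1 ih2 => simp only [MSO1.Sat, ih1, ih2]
  | imp φ ψ ih1 ih2 => simp only [MSO1.Sat, ih1, ih2]
  | exV φ ih =>
    simp only [MSO1.Sat, ih]
    refine i.toEquiv.exists_congr fun v => iff_of_eq ?_
    congr 1
    funext k; cases k using Fin.cases <;> rfl
  | allV φ ih =>
    simp only [MSO1.Sat, ih]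
    refine i.toEquiv.forall_congr fun v => iff_of_eq ?_
    congr 1
    funext k; cases k using Fin.cases <;> rfl
  | exS φ ih =>
    simp only [MSO1.Sat, ih]
    refine (Equiv.Set.congr i.toEquiv).exists_congr fun v => iff_of_eq ?_
    congr 1
    funext k; cases k using Fin.cases <;> rfl
  | allS φ ih =>
    simp only [MSO1.Sat, ih]
    refine (Equiv.Set.congr i.toEquiv).forall_congr fun v => iff_of_eq ?_
    congr 1
    funext k; cases k using Fin.cases <;> rfl

/-! ### Correctness of the base automaton -/

/-- The set of a variable under a labelling. -/
def varSet {V : Type} (lab : V → List Bool) (i : ℕ) : Set V := {v | (lab v)[i]? = some true}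

section

variable {V W : Type} (kinds : List Bool)

/-- The adjacencies recorded for the vertex `v` are correct. -/
def AdjSpec (G : SimpleGraph V) (lab : V → List Bool) (v : V) (d : Word) : Prop :=
  d.length = kinds.length ∧ ∀ j : ℕ,
    -- Bits towards variables that are still empty must be `false`, so that a later disjoint union,
    -- which has no edges across, keeps the word correct. Nothing is required when `j` has several
    -- vertices or is `v` itself.
    (kinds[j]? ≠ some true → ¬ d[j]? = some true) ∧
    (varSet lab j = ∅ → ¬ d[j]? = some true) ∧
    ∀ w ≠ v, kinds[j]? = some true → varSet lab j = {w} → (d[j]? = some true ↔ G.Adj v w)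

/-- The record of a variable is correct. -/
def RecSpec (G : SimpleGraph V) (col : V → Word) (lab : V → List Bool) (i : ℕ) (r : VRec) : Prop :=
  (varSet lab i = ∅ ∧ r = none) ∨
  (∃ v d, varSet lab i = {v} ∧ AdjSpec kinds G lab v d ∧ r = some (some (col v, (lab v, d)))) ∨
  ((varSet lab i).Nontrivial ∧ r = some none)

variable {kinds} {G : SimpleGraph V} {H : SimpleGraph W}

/-- A variable whose only vertex lies in the other part is empty in this one, so its bit is `false`,
in accordance with the absence of edges across. -/
theorem AdjSpec.inl {lab : V ⊕ W → List Bool} {v : V}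
    {d : Word} (h : AdjSpec kinds G (fun v => lab (Sum.inl v)) v d) :
    AdjSpec kinds (G ⊕g H) lab (Sum.inl v) d := by
  refine ⟨h.1, fun j => ?_⟩
  obtain ⟨h1, h2, h3⟩ := h.2 j
  have hpre : varSet (fun v => lab (Sum.inl v)) j = Sum.inl ⁻¹' varSet lab j := rfl
  refine ⟨h1, fun he => h2 (by rw [hpre, he, Set.preimage_empty]), ?_⟩
  rintro (w | w) hw hk hj
  · have hw' : w ≠ v := fun e => hw (by rw [e])
    rw [h3 w hw' hk (by rw [hpre, hj]; ext x; exact Sum.inl_injective.eq_iff)]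
    exact Iff.rfl
  · refine iff_of_false (h2 (by rw [hpre, hj]; ext x; simp)) ?_
    intro h
    simp at h

theorem AdjSpec.inr {lab : V ⊕ W → List Bool} {v : W}
    {d : Word} (h : AdjSpec kinds H (fun v => lab (Sum.inr v)) v d) :
    AdjSpec kinds (G ⊕g H) lab (Sum.inr v) d := by
  refine ⟨h.1, fun j => ?_⟩
  obtain ⟨h1, h2, h3⟩ := h.2 j
  have hpre : varSet (fun v => lab (Sum.inr v)) j = Sum.inr ⁻¹' varSet lab j := rfl
  refine ⟨h1, fun he => h2 (by rw [hpre, he, Set.preimage_empty]), ?_⟩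
  rintro (w | w) hw hk hj
  · refine iff_of_false (h2 (by rw [hpre, hj]; ext x; simp)) ?_
    intro h
    simp at h
  · have hw' : w ≠ v := fun e => hw (by rw [e])
    rw [h3 w hw' hk (by rw [hpre, hj]; ext x; exact Sum.inr_injective.eq_iff)]
    exact Iff.rfl

theorem RecSpec.join {col : V ⊕ W → Word} {lab : V ⊕ W → List Bool} {i : ℕ}
    {x y : VRec} (hx : RecSpec kinds G (fun v => col (Sum.inl v)) (fun v => lab (Sum.inl v)) i x)
    (hy : RecSpec kinds H (fun v => col (Sum.inr v)) (fun v => lab (Sum.inr v)) i y) :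
    RecSpec kinds (G ⊕g H) col lab i (joinRec x y) := by
  have hl : varSet (fun v => lab (Sum.inr v)) i = ∅ →
      varSet lab i = Sum.inl '' varSet (fun v => lab (Sum.inl v)) i := by
    intro h
    ext (v | v)
    · simp [varSet]
    · simpa [varSet] using (Set.eq_empty_iff_forall_notMem.1 h v)
  have hr : varSet (fun v => lab (Sum.inl v)) i = ∅ →
      varSet lab i = Sum.inr '' varSet (fun v => lab (Sum.inr v)) i := by
    intro h
    ext (v | v)
    · simpa [varSet] using (Set.eq_empty_iff_forall_notMem.1 h v)
    · simp [varSet]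
  have hlr : (varSet (fun v => lab (Sum.inl v)) i).Nonempty →
      (varSet (fun v => lab (Sum.inr v)) i).Nonempty → (varSet lab i).Nontrivial := by
    rintro ⟨v, hv⟩ ⟨w, hw⟩
    exact ⟨Sum.inl v, hv, Sum.inr w, hw, Sum.inl_ne_inr⟩
  rcases hx with ⟨hX, rfl⟩ | ⟨v, d, hX, hd, rfl⟩ | ⟨hX, rfl⟩
  · rcases hy with ⟨hY, rfl⟩ | ⟨w, d', hY, hd', rfl⟩ | ⟨hY, rfl⟩
    · exact Or.inl ⟨by rw [hl hY, hX, Set.image_empty], rfl⟩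
    · exact Or.inr (Or.inl ⟨Sum.inr w, d', by rw [hr hX, hY, Set.image_singleton], hd'.inr, rfl⟩)
    · exact Or.inr (Or.inr ⟨by rw [hr hX]; exact hY.image Sum.inr_injective, rfl⟩)
  · rcases hy with ⟨hY, rfl⟩ | ⟨w, d', hY, hd', rfl⟩ | ⟨hY, rfl⟩
    · exact Or.inr (Or.inl ⟨Sum.inl v, d, by rw [hl hY, hX, Set.image_singleton], hd.inl, rfl⟩)
    · exact Or.inr (Or.inr ⟨hlr (hX ▸ Set.singleton_nonempty _) (hY ▸ Set.singleton_nonempty _),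
        rfl⟩)
    · exact Or.inr (Or.inr ⟨hlr (hX ▸ Set.singleton_nonempty _) hY.nonempty, rfl⟩)
  · rcases hy with ⟨hY, rfl⟩ | ⟨w, d', hY, hd', rfl⟩ | ⟨hY, rfl⟩
    · exact Or.inr (Or.inr ⟨by rw [hl hY]; exact hX.image Sum.inl_injective, rfl⟩)
    · exact Or.inr (Or.inr ⟨hlr hX.nonempty (hY ▸ Set.singleton_nonempty _), rfl⟩)
    · exact Or.inr (Or.inr ⟨hlr hX.nonempty hY.nonempty, rfl⟩)

/-- If the variable `j` is a single vertex `w`, its record carries the color of `w`, and `linkBit`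
decides whether `v` and `w` are joined by a new edge. For empty variables and for set variables the
record is `none` and no bit is set. -/
theorem AdjSpec.addEdges {r : V → V → Prop} {col : V → Word} {A B : Word}
    (hr : ∀ u v, r u v ↔ col u = A ∧ col v = B) {lab : V → List Bool} {s : BState}
    (hlen : s.length = kinds.length)
    (hset : ∀ (i : ℕ) (x : VRec), kinds[i]? ≠ some true → s[i]? = some x → x = none)
    (hvert : ∀ i : ℕ, kinds[i]? = some true → ∃ x, s[i]? = some x ∧ RecSpec kinds G col lab i x)
    {v : V} {d : Word} (hd : AdjSpec kinds G lab v d) :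
    AdjSpec kinds (G ⊔ SimpleGraph.fromRel r) lab v
      ((s.zip d).map (fun z => z.2 || linkBit (A, B) (col v) z.1)) := by
  refine ⟨by have := hd.1; simp_all, fun j => ?_⟩
  have key : ((s.zip d).map (fun z => z.2 || linkBit (A, B) (col v) z.1))[j]? = some true ↔
      ∃ r c, s[j]? = some r ∧ d[j]? = some c ∧
        (c = true ∨ linkBit (A, B) (col v) r = true) := by
    simp only [List.getElem?_map, Option.map_eq_some_iff, List.getElem?_zip_eq_some,
      Prod.exists, Bool.or_eq_true, and_assoc]
  rw [key]
  obtain ⟨h1, h2, h3⟩ := hd.2 j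
  refine ⟨?_, ?_, ?_⟩
  · rintro hj ⟨r, c, hr, hc, rfl | h⟩
    · exact h1 hj hc
    · rw [hset j r hj hr] at h; cases h
  · rintro hj ⟨r, c, hr, hc, rfl | h⟩
    · exact h2 hj hc
    · by_cases hkj : kinds[j]? = some true
      · obtain ⟨r', hr', hs⟩ := hvert j hkj
        obtain rfl := Option.some.inj (hr.symm.trans hr')
        rcases hs with ⟨_, rfl⟩ | ⟨w, _, hw, _⟩ | ⟨hw, _⟩
        · cases h
        · exact absurd (hj.symm.trans hw) (Set.singleton_ne_empty w).symm
        · exact hw.nonempty.ne_empty hj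
      · rw [hset j r hkj hr] at h; cases h
  · intro w hw hkj hj
    obtain ⟨r', hr', hs⟩ := hvert j hkj
    have hjd : j < d.length := hd.1 ▸ (List.getElem?_eq_some_iff.1 hkj).1
    have hlink : ∃ d', r' = some (some (col w, (lab w, d'))) := by
      rcases hs with ⟨h, _⟩ | ⟨w', d', hw', _, rfl⟩ | ⟨h, _⟩
      · exact absurd (h.symm.trans hj) (Set.singleton_ne_empty w).symm
      · obtain rfl : w = w' := Set.singleton_injective (hj.symm.trans hw')
        exact ⟨d', rfl⟩
      · rw [hj] at h; exact absurd h (Set.not_nontrivial_singleton)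
    obtain ⟨d', rfl⟩ := hlink
    have h4 := h3 w hw hkj hj
    rw [List.getElem?_eq_getElem hjd, Option.some.injEq] at h4
    have h5 : linkBit (A, B) (col v) (some (some (col w, (lab w, d')))) = true ↔ r v w ∨ r w v := by
      simp only [linkBit, Option.elim, Bool.or_eq_true, Bool.and_eq_true, encEq_iff, hr]
      tauto
    rw [SimpleGraph.sup_adj, SimpleGraph.fromRel_adj, ← h4, ← h5]
    constructor
    · rintro ⟨r, c, e1, e2, h⟩
      obtain rfl := Option.some.inj (hr'.symm.trans e1)
      rw [List.getElem?_eq_getElem hjd] at e2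
      obtain rfl := Option.some.inj e2
      exact h.imp_right fun h => ⟨hw.symm, h⟩
    · intro h
      exact ⟨_, _, hr', List.getElem?_eq_getElem hjd, h.imp_right fun h => h.2⟩

end

section

variable {ω : ℕ} {kinds : List Bool} {κ : Fin ω → Word}

theorem length_baseRun (D : CWDecomp ω) (lab : D.Vertex → List Bool) (hlab : Labelled kinds [] lab) :
    (baseRun kinds κ D lab).length = kinds.length := by
  induction D with
  | intro a => have := hlab (); simp at this; simp [baseRun, introState, this]
  | join l r ihl ihr =>
    simp [baseRun, joinState, ihl _ hlab.inl, ihr _ hlab.inr]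
  | recolor a b t ih => simpa [baseRun, recolorState] using ih lab hlab
  | addEdges a b t ih => simpa [baseRun, addState] using ih lab hlab

theorem baseRun_set (D : CWDecomp ω) (lab : D.Vertex → List Bool) {i : ℕ}
    (hk : kinds[i]? ≠ some true) {r : VRec} (hr : (baseRun kinds κ D lab)[i]? = some r) :
    r = none := by
  induction D generalizing r with
  | intro a =>
    simp only [baseRun, introState, List.getElem?_map, Option.map_eq_some_iff,
      List.getElem?_zip_eq_some] at hr
    obtain ⟨⟨k, b⟩, ⟨h1, h2⟩, rfl⟩ := hr
    cases k
    · rfl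
    · exact absurd h1 hk
  | join l r' ihl ihr =>
    simp only [baseRun, joinState, List.getElem?_map, Option.map_eq_some_iff,
      List.getElem?_zip_eq_some] at hr
    obtain ⟨⟨x, y⟩, ⟨h1, h2⟩, rfl⟩ := hr
    simp only at h1 h2
    rw [ihl _ h1, ihr _ h2]
    rfl
  | recolor a b t ih =>
    simp only [baseRun, recolorState, List.getElem?_map, Option.map_eq_some_iff] at hr
    obtain ⟨x, h1, rfl⟩ := hr
    rw [ih _ h1]
    rfl
  | addEdges a b t ih =>
    simp only [baseRun, addState, List.getElem?_map, Option.map_eq_some_iff] at hr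
    obtain ⟨x, h1, rfl⟩ := hr
    rw [ih _ h1]
    rfl

/-- Injectivity of `κ` makes comparisons of color words equivalent to comparisons of colors. It is
demanded only in the presence of vertex variables, because otherwise all colors are erased. -/
theorem baseRun_vert (hκ : true ∈ kinds → Function.Injective κ) (D : CWDecomp ω)
    (lab : D.Vertex → List Bool) (hlab : Labelled kinds [] lab) {i : ℕ}
    (hk : kinds[i]? = some true) :
    ∃ r, (baseRun kinds κ D lab)[i]? = some r ∧ RecSpec kinds D.graph (fun v => κ (D.color v)) lab i r := by
  have hκ := hκ (List.mem_of_getElem? hk)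
  induction D generalizing i with
  | intro a =>
    have h0 := hlab ()
    simp only [List.length_nil, add_zero] at h0
    have hi : i < (lab ()).length := h0 ▸ (List.getElem?_eq_some_iff.1 hk).1
    have hb : (lab ())[i]? = some (lab ())[i] := List.getElem?_eq_getElem hi
    refine ⟨_, by
      simp only [baseRun, introState, List.getElem?_map, Option.map_eq_some_iff,
        List.getElem?_zip_eq_some]
      exact ⟨(true, (lab ())[i]), ⟨hk, hb⟩, rfl⟩, ?_⟩
    cases hc : (lab ())[i]
    · rw [hc] at hb
      refine Or.inl ⟨Set.eq_empty_of_forall_notMem ?_, rfl⟩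
      rintro ⟨⟩ hv
      exact absurd (Eq.trans (Eq.symm hv) hb) (by simp)
    · rw [hc] at hb
      refine Or.inr (Or.inl ⟨(), kinds.map (fun _ => false), ?_, ⟨by simp, fun j => ?_⟩, rfl⟩)
      · ext ⟨⟩
        exact iff_of_true hb rfl
      · have : ¬ (kinds.map (fun _ => false))[j]? = some true := by
          rw [List.getElem?_map]
          cases kinds[j]? <;> simp
        exact ⟨fun _ => this, fun _ => this, fun w hw => absurd rfl hw⟩
  | join l r ihl ihr =>
    obtain ⟨x, hx, hx'⟩ := ihl _ hlab.inl hk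
    obtain ⟨y, hy, hy'⟩ := ihr _ hlab.inr hk
    refine ⟨joinRec x y, ?_, hx'.join hy'⟩
    simp only [baseRun, joinState, List.getElem?_map, Option.map_eq_some_iff,
      List.getElem?_zip_eq_some]
    exact ⟨(x, y), ⟨hx, hy⟩, rfl⟩
  | recolor a b t ih =>
    obtain ⟨x, hx, hx'⟩ := ih _ hlab hk
    refine ⟨_, by
      simp only [baseRun, recolorState, List.getElem?_map, Option.map_eq_some_iff]
      exact ⟨x, hx, rfl⟩, ?_⟩
    rcases hx' with ⟨hX, rfl⟩ | ⟨v, d, hX, hd, rfl⟩ | ⟨hX, rfl⟩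
    · exact Or.inl ⟨hX, rfl⟩
    · refine Or.inr (Or.inl ⟨v, d, hX, hd, ?_⟩)
      simp only [mapInfo, recolorInfo, Option.elim, CWDecomp.color]
      congr 3
      by_cases h : t.color v = a
      · rw [if_pos h, h, encEq_iff.2 rfl, cond_true]
      · have he : encEq (κ (t.color v)) (κ a) = false :=
          Bool.eq_false_iff.2 fun e => h (hκ (encEq_iff.1 e))
        rw [if_neg h, he, cond_false]
    · exact Or.inr (Or.inr ⟨hX, rfl⟩)
  | addEdges a b t ih =>
    obtain ⟨x, hx, hx'⟩ := ih _ hlab hk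
    refine ⟨_, by
      simp only [baseRun, addState, List.getElem?_map, Option.map_eq_some_iff]
      exact ⟨x, hx, rfl⟩, ?_⟩
    rcases hx' with ⟨hX, rfl⟩ | ⟨v, d, hX, hd, rfl⟩ | ⟨hX, rfl⟩
    · exact Or.inl ⟨hX, rfl⟩
    · refine Or.inr (Or.inl ⟨v, _, hX, AdjSpec.addEdges (A := κ a) (B := κ b) (fun u w => ?_)
        (length_baseRun t lab hlab) (fun j x hj hx => baseRun_set t lab hj hx)
        (fun j hj => ih lab hlab hj) hd, rfl⟩)
      rw [hκ.eq_iff, hκ.eq_iff]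
    · exact Or.inr (Or.inr ⟨hX, rfl⟩)

/-! ### The relations of a state -/

def stateMem (s : BState) (i j : ℕ) : Prop :=
  ∃ c : Info, s[i]? = some (some (some c)) ∧ c.2.1[j]? = some true

/-- If the label shows that the vertex of `i` lies in `j`, then for single vertices both variables
denote the same vertex, and the bit, possibly set by edges within one color, is void. -/
def stateAdj (s : BState) (i j : ℕ) : Prop :=
  ∃ c : Info, s[i]? = some (some (some c)) ∧ c.2.2[j]? = some true ∧ ¬ c.2.1[j]? = some true

theorem getElem?_stripState {s : BState} {i : ℕ} {P : Word × Word → Prop} :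
    (∃ c : Info, (stripState s)[i]? = some (some (some c)) ∧ P c.2) ↔
      ∃ c : Info, s[i]? = some (some (some c)) ∧ P c.2 := by
  simp only [stripState, List.getElem?_map, Option.map_eq_some_iff]
  constructor
  · rintro ⟨c, ⟨r, hr, hc⟩, h⟩
    rcases r with _ | _ | r
    · simp [mapInfo] at hc
    · simp [mapInfo] at hc
    · simp only [mapInfo, Option.elim, Option.some.injEq] at hc
      rw [← hc] at h; exact ⟨r, hr, h⟩
  · rintro ⟨c, hc, h⟩
    exact ⟨([], c.2), ⟨_, hc, rfl⟩, h⟩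

theorem stateMem_strip (s : BState) : stateMem (stripState s) = stateMem s := by
  funext i j
  exact propext (getElem?_stripState (P := fun c => c.1[j]? = some true))

theorem stateAdj_strip (s : BState) : stateAdj (stripState s) = stateAdj s := by
  funext i j
  exact propext (getElem?_stripState (P := fun c => c.2[j]? = some true ∧ ¬ c.1[j]? = some true))

open Classical in
/-- The labelling that corresponds to an assignment. -/
noncomputable def labOf {V : Type} (env : List (Val V)) (v : V) : List Bool :=
  env.map (fun x => decide (v ∈ x.asSet))

theorem getElem?_labOf {V : Type} (env : List (Val V)) (v : V) (i : ℕ) :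
    (labOf env v)[i]? = some true ↔ ∃ x, env[i]? = some x ∧ v ∈ x.asSet := by
  simp [labOf]

theorem varSet_labOf {V : Type} {env : List (Val V)} {i : ℕ} {x : Val V} (h : env[i]? = some x) :
    varSet (labOf env) i = x.asSet := by
  ext v
  refine (getElem?_labOf env v i).trans ?_
  simp [h]

theorem labelled_labOf {V : Type} {env : List (Val V)} (h : env.map Val.isVert = kinds) :
    Labelled kinds [] (labOf env) := fun v => by simp [labOf, ← h]

theorem baseRun_labOf (hκ : true ∈ kinds → Function.Injective κ) (D : CWDecomp ω)
    {env : List (Val D.Vertex)} (h : env.map Val.isVert = kinds) {i : ℕ} {v : D.Vertex}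
    (hi : env[i]? = some (.vert v)) : ∃ d, AdjSpec kinds D.graph (labOf env) v d ∧
      (baseRun kinds κ D (labOf env))[i]? = some (some (some (κ (D.color v), (labOf env v, d)))) := by
  have hk : kinds[i]? = some true := by rw [← h, List.getElem?_map, hi]; rfl
  obtain ⟨r, hr, hs⟩ := baseRun_vert hκ D (labOf env) (labelled_labOf h) hk
  have hX : varSet (labOf env) i = {v} := varSet_labOf hi
  rcases hs with ⟨hs, _⟩ | ⟨w, d, hw, hd, rfl⟩ | ⟨hs, _⟩
  · exact absurd (hs.symm.trans hX) (Set.singleton_ne_empty v).symm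
  · obtain rfl : v = w := Set.singleton_injective (hX.symm.trans hw)
    exact ⟨d, hd, hr⟩
  · rw [hX] at hs; exact absurd hs Set.not_nontrivial_singleton

theorem isVert_of_baseRun (D : CWDecomp ω) {env : List (Val D.Vertex)}
    (h : env.map Val.isVert = kinds) (hκ : true ∈ kinds → Function.Injective κ) {i : ℕ} {c : Info}
    (hi : (baseRun kinds κ D (labOf env))[i]? = some (some (some c))) :
    ∃ v d, env[i]? = some (.vert v) ∧ AdjSpec kinds D.graph (labOf env) v d ∧
      c = (κ (D.color v), (labOf env v, d)) := by
  by_cases hk : kinds[i]? = some true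
  · have hk' := hk
    rw [← h, List.getElem?_map, Option.map_eq_some_iff] at hk'
    obtain ⟨v | A, hx, hv⟩ := hk'
    · obtain ⟨d, hd, hr⟩ := baseRun_labOf (κ := κ) hκ D h hx
      rw [hi] at hr
      simp only [Option.some.injEq] at hr
      exact ⟨v, d, hx, hd, hr⟩
    · cases hv
  · cases baseRun_set D (labOf env) hk hi

theorem stateMem_baseRun (hκ : true ∈ kinds → Function.Injective κ) (D : CWDecomp ω)
    {env : List (Val D.Vertex)} (h : env.map Val.isVert = kinds) :
    stateMem (baseRun kinds κ D (labOf env)) = memRel env := by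
  funext i j
  refine propext ⟨?_, ?_⟩
  · rintro ⟨c, hc, hj⟩
    obtain ⟨v, d, hv, hd, rfl⟩ := isVert_of_baseRun D h hκ hc
    obtain ⟨x, hx, hv'⟩ := (getElem?_labOf env v j).1 hj
    exact ⟨v, x, hv, hx, hv'⟩
  · rintro ⟨v, x, hv, hx, hv'⟩
    obtain ⟨d, hd, hr⟩ := baseRun_labOf (κ := κ) hκ D h hv
    exact ⟨_, hr, (getElem?_labOf env v j).2 ⟨x, hx, hv'⟩⟩

theorem stateAdj_baseRun (hκ : true ∈ kinds → Function.Injective κ) (D : CWDecomp ω)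
    {env : List (Val D.Vertex)} (h : env.map Val.isVert = kinds) :
    stateAdj (baseRun kinds κ D (labOf env)) = adjRel D.graph env := by
  funext i j
  refine propext ⟨?_, ?_⟩
  · rintro ⟨c, hc, hj, hj'⟩
    obtain ⟨v, d, hv, hd, rfl⟩ := isVert_of_baseRun D h hκ hc
    have hk : kinds[j]? = some true := by
      by_contra hk
      exact (hd.2 j).1 hk hj
    have hk' := hk
    rw [← h, List.getElem?_map, Option.map_eq_some_iff] at hk'
    obtain ⟨w | A, hx, hw⟩ := hk'
    · have hne : w ≠ v := by
        rintro rfl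
        exact hj' ((getElem?_labOf env w j).2 ⟨_, hx, rfl⟩)
      exact ⟨v, w, hv, hx, ((hd.2 j).2.2 w hne hk (varSet_labOf hx)).1 hj⟩
    · cases hw
  · rintro ⟨v, w, hv, hw, hvw⟩
    obtain ⟨d, hd, hr⟩ := baseRun_labOf (κ := κ) hκ D h hv
    have hk : kinds[j]? = some true := by rw [← h, List.getElem?_map, hw]; rfl
    refine ⟨_, hr, ((hd.2 j).2.2 w hvw.ne' hk (varSet_labOf hw)).2 hvw, ?_⟩
    rw [getElem?_labOf, hw]
    rintro ⟨x, hx, hv'⟩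
    cases hx
    exact hvw.ne hv'

/-! ### Acceptance by the base automaton -/

def isOne (r : VRec) : Bool := r.elim false (fun x => x.isSome)

/-- The outermost vertex variable to which not exactly one vertex is assigned decides. -/
def verdict : List Quant → BState → Option Bool
  | [], _ => none
  | q :: Q, s => (verdict Q s.tail).orElse
      (fun _ => bif q.1 && !(s.headD none |> isOne) then some (!q.2) else none)

/-- Acceptance of a state for a prenex formula. -/
def Accepts (Q : List Quant) (M : Matrx) (s : BState) : Prop :=
  match verdict Q s with
  | some c => c = true
  | none => M (stateMem s) (stateAdj s)

theorem isOne_mapInfo (f : Info → Info) (r : VRec) : isOne (mapInfo f r) = isOne r := by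
  rcases r with _ | _ | r <;> rfl

theorem verdict_strip (Q : List Quant) (s : BState) : verdict Q (stripState s) = verdict Q s := by
  induction Q generalizing s with
  | nil => rfl
  | cons q Q ih =>
    have h1 : (stripState s).tail = stripState s.tail := by cases s <;> rfl
    have h2 : isOne ((stripState s).headD none) = isOne (s.headD none) := by
      cases s
      · rfl
      · exact isOne_mapInfo _ _
    simp only [verdict, h1, h2, ih]

theorem accepts_strip (Q : List Quant) (M : Matrx) (s : BState) :
    Accepts Q M (stripState s) ↔ Accepts Q M s := by
  rw [Accepts, Accepts, verdict_strip, stateMem_strip, stateAdj_strip]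

/-- Variables are listed innermost first, so the outer variables `R` form the end of the list and
take priority. -/
theorem verdict_append {Q R : List Quant} {s : BState} {c : Bool}
    (h : verdict R (s.drop Q.length) = some c) : verdict (Q ++ R) s = some c := by
  induction Q generalizing s with
  | nil => exact h
  | cons q Q ih =>
    have h' : verdict (Q ++ R) s.tail = some c := ih (by
      rw [List.drop_tail]; exact h)
    rw [List.cons_append, verdict, h']
    rfl

theorem verdict_eq_none {Q : List Quant} {s : BState}
    (h : ∀ (i : ℕ) (q : Quant), Q[i]? = some q → q.1 = true → ∃ c : Info, s[i]? = some (some (some c))) :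
    verdict Q s = none := by
  induction Q generalizing s with
  | nil => rfl
  | cons q Q ih =>
    have h1 : verdict Q s.tail = none := ih fun i q hq hq' => by
      obtain ⟨c, hc⟩ := h (i + 1) q (by simpa using hq) hq'
      exact ⟨c, by rw [List.getElem?_tail]; exact hc⟩
    rw [verdict, h1]
    cases hq : q.1
    · rfl
    · obtain ⟨c, hc⟩ := h 0 q rfl hq
      cases s with
      | nil => cases hc
      | cons r s =>
        simp only [List.getElem?_cons_zero, Option.some.injEq] at hc
        subst hc
        rfl

end

/-! ### Quantifiers -/

section

variable {V : Type}

theorem SatAt.congr {K K' : (V → List Bool) → Prop} {m : List Bool} {lab : V → List Bool}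
    (h : ∀ ys : V → List Bool, (∀ v, (ys v).length = m.length) →
      (K (fun v => ys v ++ lab v) ↔ K' (fun v => ys v ++ lab v))) :
    SatAt K m lab ↔ SatAt K' m lab := by
  induction m generalizing lab with
  | nil => exact h (fun _ => []) fun _ => rfl
  | cons f m ih =>
    have h' : ∀ b : V → Bool, SatAt K m (fun v => b v :: lab v) ↔
        SatAt K' m (fun v => b v :: lab v) := fun b => ih fun ys hys => by
      have := h (fun v => ys v ++ [b v]) (by simp [hys])
      simpa using this
    simp only [SatAt, h']

theorem SatAt.const {c : Prop} {m : List Bool} {lab : V → List Bool} :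
    SatAt (fun _ => c) m lab ↔ c := by
  induction m generalizing lab with
  | nil => rfl
  | cons f m ih =>
    simp only [SatAt, ih]
    cases f <;> simp

theorem varSet_append {ys lab : V → List Bool} {n : ℕ} (h : ∀ v, (ys v).length = n) (i : ℕ) :
    varSet (fun v => ys v ++ lab v) (n + i) = varSet lab i := by
  ext v
  change (ys v ++ lab v)[n + i]? = some true ↔ _
  rw [List.getElem?_append_right (by rw [h v]; omega), h v, Nat.add_sub_cancel_left]
  rfl

variable {kinds : List Bool} {G : SimpleGraph V} {col : V → Word} {lab : V → List Bool} {i : ℕ}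
  {r : VRec}

theorem RecSpec.exists_info (h : RecSpec kinds G col lab i r) {v : V} (hv : varSet lab i = {v}) :
    ∃ c : Info, r = some (some c) := by
  rcases h with ⟨h, _⟩ | ⟨w, d, hw, hd, rfl⟩ | ⟨h, _⟩
  · exact absurd (h.symm.trans hv) (Set.singleton_ne_empty v).symm
  · exact ⟨_, rfl⟩
  · rw [hv] at h; exact absurd h Set.not_nontrivial_singleton

theorem RecSpec.isOne_eq_false (h : RecSpec kinds G col lab i r) (hv : ∀ v, varSet lab i ≠ {v}) :
    isOne r = false := by
  rcases h with ⟨_, rfl⟩ | ⟨w, d, hw, hd, rfl⟩ | ⟨_, rfl⟩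
  · rfl
  · exact absurd hw (hv w)
  · rfl

end

section

variable {ω : ℕ} {κ : Fin ω → Word}

/-- If the outermost variables are assigned well, but the next one does not get exactly one vertex,
then the quantifier of this variable decides. -/
theorem verdict_baseRun {Q R : List Quant} {q : Quant} (hq : q.1 = true) (D : CWDecomp ω)
    {env : List (Val D.Vertex)} (henv : env.map Val.isVert = R.map Prod.fst)
    (hκ : true ∈ (Q ++ q :: R).map Prod.fst → Function.Injective κ) {b : D.Vertex → Bool}
    (hb : ∀ v, {v | b v = true} ≠ {v}) {ys : D.Vertex → List Bool}
    (hys : ∀ v, (ys v).length = Q.length) :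
    verdict (Q ++ q :: R) (baseRun ((Q ++ q :: R).map Prod.fst) κ D
      (fun v => ys v ++ b v :: labOf env v)) = some (!q.2) := by
  have hlab : Labelled ((Q ++ q :: R).map Prod.fst) []
      (fun v => ys v ++ b v :: labOf env v) := fun v => by
    have := congrArg List.length henv
    simp only [List.length_map] at this
    simp [hys, labOf, this]
  apply verdict_append
  have h1 : verdict R ((baseRun ((Q ++ q :: R).map Prod.fst) κ D
      (fun v => ys v ++ b v :: labOf env v)).drop Q.length).tail = none := by
    refine verdict_eq_none fun i r hr hr' => ?_
    obtain ⟨x, hx, hx'⟩ : ∃ x, env[i]? = some x ∧ x.isVert = true := by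
      have : (env.map Val.isVert)[i]? = some true := by simp [henv, hr, hr']
      simpa using this
    obtain ⟨w, rfl⟩ : ∃ w, x = .vert w := by
      cases x with
      | vert w => exact ⟨w, rfl⟩
      | set A => cases hx'
    obtain ⟨rec, h1, h2⟩ := baseRun_vert hκ D _ hlab (i := Q.length + (i + 1)) (by
      simp [List.getElem?_append_right, hr, hr'])
    have hv : varSet (fun v => ys v ++ b v :: labOf env v) (Q.length + (i + 1)) = {w} := by
      rw [varSet_append hys]
      exact varSet_labOf hx
    obtain ⟨c, rfl⟩ := h2.exists_info hv
    refine ⟨c, ?_⟩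
    rw [List.getElem?_tail, List.getElem?_drop]
    exact h1
  obtain ⟨rec, h2, h3⟩ := baseRun_vert hκ D _ hlab (i := Q.length + 0) (by simp [hq])
  have h4 := h3.isOne_eq_false (by
    rw [varSet_append hys]
    have : varSet (fun v => b v :: labOf env v) 0 = {v | b v = true} := by
      ext v; exact Option.some_inj
    rw [this]
    exact hb)
  rw [verdict, h1]
  have h5 : ((baseRun ((Q ++ q :: R).map Prod.fst) κ D
      (fun v => ys v ++ b v :: labOf env v)).drop Q.length).headD none = rec := by
    rw [List.headD_eq_head?_getD, List.head?_drop]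
    rw [add_zero] at h2
    rw [h2]
    rfl
  rw [h5, h4, hq]
  rfl

theorem labOf_cons {V : Type} (x : Val V) (env : List (Val V)) (b : V → Bool)
    (h : {v | b v = true} = x.asSet) :
    labOf (x :: env) = fun v => b v :: labOf env v := by
  funext v
  rw [labOf, List.map_cons, ← h]
  simp [labOf]

-- Bit vectors range over all vertex sets, whereas a vertex variable admits only singletons. For any
-- other set the verdict is constant, whatever the inner variables are: false under ∃ and true under
-- ∀. The superfluous values therefore do not affect the quantifier.
open Classical in
theorem qsat_iff_satAt (M : Matrx) (D : CWDecomp ω) (Q R : List Quant)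
    (hκ : true ∈ (Q.reverse ++ R).map Prod.fst → Function.Injective κ)
    {env : List (Val D.Vertex)} (henv : env.map Val.isVert = R.map Prod.fst) :
    QSat Q (M.Holds D.graph) env ↔
      SatAt (fun lab => Accepts (Q.reverse ++ R) M
        (baseRun ((Q.reverse ++ R).map Prod.fst) κ D lab)) (Q.map Prod.snd) (labOf env) := by
  induction Q generalizing R env with
  | nil =>
    change true ∈ R.map Prod.fst → _ at hκ
    change _ ↔ Accepts R M (baseRun (R.map Prod.fst) κ D (labOf env))
    have hv : verdict R (baseRun (R.map Prod.fst) κ D (labOf env)) = none := by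
      refine verdict_eq_none fun i r hr hr' => ?_
      obtain ⟨x, hx, hx'⟩ : ∃ x, env[i]? = some x ∧ x.isVert = true := by
        have : (env.map Val.isVert)[i]? = some true := by simp [henv, hr, hr']
        simpa using this
      cases x with
      | vert w =>
        obtain ⟨d, _, h⟩ := baseRun_labOf (κ := κ) hκ D henv hx
        exact ⟨_, h⟩
      | set A => cases hx'
    rw [Accepts, hv, stateMem_baseRun hκ D henv, stateAdj_baseRun hκ D henv]
    rfl
  | cons q Q ih =>
    have e : (q :: Q).reverse ++ R = Q.reverse ++ q :: R := by simp
    rw [e] at hκ ⊢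
    set K := fun lab => Accepts (Q.reverse ++ q :: R) M
        (baseRun ((Q.reverse ++ q :: R).map Prod.fst) κ D lab) with hK
    have ih' : ∀ x : Val D.Vertex, x.isVert = q.1 → (QSat Q (M.Holds D.graph) (x :: env) ↔
        SatAt K (Q.map Prod.snd) (labOf (x :: env))) := fun x hx =>
      ih (q :: R) hκ (by simp [henv, hx])
    have hbad : ∀ b : D.Vertex → Bool, q.1 = true → (∀ v, {v | b v = true} ≠ {v}) →
        -- The outer variables in `env` are admissible by hypothesis, so `q` is the outermost
        -- offender and nothing quantified later can overrule it.
        (SatAt K (Q.map Prod.snd) (fun v => b v :: labOf env v) ↔ q.2 = false) := by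
      intro b hq hb
      rw [← SatAt.const (c := q.2 = false) (m := Q.map Prod.snd)
        (lab := fun v => b v :: labOf env v)]
      refine SatAt.congr fun ys hys => ?_
      have := verdict_baseRun hq D henv hκ hb (ys := ys) (by simpa using hys)
      rw [hK]
      simp only [Accepts, this, Bool.not_eq_true']
    have hgood : ∀ x : Val D.Vertex, labOf (x :: env) =
        fun v => decide (v ∈ x.asSet) :: labOf env v := fun x =>
      labOf_cons x env _ (by ext v; exact decide_eq_true_iff)
    have hval : ∀ b : D.Vertex → Bool, (∃ x : Val D.Vertex, x.isVert = q.1 ∧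
        labOf (x :: env) = fun v => b v :: labOf env v) ∨
        (q.1 = true ∧ ∀ v, {v | b v = true} ≠ {v}) := by
      intro b
      cases hq : q.1
      · exact Or.inl ⟨.set {v | b v = true}, rfl, labOf_cons _ _ _ rfl⟩
      · by_cases hv : ∃ v, {v | b v = true} = {v}
        · obtain ⟨v, hv⟩ := hv
          exact Or.inl ⟨.vert v, rfl, labOf_cons _ _ _ hv⟩
        · exact Or.inr ⟨rfl, fun v h => hv ⟨v, h⟩⟩
    rw [QSat, List.map_cons, SatAt]
    cases hq2 : q.2
    · simp only [Bool.false_eq_true, if_false]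
      constructor
      · intro h b
        rcases hval b with ⟨x, hx, hl⟩ | ⟨h1, h2⟩
        · rw [← hl]; exact (ih' x hx).1 (h x hx)
        · exact (hbad b h1 h2).2 hq2
      · intro h x hx
        rw [ih' x hx, hgood]
        exact h _
    · simp only [if_true]
      constructor
      · rintro ⟨x, hx, h⟩
        rw [ih' x hx, hgood] at h
        exact ⟨_, h⟩
      · rintro ⟨b, h⟩
        rcases hval b with ⟨x, hx, hl⟩ | ⟨h1, h2⟩
        · rw [← hl] at h; exact ⟨x, hx, (ih' x hx).2 h⟩
        · rw [hbad b h1 h2, hq2] at h; cases h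

/-- Stripped states belong to the list for the empty width, from which `paramsOf` selects the
accepting ones. -/
theorem stripState_mem {kinds : List Bool} {width : Word} {s : BState}
    (h : s ∈ baseStates kinds width) : stripState s ∈ baseStates kinds [] := by
  rw [baseStates, mem_allStates] at h ⊢
  rw [stripState, List.forall₂_map_right_iff]
  refine h.imp fun k r hr => ?_
  cases k
  · simp only [Bool.false_eq_true, if_false] at hr ⊢
    rw [hr]; rfl
  · simp only [if_true] at hr ⊢
    have hr := (wfRec_iff kinds width r).1 hr
    refine (wfRec_iff kinds [] _).2 ?_
    intro c w d hc
    rcases r with _ | _ | ⟨c', w', d'⟩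
    · simp [mapInfo] at hc
    · simp [mapInfo] at hc
    · simp only [mapInfo, Option.elim, Option.some.injEq, Prod.mk.injEq] at hc
      obtain ⟨rfl, rfl, rfl⟩ := hc
      exact ⟨le_rfl, (hr _ _ _ rfl).2⟩

/-- The parameters of the algorithm for a prenex formula. -/
noncomputable def paramsOf (Q : List Quant) (M : Matrx) : Params :=
  -- The last kind is that of the free set variable, which is outermost. The matrix is an arbitrary
  -- property, but only its finite list of accepting stripped states enters the program, as a
  -- constant.
  ((Q.map Prod.fst).reverse ++ [false], (Q.map Prod.snd,
    open Classical in (baseStates ((Q.map Prod.fst).reverse ++ [false]) []).filter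
      (fun s => decide (Accepts (Q.reverse ++ [(false, true)]) M s))))

open Classical in
theorem satAt_paramsOf (Q : List Quant) (M : Matrx) {width : Word}
    (hκ : true ∈ (paramsOf Q M).1 → ∀ a, (κ a).length ≤ width.length)
    (hinj : true ∈ (paramsOf Q M).1 → Function.Injective κ) (D : CWDecomp ω)
    (S : D.Vertex → Bool) :
    SatAt (fun lab => stripState (baseRun (paramsOf Q M).1 κ D lab) ∈ (paramsOf Q M).2.2)
      (paramsOf Q M).2.1 (fun v => [S v]) ↔
    QSat Q (M.Holds D.graph) [.set {v | S v = true}] := by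
  have hfst : (Q.reverse ++ [((false, true) : Quant)]).map Prod.fst = (paramsOf Q M).1 := by
    simp [paramsOf]
  rw [qsat_iff_satAt (κ := κ) M D Q [(false, true)] (by rw [hfst]; exact hinj) (by rfl), hfst]
  have hl : labOf [Val.set {v | S v = true}] = fun v => [S v] := labOf_cons _ _ _ rfl
  rw [hl]
  refine SatAt.congr fun ys hys => ?_
  have hlab : Labelled (paramsOf Q M).1 [] (fun v => ys v ++ [S v]) := fun v => by
    simp [hys, paramsOf]
  have hmem := stripState_mem (baseRun_mem hκ D _ hlab)
  have h2 : (paramsOf Q M).2.2 = (baseStates (paramsOf Q M).1 []).filter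
      (fun s => decide (Accepts (Q.reverse ++ [(false, true)]) M s)) := rfl
  rw [h2, List.mem_filter, decide_eq_true_iff, accepts_strip]
  exact and_iff_right hmem

end

/-! ### The program of a core -/

section

variable {ω : ℕ}

theorem card_join (l r : CWDecomp ω) : Fintype.card (CWDecomp.join l r).Node =
    Fintype.card l.Node + Fintype.card r.Node + 1 :=
  (Fintype.ofEquiv_card _).trans (by simp)

theorem card_recolor (a b : Fin ω) (t : CWDecomp ω) :
    Fintype.card (CWDecomp.recolor a b t).Node = Fintype.card t.Node + 1 :=
  (Fintype.ofEquiv_card _).trans (by simp)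

theorem card_addEdges (a b : Fin ω) (t : CWDecomp ω) :
    Fintype.card (CWDecomp.addEdges a b t).Node = Fintype.card t.Node + 1 :=
  (Fintype.ofEquiv_card _).trans (by simp)

theorem card_pos (D : CWDecomp ω) : 1 ≤ Fintype.card D.Node := Fintype.card_pos_iff.2 ⟨D.root⟩

/-- Colors as words. -/
def bitsColor (a : Fin ω) : Word := (a : ℕ).bits

/-- Process all nodes: the variable `0` holds the width and a tree, function `i` processes a
node. -/
def walkExpr (i : ℕ) : Expr :=
  -- The cases expose in turn the width, the tag with the body, and the two bits of the tag.
  -- Function `i` expects two colors, and missing ones are filled in by `nil`.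
  .case (.var 0) .nil (.case (.var 1) .nil (.case (.var 0) .nil (.case (.var 0)
    (.case (.var 1)
      (.call i (.cons (.var 4) (.cons (.var 2) (.cons (.var 3) .nil))))
      (.case (.var 5) .nil (.cons (.call i (.cons (.var 8) (.cons (.var 6) (.cons .nil .nil))))
        (.cons (.call 1 (.cons (.var 8) (.var 0))) (.call 1 (.cons (.var 8) (.var 1)))))))
    (.case (.var 5) .nil (.cons (.call i (.cons (.var 8) (.cons (.var 6) (.var 0))))
      (.call 1 (.cons (.var 8) (.var 1))))))))

theorem eval_walk {P : Program} {i : ℕ} {ev : Word × Op → List (List Word)} {B : Word × Op → ℕ}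
    (hi : Impl P i ev B) (hP : P[1]? = some (walkExpr i)) (w : Word) {N : ℕ} (D : CWDecomp ω)
    (hN : ∀ t : D.Node, B (w, opAt bitsColor t) ≤ N) :
    EvalLe P [.cons (enc w) D.encode] (walkExpr i)
      (D.encodeTable (fun t => enc (ev (w, opAt bitsColor t)))) (Fintype.card D.Node * (N + 50)) := by
  induction D with
  | intro a =>
    have h0 := hN .introRoot
    have hx : enc (w, (((false, false), (bitsColor a, [])) : Op)) =
        .cons (enc w) (.cons (.cons .nil .nil) (.cons (.ofNat a) .nil)) := rfl
    refine (EvalLe.caseCons (u := enc w) (w := CWDecomp.encode (.intro a)) (.var rfl)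
      (.caseCons (.var rfl) (.caseCons (.var rfl) (.caseNil (.var rfl) (.caseNil (.var rfl)
        (hi.call (x := (w, (((false, false), (bitsColor a, [])) : Op))) (by
          rw [hx]
          exact .cons (.var rfl) (.cons (.var rfl) (.cons (.var rfl) .nil))))))))).mono ?_
    have : Fintype.card (CWDecomp.intro a).Node = 1 := rfl
    rw [this]
    change B (w, ((false, false), (bitsColor a, []))) ≤ N at h0
    omega
  | join l r ihl ihr =>
    have h0 := hN .joinRoot
    have hl := ihl fun t => hN (.joinLeft t)
    have hr := ihr fun t => hN (.joinRight t)
    have hx : enc (w, (((false, true), ([], [])) : Op)) =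
        .cons (enc w) (.cons (.cons .nil (.cons .nil .nil)) (.cons .nil .nil)) := rfl
    refine (EvalLe.caseCons (u := enc w) (w := CWDecomp.encode (.join l r)) (.var rfl)
      (.caseCons (.var rfl) (.caseCons (.var rfl) (.caseNil (.var rfl) (.caseCons (.var rfl)
        (.caseCons (.var rfl) (.cons
          (hi.call (x := (w, (((false, true), ([], [])) : Op))) (by
            rw [hx]
            exact .cons (.var rfl) (.cons (.var rfl) (.cons .nil .nil))))
          (.cons (.call (.cons (.var rfl) (.var rfl)) hP hl)
            (.call (.cons (.var rfl) (.var rfl)) hP hr))))))))).mono ?_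
    change B (w, ((false, true), ([], []))) ≤ N at h0
    rw [card_join, add_mul, add_mul]
    omega
  | recolor a b t ih =>
    have h0 := hN .recolorRoot
    have ht := ih fun t => hN (.recolorSub t)
    have hx : enc (w, (((true, false), (bitsColor a, bitsColor b)) : Op)) =
        .cons (enc w) (.cons (.cons (.cons .nil .nil) .nil) (.cons (.ofNat a) (.ofNat b))) := rfl
    refine (EvalLe.caseCons (u := enc w) (w := CWDecomp.encode (.recolor a b t)) (.var rfl)
      (.caseCons (.var rfl) (.caseCons (.var rfl) (.caseCons (.var rfl)
        (.caseCons (.var rfl) (.cons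
          (hi.call (x := (w, (((true, false), (bitsColor a, bitsColor b)) : Op))) (by
            rw [hx]
            exact .cons (.var rfl) (.cons (.var rfl) (.var rfl))))
          (.call (.cons (.var rfl) (.var rfl)) hP ht))))))).mono ?_
    change B (w, ((true, false), (bitsColor a, bitsColor b))) ≤ N at h0
    rw [card_recolor, add_mul]
    omega
  | addEdges a b t ih =>
    have h0 := hN .addEdgesRoot
    have ht := ih fun t => hN (.addEdgesSub t)
    have hx : enc (w, (((true, true), (bitsColor a, bitsColor b)) : Op)) =
        .cons (enc w) (.cons (.cons (.cons .nil .nil) (.cons .nil .nil))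
          (.cons (.ofNat a) (.ofNat b))) := rfl
    refine (EvalLe.caseCons (u := enc w) (w := CWDecomp.encode (.addEdges a b t)) (.var rfl)
      (.caseCons (.var rfl) (.caseCons (.var rfl) (.caseCons (.var rfl)
        (.caseCons (.var rfl) (.cons
          (hi.call (x := (w, (((true, true), (bitsColor a, bitsColor b)) : Op))) (by
            rw [hx]
            exact .cons (.var rfl) (.cons (.var rfl) (.var rfl))))
          (.call (.cons (.var rfl) (.var rfl)) hP ht))))))).mono ?_
    change B (w, ((true, true), (bitsColor a, bitsColor b))) ≤ N at h0
    rw [card_addEdges, add_mul]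
    omega

end

/-- A program for the functions `ev` and `acc`, applied to the nodes of a decomposition. -/
theorem exists_program {ev : Word × Op → List (List Word)} {B : Word × Op → ℕ} (hev : Comp ev B)
    {acc : Word → List Word} {A : Word → ℕ} (hacc : Comp acc A) :
    ∃ P : Program, ∀ (ω : ℕ) (D : CWDecomp ω), EvalLe P [D.input] (.call 0 (.var 0))
      (.cons (enc (acc ω.bits)) (D.encodeTable (fun t => enc (ev (ω.bits, opAt bitsColor t)))))
      (Fintype.card D.Node *
        (Finset.univ.sup (fun t : D.Node => B (ω.bits, opAt bitsColor t)) + A ω.bits + 60)) := by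
  obtain ⟨i, j, H⟩ := link2 hev hacc 2
  -- Function `0` pairs the accepting words with the table, function `1` is the walk; the programs
  -- for `acc` and `ev` are linked behind them.
  obtain ⟨P, hP, hi, hj⟩ := H [.case (.var 0) .nil
    (.cons (.call j (.var 0)) (.call 1 (.var 2))), walkExpr i] rfl
  refine ⟨P, fun ω D => ?_⟩
  have hw := eval_walk hi (hP (m := 1) rfl) ω.bits D
    (fun t => Finset.le_sup (f := fun t : D.Node => B (ω.bits, opAt bitsColor t))
      (Finset.mem_univ t))
  refine (EvalLe.call (u := D.input) (.var rfl) (hP (m := 0) rfl)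
    (.caseCons (u := enc ω.bits) (w := D.encode) (.var rfl)
      (.cons (hj.call (.var rfl)) (.call (.var rfl) (hP (m := 1) rfl) hw)))).mono ?_
  have h := card_pos D
  generalize Finset.univ.sup (fun t : D.Node => B (ω.bits, opAt bitsColor t)) = N at *
  obtain ⟨n, hn⟩ : ∃ n, Fintype.card D.Node = n + 1 := ⟨_, (Nat.sub_add_cancel h).symm⟩
  rw [hn]
  have : (n + 1) * (N + A ω.bits + 60) = (n + 1) * (N + 50) + n * (A ω.bits + 10) +
    (A ω.bits + 10) := by ring
  rw [this]
  omega

/-- The core of a pair of computable functions. -/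
theorem exists_core {ev : Word × Op → List (List Word)} {B : Word × Op → ℕ} (hev : Comp ev B)
    {acc : Word → List Word} {A : Word → ℕ} (hacc : Comp acc A)
    (hlen : ∀ (ω : ℕ) (D : CWDecomp ω) (t : D.Node), ∀ e ∈ ev (ω.bits, opAt bitsColor t),
      e.length = (CWDecomp.children t).length + 1) :
    ∃ 𝔠 : DPCore, ∀ (ω : ℕ) (D : CWDecomp ω), 𝔠.accept D = acc ω.bits ∧
      (∀ t : D.Node, 𝔠.process D t = ev (ω.bits, opAt bitsColor t)) ∧
      𝔠.time D ≤ Fintype.card D.Node *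
        (Finset.univ.sup (fun t : D.Node => B (ω.bits, opAt bitsColor t)) + A ω.bits + 60) := by
  obtain ⟨P, hP⟩ := exists_program hev hacc
  choose k hk hk' using hP
  exact ⟨{  prog := P
            accept := fun {ω} _ => acc ω.bits
            process := fun {ω} _ t => ev (ω.bits, opAt bitsColor t)
            time := fun {ω} D => k ω D
            length_eq := fun {ω} D t => hlen ω D t
            computes := fun {ω} D => hk' ω D }, fun ω D => ⟨rfl, fun _ => rfl, hk ω D⟩⟩

section

variable {ω : ℕ}

theorem length_of_mem_nodeFn (P : Params) (κ : Fin ω → Word) (width : Word) {D : CWDecomp ω}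
    (t : D.Node) : ∀ e ∈ nodeFn ((P, width), opAt κ t), e.length = (CWDecomp.children t).length + 1 := by
  have hbin : ∀ (c : Word × Word), ∀ e ∈ nodeFn ((P, width), (((false, true), c) : Op)),
      e.length = 3 := by
    intro c e he
    obtain ⟨p, hp, s, hs, rfl⟩ := (mem_nodeOut rfl).1 he
    obtain ⟨a, b, d, rfl⟩ := mem_prefixes_false.1 hp
    obtain ⟨x, y, z, -, -, rfl⟩ := (isTable_levelAt ((P, width), (((false, true), c) : Op)) _).binary hs
    rfl
  have hun : ∀ (b : Bool) (c : Word × Word), ∀ e ∈ nodeFn ((P, width), (((true, b), c) : Op)),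
      e.length = 2 := by
    intro b c e he
    obtain ⟨p, hp, s, hs, rfl⟩ := (mem_nodeOut rfl).1 he
    obtain ⟨a, d, rfl⟩ := mem_prefixes_true.1 hp
    obtain ⟨x, y, -, rfl⟩ := (isTable_levelAt ((P, width), (((true, b), c) : Op)) _).unary hs
    rfl
  induction t with
  | introRoot =>
    intro e he
    obtain ⟨y, _, rfl⟩ := List.mem_map.1 he
    rfl
  | joinRoot => exact hbin _
  | recolorRoot => exact hun _ _
  | addEdgesRoot => exact hun _ _
  | joinLeft s ih | joinRight s ih | recolorSub s ih | addEdgesSub s ih =>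
    intro e he
    rw [CWDecomp.children, List.length_map]
    exact ih e he

/-- The colors, which are needed only if there are vertex variables. -/
def colorOf (b : Bool) (a : Fin ω) : Word := bif b then bitsColor a else []

theorem opAt_colorOf (b : Bool) {D : CWDecomp ω} (t : D.Node) : opAt (colorOf b) t =
    ((opAt bitsColor t).1, bif b then (opAt bitsColor t).2 else ([], [])) := by
  cases b
  · induction t with
    | introRoot | joinRoot | recolorRoot | addEdgesRoot => rfl
    | joinLeft s ih | joinRight s ih | recolorSub s ih | addEdgesSub s ih => exact ih
  · rfl

end

/-- The word that bounds the lengths of the colors. -/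
def widthOf (b : Bool) (ω : ℕ) : Word := bif b then ω.bits else []

/-- Forget the colors if `b = false`. -/
def nodeInput (P : Params) (b : Bool) (x : Word × Op) : NodeInput :=
  ((P, bif b then x.1 else []), (x.2.1, bif b then x.2.2 else ([], [])))

theorem nodeInput_opAt (P : Params) (b : Bool) {ω : ℕ} {D : CWDecomp ω} (t : D.Node) :
    nodeInput P b (ω.bits, opAt bitsColor t) = ((P, widthOf b ω), opAt (colorOf b) t) := by
  rw [nodeInput, opAt_colorOf]
  rfl

/-- The parameters are a constant of the program. Building them costs their size, which the size of
the resulting input already includes. -/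
theorem comp_nodeInput (P : Params) (b : Bool) :
    Comp (nodeInput P b) (fun x => sz (nodeInput P b x) + 40) := by
  cases b
  · refine Comp.mono (f := fun x : Word × Op =>
      (((P, []), (x.2.1, ([], []))) : NodeInput)) (((Comp.const ((P, []) : Params × Word)).pair
        ((Comp.fst.comp Comp.snd).pair (Comp.const (([], []) : Word × Word))))) fun x => ?_
    simp only [nodeInput, sz_pair, cond_false]
    omega
  · refine Comp.mono (f := fun x : Word × Op => (((P, x.1), x.2) : NodeInput))
      (((Comp.const P).pair Comp.fst).pair Comp.snd) fun x => ?_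
    simp only [nodeInput, sz_pair, cond_true]
    omega

/-- An arbitrary node type. -/
def defaultOp : Op := ((false, false), ([], []))

/-- Accepting states do not depend on the type of a node, so any type can be supplied. -/
theorem comp_acceptInput (P : Params) (b : Bool) :
    Comp (fun w : Word => nodeInput P b (w, defaultOp))
      (fun w => sz (nodeInput P b (w, defaultOp)) + 40 + 30) :=
  ((comp_nodeInput P b).comp (Comp.id.pair (Comp.const defaultOp))).mono fun w => by
    have : sz defaultOp = 7 := rfl
    simp only [this]
    omega

/-- `C` and `k` precede the parameters: they stem from the fixed programs for `nodeFn` and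
`acceptFn`, and a formula contributes only through the measure. This is the source of the universal
constant. -/
theorem exists_core_of_params : ∃ C k : ℕ, ∀ (P : Params) (b : Bool), ∃ 𝔠 : DPCore,
    ∀ (ω : ℕ) (D : CWDecomp ω),
      𝔠.accept D = acceptFn ((P, widthOf b ω), defaultOp) ∧
      (∀ t : D.Node, 𝔠.process D t = nodeFn ((P, widthOf b ω), opAt (colorOf b) t)) ∧
      ∀ N, (∀ t : D.Node, nodeMeasure ((P, widthOf b ω), opAt (colorOf b) t) ≤ N) →
        nodeMeasure ((P, widthOf b ω), defaultOp) ≤ N →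
        𝔠.time D ≤ Fintype.card D.Node * (C * (N + 1) ^ k) := by
  obtain ⟨-, B, ⟨C, k, hB⟩, hev⟩ := PTm.nodeFn
  obtain ⟨-, A, ⟨C', k', hA⟩, hacc⟩ := PTm.acceptFn
  refine ⟨C + C' + 200, k + k' + 1, fun P b => ?_⟩
  obtain ⟨𝔠, h𝔠⟩ := exists_core (hev.comp (comp_nodeInput P b)) (hacc.comp (comp_acceptInput P b))
    (fun ω D t => by
      simp only [nodeInput_opAt]
      exact length_of_mem_nodeFn P _ _ t)
  have hdef : ∀ ω : ℕ, nodeInput P b (ω.bits, defaultOp) = ((P, widthOf b ω), defaultOp) := by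
    intro ω; cases b <;> rfl
  refine ⟨𝔠, fun ω D => ?_⟩
  obtain ⟨h1, h2, h3⟩ := h𝔠 ω D
  refine ⟨by rw [h1, hdef], fun t => by rw [h2, nodeInput_opAt], fun N hN hN' => ?_⟩
  refine h3.trans (Nat.mul_le_mul_left _ ?_)
  have hsup : Finset.univ.sup (fun t : D.Node =>
      sz (nodeInput P b (ω.bits, opAt bitsColor t)) + 40 +
        B (nodeInput P b (ω.bits, opAt bitsColor t)) + 3) ≤ N + 40 + C * (N + 1) ^ k + 3 := by
    refine Finset.sup_le fun t _ => ?_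
    rw [nodeInput_opAt]
    have h4 := (sz_le_nodeMeasure _).trans (hN t)
    have h5 := (hB ((P, widthOf b ω), opAt (colorOf b) t)).trans (Nat.mul_le_mul_left C
      (Nat.pow_le_pow_left (Nat.add_le_add_right (hN t) 1) k))
    omega
  have h6 := (sz_le_nodeMeasure _).trans hN'
  have h7 := (hA ((P, widthOf b ω), defaultOp)).trans (Nat.mul_le_mul_left C'
      (Nat.pow_le_pow_left (Nat.add_le_add_right hN' 1) k'))
  refine (Nat.add_le_add_right (Nat.add_le_add hsup le_rfl) _).trans ?_
  simp only [hdef]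
  have e1 : (N + 1) ^ k ≤ (N + 1) ^ (k + k' + 1) := Nat.pow_le_pow_right (by omega) (by omega)
  have e2 : (N + 1) ^ k' ≤ (N + 1) ^ (k + k' + 1) := Nat.pow_le_pow_right (by omega) (by omega)
  have e3 : N + 1 ≤ (N + 1) ^ (k + k' + 1) := Nat.le_self_pow (by omega) _
  have e4 := Nat.mul_le_mul_left C e1
  have e5 := Nat.mul_le_mul_left C' e2
  rw [add_mul, add_mul]
  omega

/-! ### Towers -/

section Towers

theorem one_le_expTower (h : ℕ) {x : ℝ} (hx : 1 ≤ x) : 1 ≤ expTower h x := by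
  induction h with
  | zero => exact hx
  | succ h ih => exact Real.one_le_rpow (by norm_num) (by linarith)

theorem expTower_mono (h : ℕ) {x y : ℝ} (hxy : x ≤ y) : expTower h x ≤ expTower h y := by
  induction h with
  | zero => exact hxy
  | succ h ih => exact Real.rpow_le_rpow_of_exponent_le (by norm_num) ih

theorem expTower_two_rpow (h : ℕ) (x : ℝ) : expTower h ((2 : ℝ) ^ x) = expTower (h + 1) x := by
  induction h with
  | zero => rfl
  | succ h ih => exact congrArg (fun y => (2 : ℝ) ^ y) ih

theorem le_two_rpow (x : ℝ) (hx : 0 ≤ x) : x ≤ (2 : ℝ) ^ x := by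
  have h1 : (⌊x⌋₊ : ℝ) + 1 ≤ 2 ^ ⌊x⌋₊ := by exact_mod_cast Nat.lt_two_pow_self
  have h2 : (2 : ℝ) ^ (⌊x⌋₊ : ℝ) ≤ (2 : ℝ) ^ x :=
    Real.rpow_le_rpow_of_exponent_le (by norm_num) (Nat.floor_le hx)
  rw [Real.rpow_natCast] at h2
  linarith [Nat.lt_floor_add_one x]

theorem expTower_le_succ (h : ℕ) {x : ℝ} (hx : 1 ≤ x) : expTower h x ≤ expTower (h + 1) x :=
  le_two_rpow _ (by linarith [one_le_expTower h hx])

theorem le_expTower (h : ℕ) {x : ℝ} (hx : 1 ≤ x) : x ≤ expTower h x := by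
  induction h with
  | zero => exact le_rfl
  | succ h ih => exact ih.trans (expTower_le_succ h hx)

theorem two_rpow_le_expTower {h : ℕ} (hh : 1 ≤ h) {x : ℝ} (hx : 1 ≤ x) :
    (2 : ℝ) ^ x ≤ expTower h x := by
  obtain ⟨h, rfl⟩ : ∃ k, h = k + 1 := ⟨h - 1, by omega⟩
  exact Real.rpow_le_rpow_of_exponent_le (by norm_num) (le_expTower h hx)

theorem mul_le_pow_of_two_le {y : ℝ} (hy : 2 ≤ y) (a : ℕ) : (a + 1 : ℝ) * y ≤ y ^ (a + 1) := by
  induction a with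
  | zero => simp
  | succ a ih =>
    have h1 : y ≤ y ^ (a + 1) := le_self_pow₀ (by linarith) (by omega)
    have h2 : (0 : ℝ) ≤ y ^ (a + 1) := by positivity
    rw [pow_succ]
    push_cast at *
    nlinarith

/-- The two claims feed each other: exponentiating the first gives the second at the same `h`, and
the second gives the first at `h + 1` because a y ≤ y^a for y ≥ 2. -/
theorem mul_expTower_le (h : ℕ) {x : ℝ} (hx : 1 ≤ x) {a : ℕ} (ha : 1 ≤ a) :
    a * expTower h x ≤ expTower h (a * x) ∧
      expTower (h + 1) x ^ a ≤ expTower (h + 1) (a * x) := by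
  have key : ∀ h, a * expTower h x ≤ expTower h (a * x) →
      expTower (h + 1) x ^ a ≤ expTower (h + 1) (a * x) := by
    intro h hh
    rw [expTower, expTower, ← Real.rpow_mul_natCast (by norm_num), mul_comm]
    exact Real.rpow_le_rpow_of_exponent_le (by norm_num) hh
  induction h with
  | zero => exact ⟨le_rfl, key 0 le_rfl⟩
  | succ h ih =>
    have h1 : a * expTower (h + 1) x ≤ expTower (h + 1) (a * x) := by
      refine le_trans ?_ ih.2
      obtain ⟨b, rfl⟩ : ∃ b, a = b + 1 := ⟨a - 1, by omega⟩
      have h2 : (2 : ℝ) ≤ expTower (h + 1) x := by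
        have := Real.rpow_le_rpow_of_exponent_le (x := 2) (by norm_num) (one_le_expTower h hx)
        rwa [Real.rpow_one] at this
      have := mul_le_pow_of_two_le h2 b
      push_cast
      exact this
    exact ⟨h1, key _ h1⟩

theorem pow_expTower_le {h : ℕ} (hh : 1 ≤ h) {x : ℝ} (hx : 1 ≤ x) {a : ℕ} (ha : 1 ≤ a) :
    expTower h x ^ a ≤ expTower h (a * x) := by
  obtain ⟨h, rfl⟩ : ∃ k, h = k + 1 := ⟨h - 1, by omega⟩
  exact (mul_expTower_le h hx ha).2

/-- The number 2^q of labels must be absorbed by the height of the tower: without vertex variables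
its top does not grow with q. -/
theorem two_pow_le_expTower {h : ℕ} (hh : 1 ≤ h) {x : ℝ} (hx : 1 ≤ x) :
    (2 : ℝ) ^ h ≤ expTower h x := by
  induction h, hh using Nat.le_induction with
  | base =>
    have := Real.rpow_le_rpow_of_exponent_le (x := 2) (by norm_num) hx
    simpa [expTower] using this
  | succ h hh ih =>
    have h1 : ((h + 1 : ℕ) : ℝ) ≤ 2 ^ h := by exact_mod_cast Nat.lt_two_pow_self
    rw [expTower, ← Real.rpow_natCast]
    exact Real.rpow_le_rpow_of_exponent_le (by norm_num) (h1.trans ih)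

end Towers

/-! ### The number of states -/

theorem length_allRecs (colors ws : List Word) :
    (allRecs colors ws).length = 2 + colors.length * ws.length ^ 2 := by
  simp [allRecs, List.length_flatMap, sq]
  ring

theorem length_baseStates (kinds : List Bool) (width : Word) :
    (baseStates kinds width).length =
      (2 + (upWords width).length * (2 ^ kinds.length) ^ 2) ^ kinds.count true := by
  rw [baseStates, length_allStates, length_allRecs, length_allWords]

/-- With u colors and s pairs of words, the number of records satisfies 2 + u s ≤ 2 (u + 1) s, and u
+ 1 is a power of two. -/
theorem length_baseStates_le (kinds : List Bool) (width : Word) :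
    (baseStates kinds width).length ≤
      2 ^ (kinds.count true * (width.length + 2 + 2 * kinds.length)) := by
  rw [length_baseStates, mul_comm (kinds.count true), pow_mul]
  refine Nat.pow_le_pow_left ?_ _
  have h1 := length_upWords width
  have h2 : 1 ≤ (2 ^ kinds.length) ^ 2 := Nat.one_le_pow _ _ (by positivity)
  have h3 : 2 ^ (width.length + 2 + 2 * kinds.length) =
      2 * (2 ^ (width.length + 1) * (2 ^ kinds.length) ^ 2) := by ring
  rw [h3, ← h1]
  have h4 : 1 ≤ (upWords width).length := by
    have : 2 ≤ 2 ^ (width.length + 1) := Nat.le_self_pow (by omega) 2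
    omega
  nlinarith [Nat.mul_le_mul h4 h2]

theorem length_baseStates_nil_le (kinds : List Bool) (width : Word) :
    (baseStates kinds []).length ≤ (baseStates kinds width).length := by
  rw [length_baseStates, length_baseStates]
  have h1 := length_upWords width
  have h2 : (upWords ([] : Word)).length = 1 := rfl
  have : 2 ≤ 2 ^ (width.length + 1) := Nat.le_self_pow (by omega) 2
  rw [h2]
  refine Nat.pow_le_pow_left ?_ _
  gcongr
  omega

theorem length_levelAt_nil (e : NodeInput) :
    (levelAt e []).1.length = (baseStates e.kinds e.width).length := by
  simp [levelAt, baseLevel, baseWith]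

theorem length_levelAt (e : NodeInput) (m : List Bool) : ((levelAt e m).1.length : ℝ) =
    expTower m.length ((baseStates e.kinds e.width).length : ℝ) := by
  induction m with
  | nil => rw [length_levelAt_nil]; rfl
  | cons f m ih =>
    rw [length_levelAt_cons, List.length_cons, expTower, ← ih]
    push_cast
    rw [Real.rpow_natCast]

/-! ### The measure of an input -/

theorem sz_word_le' (w : Word) : sz w ≤ 4 * w.length + 1 := by
  have := sz_word_le w; omega

theorem sz_allRecs_nil_le (kinds : List Bool) : sz (allRecs [[]] (allWords kinds)) ≤
    (2 + (2 ^ kinds.length) ^ 2) * (8 * kinds.length + 10) + 1 := by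
  have h : (allRecs [[]] (allWords kinds)).length = 2 + (2 ^ kinds.length) ^ 2 := by
    rw [length_allRecs, length_allWords]; simp
  rw [← h]
  refine sz_le_of_forall (m := 8 * kinds.length + 9) fun r hr => ?_
  have hr := (wfRec_iff kinds [] r).1 hr
  rcases r with _ | _ | ⟨c, w, d⟩
  · rw [sz_none]; omega
  · rw [sz_some, sz_none]; omega
  · obtain ⟨hc, hw, hd⟩ := hr c w d rfl
    have h1 := sz_word_le' c
    have h2 := sz_word_le' w
    have h3 := sz_word_le' d
    simp only [List.length_nil] at hc
    simp only [sz_some, sz_pair]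
    omega

theorem sz_matrix_le {kinds : List Bool} {L : List BState} (h : L.Sublist (baseStates kinds [])) :
    sz L ≤ (baseStates kinds []).length *
      (kinds.length * ((2 + (2 ^ kinds.length) ^ 2) * (8 * kinds.length + 10) + 3) + 2) + 1 := by
  refine h.sz_le.trans (sz_le_of_forall fun s hs => (sz_of_mem_allStates hs).trans ?_)
  exact Nat.add_le_add_right (Nat.mul_le_mul_left _
    (Nat.add_le_add_right (sz_allRecs_nil_le kinds) 2)) 1

/-- The dominant term is the list of accepting states: at most M states of size O(M^4). The other
terms are linear in M, so the sum is at most 64 M^5, and 64 ≤ M^6 as M ≥ 2. -/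
theorem nodeMeasure_le_pow {e : NodeInput} (hq : e.kinds.length = e.flags.length + 1)
    (hm : e.matrix.Sublist (baseStates e.kinds [])) (h1 : e.2.2.1.length ≤ e.width.length)
    (h2 : e.2.2.2.length ≤ e.width.length) {M : ℕ} (hM1 : 2 ^ e.kinds.length ≤ M)
    (hM2 : 2 ^ e.width.length ≤ M) (hM3 : (levelAt e e.flags).1.length ≤ M) :
    nodeMeasure e ≤ M ^ 11 := by
  have hmat := sz_matrix_le hm
  have h00 : (baseStates e.kinds []).length ≤ M := by
    refine (length_baseStates_nil_le _ e.width).trans (le_trans ?_ hM3)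
    rw [← length_levelAt_nil]
    exact length_levelAt_mono e (List.nil_suffix)
  unfold nodeMeasure
  obtain ⟨⟨⟨kinds, flags, matrix⟩, width⟩, ⟨b1, b2⟩, c1, c2⟩ := e
  simp only [NodeInput.kinds, NodeInput.flags, NodeInput.matrix, NodeInput.width] at *
  have s1 := sz_word_le' kinds
  have s2 := sz_word_le' flags
  have s3 := sz_word_le' width
  have s4 := sz_word_le' c1
  have s5 := sz_word_le' c2
  have s6 := sz_bool b1
  have s7 := sz_bool b2
  have hk : kinds.length ≤ M := Nat.lt_two_pow_self.le.trans hM1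
  have hw : width.length ≤ M := Nat.lt_two_pow_self.le.trans hM2
  have hM : 2 ≤ M := (Nat.le_self_pow (by omega) 2).trans hM1
  have hmat' : sz matrix ≤ 28 * M ^ 5 + 1 := by
    refine hmat.trans ?_
    have a1 : 2 + (2 ^ kinds.length) ^ 2 ≤ 2 * M ^ 2 := by nlinarith [Nat.pow_le_pow_left hM1 2]
    have a2 : 8 * kinds.length + 10 ≤ 13 * M := by omega
    have a3 := Nat.mul_le_mul a1 a2
    have a4 : (2 + (2 ^ kinds.length) ^ 2) * (8 * kinds.length + 10) + 3 ≤ 27 * M ^ 3 := by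
      nlinarith [Nat.pow_le_pow_left hM 3]
    have a5 := Nat.mul_le_mul hk a4
    have a6 : kinds.length * ((2 + (2 ^ kinds.length) ^ 2) * (8 * kinds.length + 10) + 3) + 2 ≤
        28 * M ^ 4 := by nlinarith [Nat.pow_le_pow_left hM 4]
    have a7 := Nat.mul_le_mul h00 a6
    have a8 : M * (28 * M ^ 4) = 28 * M ^ 5 := by ring
    omega
  have hM5 : M ≤ M ^ 5 := Nat.le_self_pow (by omega) M
  have hM6 : 64 * M ^ 5 ≤ M ^ 11 := by
    have := Nat.mul_le_mul_right (M ^ 5) (Nat.pow_le_pow_left hM 6)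
    calc 64 * M ^ 5 = 2 ^ 6 * M ^ 5 := by norm_num
      _ ≤ M ^ 6 * M ^ 5 := this
      _ = M ^ 11 := by ring
  have hM7 : 32 ≤ M ^ 5 := Nat.pow_le_pow_left hM 5
  have hW2 : 2 ^ (width.length + 1) ≤ 2 * M := by rw [pow_succ]; omega
  simp only [sz_pair]
  omega

theorem nodeMeasure_le_expTower {e : NodeInput} (hq : e.kinds.length = e.flags.length + 1)
    (hm : e.matrix.Sublist (baseStates e.kinds [])) (h1 : e.2.2.1.length ≤ e.width.length)
    (h2 : e.2.2.2.length ≤ e.width.length) {p : ℝ} (hp : 1 ≤ p) (hw : (e.width.length : ℝ) ≤ p)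
    (hN : ((e.kinds.count true * (e.width.length + 2 + 2 * e.kinds.length) : ℕ) : ℝ) ≤ 5 * p) :
    (nodeMeasure e : ℝ) ≤ expTower e.kinds.length (55 * p) := by
  have hp5 : 1 ≤ 5 * p := by linarith
  have hq1 : 1 ≤ e.kinds.length := by omega
  set M := max (max (2 ^ e.kinds.length) (2 ^ e.width.length)) (levelAt e e.flags).1.length with hM
  have hMr : (M : ℝ) ≤ expTower e.kinds.length (5 * p) := by
    rw [hM]
    push_cast
    refine max_le (max_le (two_pow_le_expTower hq1 hp5) ?_) ?_
    · refine le_trans ?_ (two_rpow_le_expTower hq1 hp5)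
      rw [← Real.rpow_natCast]
      exact Real.rpow_le_rpow_of_exponent_le (by norm_num) (by linarith)
    -- There are at most 2^(5p) base states and one exponential for each of the q - 1 flags, which
    -- makes a tower of height q over 5p.
    · rw [length_levelAt, hq, ← expTower_two_rpow]
      refine expTower_mono _ ?_
      have h3 : ((baseStates e.kinds e.width).length : ℝ) ≤
          2 ^ (e.kinds.count true * (e.width.length + 2 + 2 * e.kinds.length)) := by
        exact_mod_cast length_baseStates_le e.kinds e.width
      refine h3.trans ?_
      rw [← Real.rpow_natCast]
      exact Real.rpow_le_rpow_of_exponent_le (by norm_num) hN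
  have h3 := nodeMeasure_le_pow hq hm h1 h2 (M := M) (by simp [hM]) (by simp [hM]) (by simp [hM])
  calc (nodeMeasure e : ℝ) ≤ (M : ℝ) ^ 11 := by exact_mod_cast h3
    _ ≤ expTower e.kinds.length (5 * p) ^ 11 := by gcongr
    _ ≤ expTower e.kinds.length ((11 : ℕ) * (5 * p)) := pow_expTower_le hq1 hp5 (by norm_num)
    _ = expTower e.kinds.length (55 * p) := by norm_num; ring_nf

theorem length_nodeFn_le_expTower {e : NodeInput} (hq : 1 ≤ e.kinds.length) {p : ℝ} (hp : 1 ≤ p)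
    (h : (nodeMeasure e : ℝ) ≤ expTower e.kinds.length p) :
    ((nodeFn e).length : ℝ) ≤ expTower e.kinds.length (7 * p) := by
  have h1 := length_nodeFn_le e
  have h2 := pow_kinds_le_nodeMeasure e
  have h3 := length_le_nodeMeasure e
  have h4 : 2 ≤ nodeMeasure e := (Nat.le_self_pow (by omega) 2).trans h2
  have h5 : (nodeFn e).length ≤ nodeMeasure e ^ 7 := by
    have h6 : (levelAt e e.flags).1.length ^ 2 ≤ nodeMeasure e ^ 2 := Nat.pow_le_pow_left h3 2
    -- The factor 17 = 8 + 8 + 1 is below 2^5, hence below the fifth power of the measure; this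
    -- yields the exponent 7.
    have h7 : (nodeFn e).length ≤ 17 * nodeMeasure e ^ 2 := by nlinarith
    have h8 : 17 ≤ nodeMeasure e ^ 5 := le_trans (by norm_num) (Nat.pow_le_pow_left h4 5)
    calc (nodeFn e).length ≤ 17 * nodeMeasure e ^ 2 := h7
      _ ≤ nodeMeasure e ^ 5 * nodeMeasure e ^ 2 := Nat.mul_le_mul_right _ h8
      _ = nodeMeasure e ^ 7 := by ring
  calc ((nodeFn e).length : ℝ) ≤ (nodeMeasure e : ℝ) ^ 7 := by exact_mod_cast h5
    _ ≤ expTower e.kinds.length p ^ 7 := by gcongr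
    _ ≤ expTower e.kinds.length ((7 : ℕ) * p) := pow_expTower_le hq hp (by norm_num)
    _ = expTower e.kinds.length (7 * p) := by norm_num

/-- The additional exponential of the time bound swallows any polynomial: N + 1 ≤ 2^N turns
coefficient and degree into a linear exponent. -/
theorem poly_le_expTower (C k : ℕ) {N q : ℕ} {p : ℝ} (hp : 1 ≤ p) (hN : (N : ℝ) ≤ expTower q p) :
    ((C * (N + 1) ^ k : ℕ) : ℝ) ≤ expTower (q + 1) ((C + k + 1 : ℕ) * p) := by
  have h1 : C * (N + 1) ^ k ≤ 2 ^ (C + k * N) := by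
    rw [pow_add, mul_comm k, pow_mul]
    exact Nat.mul_le_mul Nat.lt_two_pow_self.le (Nat.pow_le_pow_left Nat.lt_two_pow_self k)
  calc ((C * (N + 1) ^ k : ℕ) : ℝ) ≤ ((2 ^ (C + k * N) : ℕ) : ℝ) := by exact_mod_cast h1
    _ = (2 : ℝ) ^ ((C + k * N : ℕ) : ℝ) := by rw [Real.rpow_natCast]; push_cast; rfl
    _ ≤ (2 : ℝ) ^ expTower q ((C + k + 1 : ℕ) * p) := by
      refine Real.rpow_le_rpow_of_exponent_le (by norm_num) (le_trans ?_
        (mul_expTower_le q hp (by omega)).1)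
      have h2 := one_le_expTower q hp
      have h3 : (0 : ℝ) ≤ C := by positivity
      have h4 : (0 : ℝ) ≤ k := by positivity
      push_cast
      nlinarith
    _ = expTower (q + 1) ((C + k + 1 : ℕ) * p) := rfl

/-! ### Colors -/

theorem bits_injective : Function.Injective Nat.bits := fun m n h => by
  apply Nat.digits_inj_iff (b := 2).1
  rw [Nat.digits_two_eq_bits, Nat.digits_two_eq_bits, h]

section

variable {ω : ℕ}

theorem colorOf_injective : Function.Injective (colorOf (ω := ω) true) := fun _ _ h =>
  Fin.val_injective (bits_injective h)

theorem length_colorOf_le (b : Bool) (a : Fin ω) :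
    (colorOf b a).length ≤ (widthOf b ω).length := by
  cases b
  · exact le_rfl
  · change (a : ℕ).bits.length ≤ ω.bits.length
    rw [Nat.size_eq_bits_len, Nat.size_eq_bits_len]
    exact Nat.size_le_size a.2.le

theorem length_opAt_le (b : Bool) {D : CWDecomp ω} (t : D.Node) :
    (opAt (colorOf b) t).2.1.length ≤ (widthOf b ω).length ∧
      (opAt (colorOf b) t).2.2.length ≤ (widthOf b ω).length := by
  induction t with
  | introRoot => exact ⟨length_colorOf_le _ _, Nat.zero_le _⟩
  | joinRoot => exact ⟨Nat.zero_le _, Nat.zero_le _⟩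
  | recolorRoot => exact ⟨length_colorOf_le _ _, length_colorOf_le _ _⟩
  | addEdgesRoot => exact ⟨length_colorOf_le _ _, length_colorOf_le _ _⟩
  | joinLeft s ih | joinRight s ih | recolorSub s ih | addEdgesSub s ih => exact ih

theorem one_le_width (D : CWDecomp ω) : 1 ≤ ω := by
  induction D with
  | intro a => exact Nat.one_le_of_lt a.2
  | join l r ih _ | recolor a b t ih | addEdges a b t ih => exact ih

theorem nonempty_vertex (D : CWDecomp ω) : Nonempty D.Vertex := by
  induction D with
  | intro a => exact ⟨()⟩
  | join l r ih _ => exact ih.map Sum.inl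
  | recolor a b t ih | addEdges a b t ih => exact ih

theorem finite_vertex (D : CWDecomp ω) : Finite D.Vertex := by
  induction D with
  | intro a => exact inferInstanceAs (Finite Unit)
  | join l r ihl ihr => exact inferInstanceAs (Finite (l.Vertex ⊕ r.Vertex))
  | recolor a b t ih | addEdges a b t ih => exact ih

end

/-! ### The parameter of the bounds -/

theorem one_le_msoParam (q qv ω : ℕ) : 1 ≤ msoParam q qv ω := le_max_left _ _

/-- The binary length of ω is at most log ω + 1, so the second quantity is at most q_v (log ω + 3 +
2 q) ≤ 5 q_v (q + log ω), using q ≥ 1. For q_v = 0 the width is empty. -/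
theorem length_widthOf_le {b : Bool} {q qv ω : ℕ} (hq : 1 ≤ q) (hω : 1 ≤ ω)
    (hb : b = true ↔ 1 ≤ qv) : ((widthOf b ω).length : ℝ) ≤ msoParam q qv ω ∧
      ((qv * ((widthOf b ω).length + 2 + 2 * q) : ℕ) : ℝ) ≤ 5 * msoParam q qv ω := by
  have h1 := one_le_msoParam q qv ω
  cases b
  · have h0 : qv = 0 := by simpa using hb
    subst h0
    simp only [widthOf, cond_false, List.length_nil, zero_mul, Nat.cast_zero]
    exact ⟨by linarith, by linarith⟩
  · have hv : (1 : ℝ) ≤ qv := by exact_mod_cast hb.1 rfl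
    have hq' : (1 : ℝ) ≤ q := by exact_mod_cast hq
    have hlog : 0 ≤ Real.logb 2 ω := Real.logb_nonneg (by norm_num) (by exact_mod_cast hω)
    have h2 : (qv : ℝ) * (q + Real.logb 2 ω) ≤ msoParam q qv ω := le_max_right _ _
    have hW : ((widthOf true ω).length : ℝ) ≤ Real.logb 2 ω + 1 := by
      have e : (widthOf true ω).length = ω.size := Nat.size_eq_bits_len ω
      rw [e]
      have hs : 0 < ω.size := Nat.lt_size.2 hω
      have h3 : 2 ^ (ω.size - 1) ≤ ω := Nat.lt_size.1 (by omega)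
      have h4 : ((ω.size - 1 : ℕ) : ℝ) ≤ Real.logb 2 ω := by
        rw [Real.le_logb_iff_rpow_le (by norm_num) (by exact_mod_cast hω), Real.rpow_natCast]
        exact_mod_cast h3
      rw [Nat.cast_sub hs] at h4
      push_cast at h4
      linarith
    push_cast
    constructor <;> nlinarith

/-- Accepting witnesses exist for exactly the vertex sets that satisfy the formula. -/
theorem exists_isLocal_iff {Q : List Quant} {M : Matrx} {b : Bool}
    (hb : b = true ↔ true ∈ (paramsOf Q M).1) {ω : ℕ} (D : CWDecomp ω) (S : D.Vertex → Bool) :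
    (∃ α : D.Node → Word, (IsLocal (paramsOf Q M) (colorOf b) (widthOf b ω) D α ∧
      α D.root ∈ acceptFn ((paramsOf Q M, widthOf b ω), defaultOp)) ∧
      ∀ v, memBit (α (D.leaf v)) = S v) ↔ QSat Q (M.Holds D.graph) [.set {v | S v = true}] := by
  have hκ : true ∈ (paramsOf Q M).1 → ∀ a : Fin ω, (colorOf b a).length ≤ (widthOf b ω).length :=
    fun _ => length_colorOf_le b
  rw [exists_witness_iff hκ (by simp [paramsOf]) ?_]
  · exact satAt_paramsOf Q M hκ (fun h => by rw [hb.2 h]; exact colorOf_injective) D S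
  -- States must be recoverable from words. Without quantifiers the only variable is the free set
  -- variable, and all records are `none`.
  · cases Q with
    | nil => exact Or.inr (by simp [paramsOf])
    | cons q Q => exact Or.inl (by simp [paramsOf])

/-! ### The theorem. -/

theorem mainTheorem3 :
    ∃ c : ℝ, 0 < c ∧
      ∀ (P : VertexProblem) (Φ' : MSO1 0 1), P.ExpressedBy Φ' →
        ∀ (q qv : ℕ), q = (MSO1.exS Φ').numQ → qv = (MSO1.exS Φ').numV →
          ∃ 𝔠 : DPCore, 𝔠.Monotone P ∧
            ∀ (ω : ℕ) (D : CWDecomp ω),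
              (𝔠.time D : ℝ) ≤
                (Fintype.card D.Node : ℝ) * expTower (q + 1) (c * msoParam q qv ω) ∧
              (𝔠.size D : ℝ) ≤ expTower q (c * msoParam q qv ω) := by
  obtain ⟨C, k, hcore⟩ := exists_core_of_params
  -- The measure is at most T_q(55 p). The first summand serves the time via `poly_le_expTower`, the
  -- second, 7 · 55, serves the size.
  refine ⟨(C + k + 1 : ℕ) * 55 + 385, by positivity, ?_⟩
  rintro P Φ hP q qv hq hqv
  obtain ⟨Q, M, hV, hS, hQ⟩ := exists_prenex Φ Fin.elim0 (fun _ => 0)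
  classical
  -- Colors are kept only if there is a vertex variable; otherwise nothing may depend on ω.
  set b : Bool := decide (true ∈ (paramsOf Q M).1)
  have hb : b = true ↔ true ∈ (paramsOf Q M).1 := decide_eq_true_iff
  obtain ⟨𝔠, h𝔠⟩ := hcore (paramsOf Q M) b
  have hlen : (paramsOf Q M).1.length = q := by
    have h1 := List.count_false_add_count_true (Q.map Prod.fst)
    rw [hV, hS, List.length_map] at h1
    rw [hq]
    simp only [paramsOf, List.length_append, List.length_reverse, List.length_map,
      List.length_singleton, MSO1.numQ, MSO1.numV, MSO1.numS]
    omega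
  have hcount : (paramsOf Q M).1.count true = qv := by
    rw [hqv, MSO1.numV, ← hV]
    simp [paramsOf]
  have hflags : (paramsOf Q M).1.length = (paramsOf Q M).2.1.length + 1 := by simp [paramsOf]
  have hq1 : 1 ≤ q := by omega
  refine ⟨𝔠, ⟨memBit, fun V G ω D i S => ?_⟩, fun ω D => ?_⟩
  · obtain ⟨hacc, hproc, -⟩ := h𝔠 ω D
    have := finite_vertex D
    have := nonempty_vertex D
    have : Finite V := Finite.of_equiv _ i.symm.toEquiv
    rw [hP V G S, MSO1.sat_iso i, hQ D.Vertex D.graph _ (fun _ => i '' S) [.set (i '' S)]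
      (fun j => j.elim0) (fun _ => rfl)]
    have hS : i '' S = {v | decide (v ∈ i '' S) = true} := by
      ext v; exact decide_eq_true_iff.symm
    rw [hS, ← exists_isLocal_iff hb]
    refine exists_congr fun α => and_congr ?_ ?_
    · simp only [DPCore.IsWitness, IsLocal, hproc, hacc]
    · constructor
      · intro h
        ext v
        change v ∈ S ↔ memBit (α (D.leaf (i v))) = true
        rw [h, decide_eq_true_iff, i.injective.mem_set_image]
      · intro h v
        obtain ⟨v, rfl⟩ := i.surjective v
        rw [Bool.eq_iff_iff, decide_eq_true_iff, i.injective.mem_set_image, h]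
        rfl
  · obtain ⟨-, hproc, htime⟩ := h𝔠 ω D
    have hp := one_le_msoParam q qv ω
    obtain ⟨hW, hN⟩ := length_widthOf_le (b := b) (qv := qv) hq1 (one_le_width D)
      (by rw [hb, ← hcount, Nat.succ_le_iff, List.count_pos_iff])
    set p := msoParam q qv ω
    have hp' : 1 ≤ 55 * p := by linarith
    have hmeas : ∀ o : Op, o.2.1.length ≤ (widthOf b ω).length →
        o.2.2.length ≤ (widthOf b ω).length →
        (nodeMeasure ((paramsOf Q M, widthOf b ω), o) : ℝ) ≤ expTower q (55 * p) := by
      intro o h1 h2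
      have := nodeMeasure_le_expTower (e := ((paramsOf Q M, widthOf b ω), o)) hflags
        List.filter_sublist h1 h2 hp hW (by
          change ((List.count true (paramsOf Q M).1 *
            ((widthOf b ω).length + 2 + 2 * (paramsOf Q M).1.length) : ℕ) : ℝ) ≤ _
          rw [hlen, hcount]
          exact hN)
      change _ ≤ expTower (paramsOf Q M).1.length _ at this
      rwa [hlen] at this
    have hnode : ∀ t : D.Node,
        (nodeMeasure ((paramsOf Q M, widthOf b ω), opAt (colorOf b) t) : ℝ) ≤
          expTower q (55 * p) := fun t =>
      hmeas _ (length_opAt_le b t).1 (length_opAt_le b t).2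
    have hdef := hmeas defaultOp (Nat.zero_le _) (Nat.zero_le _)
    have hC : (0 : ℝ) ≤ (C + k + 1 : ℕ) := Nat.cast_nonneg _
    constructor
    · have h0 : (0 : ℝ) ≤ expTower q (55 * p) := by linarith [one_le_expTower q hp']
      have h1 := htime ⌊expTower q (55 * p)⌋₊ (fun t => Nat.le_floor (hnode t)) (Nat.le_floor hdef)
      calc (𝔠.time D : ℝ) ≤ (Fintype.card D.Node : ℝ) *
            ((C * (⌊expTower q (55 * p)⌋₊ + 1) ^ k : ℕ) : ℝ) := by exact_mod_cast h1
        _ ≤ _ := by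
          refine mul_le_mul_of_nonneg_left ?_ (Nat.cast_nonneg _)
          refine (poly_le_expTower C k hp' (Nat.floor_le h0)).trans (expTower_mono _ ?_)
          nlinarith
    · have h2 : ∀ t : D.Node, ((𝔠.process D t).toFinset.card : ℝ) ≤ expTower q (7 * (55 * p)) := by
        intro t
        refine le_trans (Nat.cast_le.2 (List.toFinset_card_le _)) ?_
        rw [hproc]
        have h3 := length_nodeFn_le_expTower
          (e := ((paramsOf Q M, widthOf b ω), opAt (colorOf b) t)) (p := 55 * p)
          (hlen.symm ▸ hq1) hp' (by
            change _ ≤ expTower (paramsOf Q M).1.length _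
            rw [hlen]
            exact hnode t)
        change _ ≤ expTower (paramsOf Q M).1.length _ at h3
        rwa [hlen] at h3
      have h4 : 𝔠.size D ≤ ⌊expTower q (7 * (55 * p))⌋₊ :=
        Finset.sup_le fun t _ => Nat.le_floor (h2 t)
      have h5 : (0 : ℝ) ≤ expTower q (7 * (55 * p)) := by
        linarith [one_le_expTower q (x := 7 * (55 * p)) (by linarith)]
      refine ((Nat.cast_le.2 h4).trans (Nat.floor_le h5)).trans (expTower_mono _ ?_)
      nlinarith
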